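/- **Setting.** Let $n\ge 1$, $\mu\ge 1$ be integers. For a stochastic sequence $\xi$ put $\xi^{(n)}(m,s)=\sum_{l=0}^n(-1)^l\binom nl\xi(m-ls)$. A *spectral density* is a nonnegative integrable function on $(-\pi,\pi]$ (identified up to null sets). The sequence $\xi$ (over a probability space) has stationary $n$th increments with spectral density $f$ if the increments are square integrable with mean $0$ and, for all integers $m_0,m,s_1,s_2$, $$\mathsf E\,\xi^{(n)}(m_0+m,s_1)\overline{\xi^{(n)}(m_0,s_2)}=\frac1{2\pi}\int_{-\pi}^{\pi}e^{i\lambda m}(1-e^{-is_1\lambda})^n(1-e^{is_2\lambda})^n\lambda^{-2n}f(\lambda)\,d\lambda .$$ Let $\sum_k d_\mu(k)x^k=(\sum_j x^{\mu j})^n$. Let $a(0),a(1),\dots\in\mathbb C$ be such that the series $b_\mu(k)=(D^\mu a)_k=\sum_{m\ge k}a(m)d_\mu(m-k)$ converge, $\sum_k|b_\mu(k)|<\infty$ and $\sum_k(k+1)|b_\mu(k)|^2<\infty$. The matrices $D^\mu$, $A$ have entries $D^\mu_{k,l}=d_\mu(l-k)$ for $l\ge k$ and $0$ otherwise, and $A_{l,m}=a(l+m)$;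 $D^\mu A$ is their product. The functional $A\xi=\sum_{k\ge0}a(k)\xi(k)$ is understood as $A\xi=B\xi-V\xi$, where $B\xi=\sum_{k\ge0}b_\mu(k)\xi^{(n)}(k,\mu)$ and $V\xi=\sum_{k=-\mu n}^{-1}v_\mu(k)\xi(k)$, $v_\mu(k)=\sum_{-k/\mu\le l\le n}(-1)^l\binom nl b_\mu(l\mu+k)$. Put $\chi(\lambda)=(1-e^{-i\lambda\mu})^n/(i\lambda)^n$, $A(e^{i\lambda})=\sum_k b_\mu(k)e^{i\lambda k}$, and let $L_2^{0-}(f)$ be the closed span of $\{e^{i\lambda k}\chi(\lambda):k\le-1\}$ in $L_2(\tfrac1{2\pi}f\,d\lambda)$. A *spectral characteristic* under $f$ is a function $h$ with $h\chi\in L_2^{0-}(f)$. It determines the linear estimate $\hat A\xi=-V\xi+\int h\chi\,dZ$, where $\int g\,dZ$ is the mean square isometric image of $g\in L_2(\tfrac1{2\pi}f\,d\lambda)$ under $e^{i\lambda m}\chi\mapsto\xi^{(n)}(m,\mu)$. Put $$\Delta(h;f)=\frac1{2\pi}\int_{-\pi}^{\pi}|A(e^{i\lambda})-h(\lambda)|^2|\chi(\lambda)|^2f(\lambda)\,d\lambda,\qquad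 \Delta(f)=\inf_h\Delta(h;f),$$ the infimum being over the spectral characteristics under $f$. An $f^0\in D$ is *least favorable* in a class $D$ of densities if $\Delta(f)\le\Delta(f^0)$ for all $f\in D$. With $H_D$ the set of functions that are spectral characteristics under every $f\in D$, $h^0$ is *minimax-robust* for $D$ if $h^0\in H_D$, $\max_{f\in D}\Delta(h^0;f)$ is attained, and it is $\le\sup_{f\in D}\Delta(h;f)$ for every $h\in H_D$. A sequence $\varphi=(\varphi(k))_{k\ge0}$ of complex numbers is *canonical* if $\Phi(z)=\sum_k\varphi(k)z^k$ has radius of convergence $>1$ and no zeros in $|z|\le1$; it then gives the canonical factorization of the density $f_\varphi(\lambda)=|\Phi(e^{-i\lambda})|^2$. Let $$w_\mu(z)=\sum_{k\ge0}w_\mu(k)z^k=\exp\Big\{\frac1{4\pi}\int_{-\pi}^{\pi}\frac{e^{i\lambda}+z}{e^{i\lambda}-z}\ln\frac{|1-e^{-i\lambda\mu}|^{2n}}{\lambda^{2n}}\,d\lambda\Big\}\quad(|z|<1),$$ $\varphi_\mu(k)=(W^\mu\varphi)_k=\sum_{j\le k}w_\mu(k-j)\varphi(j)$, $\Phi_\mu(z)=\sum_k\varphi_\mu(k)z^k$,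 $r_\varphi(e^{i\lambda})=\sum_{k\ge0}(D^\mu A\varphi_\mu)_ke^{i\lambda k}$, and $$h_\varphi(\lambda)=A(e^{i\lambda})-r_\varphi(e^{i\lambda})\,\Phi_\mu(e^{-i\lambda})^{-1}.$$ Let $v\le u$ be spectral densities, $P_0>0$, and $$D_v^u=\Big\{f:\ v\le f\le u,\ \frac1{2\pi}\int_{-\pi}^{\pi}f\,d\lambda\le P_0\Big\}.$$ Let $S$ be the set of canonical $\varphi$ with $\|\varphi\|^2=P_0$, $v\le f_\varphi\le u$ and $D^\mu AW^\mu\varphi=\alpha\overline\varphi$ for some $\alpha\in\mathbb C$. Let $S^+$ be the set of pairs $(c,\varphi)$ with $c\in\mathbb C$ and $\varphi$ canonical such that $\|\varphi\|^2=P_0$ and $f_\varphi=f_{c,\varphi}$ almost everywhere, where $$f_{c,\varphi}(\lambda)=\max\Big\{v(\lambda),\min\Big\{u(\lambda),\Big|c\sum_{k\ge0}(D^\mu A\varphi_\mu)_ke^{i\lambda k}\Big|^2\Big\}\Big\}.$$ Let $\nu_uP_0=\sup_{\varphi\in S}\|D^\mu AW^\mu\varphi\|^2$ and $\nu_u^+P_0=\sup_{(c,\varphi)\in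 S^+}\|D^\mu AW^\mu\varphi\|^2$, where the supremum over the empty set is $0$. **Theorem 7.1.** 1. Let $f$ be any spectral density and let $\xi$ have stationary $n$th increments with spectral density $f$. For every spectral characteristic $h$ under $f$ the corresponding estimate $\hat A\xi$ exists and $\mathsf E|A\xi-\hat A\xi|^2=\Delta(h;f)$. The infimum of $\mathsf E|A\xi-(-V\xi+X)|^2$ over all $X$ in the closed span of $\{\xi^{(n)}(m,\mu):m\le-1\}$ equals $\Delta(f)$. 2. If $\varphi^0\in S$ and $\nu_uP_0=\nu_u^+P_0=\|D^\mu AW^\mu\varphi^0\|^2$, then the density $f_{\varphi^0}=\big|\sum_k\varphi^0(k)e^{-i\lambda k}\big|^2$ is least favorable in $D_v^u$ for the optimal linear estimation of $A\xi$. Every $\xi$ having stationary $n$th increments with this spectral density admits the canonical one-sided moving average representation $\xi^{(n)}(m,\mu)=\sum_{k\ge0}\varphi^0_\mu(k)\varepsilon(m-k)$ in mean square, where $\varphi^0_\mu=W^\mu\varphi^0$ and $\varepsilon$ is an uncorrelated sequence of mean $0$ and variance $1$ such that, for each $t$, $\{\varepsilon(m):m\le t\}$ and $\{\xi^{(n)}(m,s):m\le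 t,\ s>0\}$ have the same closed span. The function $h_{\varphi^0}$ is the spectral characteristic of the optimal estimate under $f_{\varphi^0}$ and is minimax-robust for $D_v^u$. 3. If $\nu_u<\nu_u^+$, then $S^+$ is nonempty, and for every $(c,\varphi)\in S^+$ the density $f_{c,\varphi}$ is least favorable in $D_v^u$. Every $\xi$ with this spectral density admits the canonical moving average representation with coefficients $\varphi_\mu=W^\mu\varphi$. Moreover $\varphi$ solves the extremum problem $\|D^\mu AW^\mu\psi\|^2\to\max$ over the canonical $\psi$ with $f_\psi\in D_v^u$, and $\int_{-\pi}^{\pi}f_{c,\varphi}\,d\lambda=2\pi P_0$. The function $h_\varphi$ is the spectral characteristic of the optimal estimate under $f_{c,\varphi}$ and is minimax-robust for $D_v^u$. -/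

import Mathlib

open MeasureTheory Filter Topology Complex
open scoped ENNReal NNReal Real ComplexConjugate

universe w

noncomputable section

/-! ### Square-integrable functions and closed spans -/

/-- The closed linear subspace of `L²(ν)` generated by the functions in `S`: all (a.e. strongly
measurable) functions which are `L²(ν)`-limits of finite linear combinations of members of `S`. -/
def closedSpanL2 {α : Type*} [MeasurableSpace α] (ν : Measure α) (S : Set (α → ℂ)) :
    Set (α → ℂ) :=
  {g | AEStronglyMeasurable g ν ∧
    ∀ ε : ℝ≥0∞, 0 < ε → ∃ p ∈ Submodule.span ℂ S, eLpNorm (g - p) 2 ν ≤ ε}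

/-- Squared `ℓ²` norm of a sequence, with value `∞` off `ℓ²`. -/
def l2sq (x : ℕ → ℂ) : ℝ≥0∞ := ∑' k, ‖x k‖ₑ ^ 2

/-! ### Spectral densities -/

/-- Lebesgue measure on the frequency interval. -/
def freqMeasure : Measure ℝ := volume.restrict (Set.Ioc (-π) π)

/-- A spectral density: a nonnegative integrable function on the frequency interval. -/
def IsSpectralDensity (f : ℝ → ℝ) : Prop :=
  (∀ᵐ t ∂freqMeasure, 0 ≤ f t) ∧ Integrable f freqMeasure

/-- The spectral measure `dF(t) = f(t) dt / 2π`. -/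
def specMeasure (f : ℝ → ℝ) : Measure ℝ :=
  freqMeasure.withDensity fun t => ENNReal.ofReal (f t / (2 * π))

/-- The band class: `v ≤ f ≤ u`, total power at most `P₀`. -/
def bandClass (v u : ℝ → ℝ) (P₀ : ℝ) : Set (ℝ → ℝ) :=
  {f | IsSpectralDensity f ∧ (∀ᵐ t ∂freqMeasure, v t ≤ f t ∧ f t ≤ u t) ∧
    (1 / (2 * π)) * ∫ t, f t ∂freqMeasure ≤ P₀}

/-- The factor `χ(t) = (1 - e^{-itμ})^n / (it)^n`. -/
def incrFactor (n μ : ℕ) (t : ℝ) : ℂ :=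
  (1 - exp (-(I * t * μ))) ^ n / (I * t) ^ n

/-! ### Stochastic sequences with stationary `n`th increments -/

/-- The `n`th increment `ξ⁽ⁿ⁾(m, s)` with step `s`. -/
def increment {Ω : Type*} (n : ℕ) (ξ : ℤ → Ω → ℂ) (m s : ℤ) (ω : Ω) : ℂ :=
  ∑ l ∈ Finset.range (n + 1), (-1) ^ l * (n.choose l : ℂ) * ξ (m - l * s) ω

/-- `ξ` has wide sense stationary mean zero `n`th increments with spectral density `f`. -/
structure HasIncrementDensity {Ω : Type*} [MeasurableSpace Ω] (P : Measure Ω) (n : ℕ)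
    (f : ℝ → ℝ) (ξ : ℤ → Ω → ℂ) : Prop where
  memLp : ∀ m s : ℤ, MemLp (increment n ξ m s) 2 P
  mean_zero : ∀ m s : ℤ, ∫ ω, increment n ξ m s ω ∂P = 0
  structural : ∀ m₀ m s₁ s₂ : ℤ,
    ∫ ω, increment n ξ (m₀ + m) s₁ ω * conj (increment n ξ m₀ s₂ ω) ∂P =
      ∫ t : ℝ, exp (I * t * m) * (1 - exp (-(I * s₁ * t))) ^ n * (1 - exp (I * s₂ * t)) ^ n
        * (1 / (t : ℂ) ^ (2 * n)) ∂(specMeasure f)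

/-- One-sided (canonical) moving average representation of the step `μ` increments with
coefficients `ψ`: there is an orthonormal mean zero sequence `ε` generating, up to each time, the
same closed space as the increments, such that `ξ⁽ⁿ⁾(m, μ) = ∑ ψ(k) ε(m - k)` in mean square. -/
def HasMovingAverage {Ω : Type*} [MeasurableSpace Ω] (P : Measure Ω) (n μ : ℕ)
    (ψ : ℕ → ℂ) (ξ : ℤ → Ω → ℂ) : Prop :=
  ∃ ε : ℤ → Ω → ℂ,
    (∀ m, MemLp (ε m) 2 P) ∧ (∀ m, ∫ ω, ε m ω ∂P = 0) ∧
    (∀ m k, ∫ ω, ε m ω * conj (ε k ω) ∂P = if m = k then 1 else 0) ∧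
    (∀ t : ℤ, closedSpanL2 P {X | ∃ m s : ℤ, m ≤ t ∧ 0 < s ∧ X = increment n ξ m s} =
      closedSpanL2 P {X | ∃ m : ℤ, m ≤ t ∧ X = ε m}) ∧
    (Summable fun k => ‖ψ k‖ ^ 2) ∧
    ∀ m : ℤ, Tendsto (fun N : ℕ => eLpNorm
      (fun ω => increment n ξ m μ ω - ∑ k ∈ Finset.range N, ψ k * ε (m - k) ω) 2 P)
      atTop (𝓝 0)

/-! ### The functional and its linear estimates -/

/-- Coefficients `d_μ(k)` of `(∑ x^{μ j})^n`. -/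
def dCoef (n μ : ℕ) (k : ℕ) : ℂ :=
  PowerSeries.coeff k ((PowerSeries.mk fun j => if μ ∣ j then (1 : ℂ) else 0) ^ n)

/-- `b_μ(k) = (D^μ a)_k = ∑_{m ≥ k} a(m) d_μ(m - k)`, as an ordinary (ordered) series. -/
def bCoef (a : ℕ → ℂ) (n μ : ℕ) (k : ℕ) : ℂ :=
  ∑'[SummationFilter.conditional ℕ] l, a (k + l) * dCoef n μ l

/-- Standing conditions on the coefficients: the series for `b_μ` converge,
`∑ |b_μ(k)| < ∞` and `∑ (k+1) |b_μ(k)|² < ∞`. -/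
structure AdmissibleCoef (a : ℕ → ℂ) (n μ : ℕ) : Prop where
  converges : ∀ k, Summable (fun l => a (k + l) * dCoef n μ l) (SummationFilter.conditional ℕ)
  summable_b : Summable fun k => ‖bCoef a n μ k‖
  summable_b_sq : Summable fun k : ℕ => ((k : ℝ) + 1) * ‖bCoef a n μ k‖ ^ 2

/-- Entries of the matrix product `D^μ A`, where `A_{l,m} = a(l + m)` and
`D^μ_{k,l} = d_μ(l - k)` for `l ≥ k`. -/
def DAentry (a : ℕ → ℂ) (n μ : ℕ) (k m : ℕ) : ℂ :=
  ∑'[SummationFilter.conditional ℕ] l, dCoef n μ l * a (k + l + m)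

/-- `(D^μ A x)_k`. -/
def DAapply (a : ℕ → ℂ) (n μ : ℕ) (x : ℕ → ℂ) (k : ℕ) : ℂ :=
  ∑' m, DAentry a n μ k m * x m

/-- The functional `B ξ = ∑ b_μ(k) ξ⁽ⁿ⁾(k, μ)`. -/
def functionalB {Ω : Type*} (a : ℕ → ℂ) (n μ : ℕ) (ξ : ℤ → Ω → ℂ) (ω : Ω) : ℂ :=
  ∑' k : ℕ, bCoef a n μ k * increment n ξ k μ ω

/-- The functional `V ξ = ∑_{k=-μn}^{-1} v_μ(k) ξ(k)` of the observed initial values, where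
`v_μ(k) = ∑_{⌈-k/μ⌉ ≤ l ≤ n} (-1)^l C(n,l) b_μ(lμ + k)`; here `k = -j`. -/
def functionalV {Ω : Type*} (a : ℕ → ℂ) (n μ : ℕ) (ξ : ℤ → Ω → ℂ) (ω : Ω) : ℂ :=
  ∑ j ∈ Finset.Icc 1 (μ * n),
    (∑ l ∈ (Finset.range (n + 1)).filter (fun l => j ≤ l * μ),
      (-1) ^ l * (n.choose l : ℂ) * bCoef a n μ (l * μ - j)) * ξ (-(j : ℤ)) ω

/-- The functional `A ξ = ∑ a(k) ξ(k)`, through its representation `A ξ = B ξ - V ξ` (an identity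
of finite sums if `a` has finite support, and the meaning of the formal series otherwise). -/
def functionalA {Ω : Type*} (a : ℕ → ℂ) (n μ : ℕ) (ξ : ℤ → Ω → ℂ) (ω : Ω) : ℂ :=
  functionalB a n μ ξ ω - functionalV a n μ ξ ω

/-- Mean square error `E|Aξ - Âξ|²` of the estimate `Âξ = -Vξ + X`. -/
def estimateError {Ω : Type*} [MeasurableSpace Ω] (P : Measure Ω) (a : ℕ → ℂ) (n μ : ℕ)
    (ξ : ℤ → Ω → ℂ) (X : Ω → ℂ) : ℝ≥0∞ :=
  ∫⁻ ω, ‖functionalA a n μ ξ ω - (-functionalV a n μ ξ ω + X ω)‖ₑ ^ 2 ∂P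

/-- The mean square error of the optimal linear estimate: `X` runs through the closed space
generated by the observed increments. -/
def optimalEstimateError {Ω : Type*} [MeasurableSpace Ω] (P : Measure Ω) (a : ℕ → ℂ)
    (n μ : ℕ) (ξ : ℤ → Ω → ℂ) : ℝ≥0∞ :=
  ⨅ X ∈ closedSpanL2 P {Y | ∃ m : ℤ, m ≤ -1 ∧ Y = increment n ξ m μ}, estimateError P a n μ ξ X

/-- `X = ∫ h(t) χ(t) dZ(t)`, where `Z` is the orthogonal stochastic measure of the increments: `X`
is a mean square limit of linear combinations of increments `ξ⁽ⁿ⁾(m, μ)`, `m ≤ -1`, such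
that the same combinations of the functions `e^{itm} χ(t)` tend to `h χ` in `L²(f)`. -/
def HasSpectralCharacteristic {Ω : Type*} [MeasurableSpace Ω] (P : Measure Ω) (n μ : ℕ)
    (f : ℝ → ℝ) (ξ : ℤ → Ω → ℂ) (h : ℝ → ℂ) (X : Ω → ℂ) : Prop :=
  AEStronglyMeasurable X P ∧
  ∀ ε : ℝ≥0∞, 0 < ε → ∃ c : ℤ →₀ ℂ, (∀ m ∈ c.support, m ≤ -1) ∧
    eLpNorm (fun ω => X ω - ∑ m ∈ c.support, c m * increment n ξ m μ ω) 2 P ≤ ε ∧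
    eLpNorm (fun t : ℝ => h t * incrFactor n μ t -
      ∑ m ∈ c.support, c m * (exp (I * t * m) * incrFactor n μ t)) 2 (specMeasure f) ≤ ε

/-- The space `L₂^{0-}(f)` generated by `e^{itk} χ(t)`, `k ≤ -1`. -/
def pastSpace (n μ : ℕ) (f : ℝ → ℝ) : Set (ℝ → ℂ) :=
  closedSpanL2 (specMeasure f)
    {g | ∃ k : ℤ, k ≤ -1 ∧ g = fun t : ℝ => exp (I * t * k) * incrFactor n μ t}

/-- Spectral characteristics of linear estimates under the density `f`: `h χ ∈ L₂^{0-}(f)`. -/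
def characteristics (n μ : ℕ) (f : ℝ → ℝ) : Set (ℝ → ℂ) :=
  {h | (fun t => h t * incrFactor n μ t) ∈ pastSpace n μ f}

/-- The class `H_D` of spectral characteristics admissible for all densities in `D`. -/
def characteristicsOn (n μ : ℕ) (D : Set (ℝ → ℝ)) : Set (ℝ → ℂ) :=
  {h | ∀ f ∈ D, h ∈ characteristics n μ f}

/-- `A(e^{it}) = ∑ (D^μ a)_k e^{itk}`. -/
def symbolA (a : ℕ → ℂ) (n μ : ℕ) (t : ℝ) : ℂ := ∑' k : ℕ, bCoef a n μ k * exp (I * t * k)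

/-- `Δ(h; f)`, the mean square error under the density `f` of the estimate with spectral
characteristic `h`. -/
def mse (a : ℕ → ℂ) (n μ : ℕ) (h : ℝ → ℂ) (f : ℝ → ℝ) : ℝ≥0∞ :=
  ∫⁻ t, ‖(symbolA a n μ t - h t) * incrFactor n μ t‖ₑ ^ 2 ∂(specMeasure f)

/-- `Δ(f)`, the mean square error of the optimal linear estimate under the density `f`. -/
def optMse (a : ℕ → ℂ) (n μ : ℕ) (f : ℝ → ℝ) : ℝ≥0∞ :=
  ⨅ h ∈ characteristics n μ f, mse a n μ h f

/-- `h` is the spectral characteristic of the optimal linear estimate under the density `f`. -/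
def IsOptimalCharacteristic (a : ℕ → ℂ) (n μ : ℕ) (f : ℝ → ℝ) (h : ℝ → ℂ) : Prop :=
  h ∈ characteristics n μ f ∧ mse a n μ h f = optMse a n μ f

/-- `f₀` is least favorable in `D` for the optimal linear estimation of `Aξ`. -/
def IsLeastFavorable (a : ℕ → ℂ) (n μ : ℕ) (D : Set (ℝ → ℝ)) (f₀ : ℝ → ℝ) : Prop :=
  f₀ ∈ D ∧ ∀ f ∈ D, optMse a n μ f ≤ optMse a n μ f₀

/-- `h₀` is minimax-robust for `D`: it lies in `H_D`, its maximal error over `D` is attained, and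
that maximum is minimal among all `h ∈ H_D`. -/
def IsMinimaxRobust (a : ℕ → ℂ) (n μ : ℕ) (D : Set (ℝ → ℝ)) (h₀ : ℝ → ℂ) : Prop :=
  h₀ ∈ characteristicsOn n μ D ∧
  (∃ f₀ ∈ D, ∀ f ∈ D, mse a n μ h₀ f ≤ mse a n μ h₀ f₀) ∧
  ∀ h ∈ characteristicsOn n μ D, ⨆ f ∈ D, mse a n μ h₀ f ≤ ⨆ f ∈ D, mse a n μ h f

/-! ### Canonical factorization and the operator `W^μ` -/

/-- `Φ(z) = ∑ φ(k) z^k` has radius of convergence greater than `1` and no zeros in the closed unit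
disk. -/
def IsCanonical (φ : ℕ → ℂ) : Prop :=
  (∃ r : ℝ, 1 < r ∧ Summable fun k => ‖φ k‖ * r ^ k) ∧
  ∀ z : ℂ, ‖z‖ ≤ 1 → ∑' k, φ k * z ^ k ≠ 0

/-- The function `Φ(e^{-it}) = ∑ φ(k) e^{-itk}`. -/
def factorFun (φ : ℕ → ℂ) (t : ℝ) : ℂ := ∑' k : ℕ, φ k * exp (-(I * t * k))

/-- The density `f(t) = |∑ φ(k) e^{-itk}|²`. -/
def factorDensity (φ : ℕ → ℂ) (t : ℝ) : ℝ := ‖factorFun φ t‖ ^ 2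

/-- The outer function `w_μ(z)` with `|w_μ(e^{-it})|² = |1 - e^{-itμ}|^{2n} / t^{2n}`. -/
def outerW (n μ : ℕ) (z : ℂ) : ℂ :=
  exp ((1 / (4 * π)) * ∫ t in (-π)..π, ((exp (I * t) + z) / (exp (I * t) - z)) *
    ((Real.log (‖1 - exp (-(I * t * μ))‖ ^ (2 * n) / t ^ (2 * n)) : ℝ) : ℂ))

/-- Taylor coefficients of `w_μ`. -/
def wCoef (n μ : ℕ) (k : ℕ) : ℂ := iteratedDeriv k (outerW n μ) 0 / (k.factorial : ℂ)

/-- `φ_μ = W^μ φ`, `φ_μ(k) = ∑_{j ≤ k} w_μ(k - j) φ(j)`. -/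
def Wapply (n μ : ℕ) (φ : ℕ → ℂ) (k : ℕ) : ℂ :=
  ∑ j ∈ Finset.range (k + 1), wCoef n μ (k - j) * φ j

/-- The sequence `D^μ A W^μ φ`. -/
def DAW (a : ℕ → ℂ) (n μ : ℕ) (φ : ℕ → ℂ) : ℕ → ℂ := DAapply a n μ (Wapply n μ φ)

/-- `r(e^{it}) = ∑ (D^μ A φ_μ)_k e^{itk}` with `φ_μ = W^μ φ`. -/
def rFun (a : ℕ → ℂ) (n μ : ℕ) (φ : ℕ → ℂ) (t : ℝ) : ℂ :=
  ∑' k : ℕ, DAW a n μ φ k * exp (I * t * k)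

/-- The spectral characteristic `h(t) = A(e^{it}) - r(e^{it}) Φ_μ(e^{-it})⁻¹`. -/
def hFun (a : ℕ → ℂ) (n μ : ℕ) (φ : ℕ → ℂ) (t : ℝ) : ℂ :=
  symbolA a n μ t - rFun a n μ φ t * (factorFun (Wapply n μ φ) t)⁻¹

/-! ### The extremal problems -/

/-- `φ` solves the conditional extremum problem `‖D^μ A W^μ φ‖² → max`, `|Φ(e^{-it})|² ∈ D`, over
the sequences that determine a canonical factorization. -/
def SolvesExtremal (a : ℕ → ℂ) (n μ : ℕ) (D : Set (ℝ → ℝ)) (φ : ℕ → ℂ) : Prop :=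
  IsCanonical φ ∧ factorDensity φ ∈ D ∧
  ∀ ψ, IsCanonical ψ → factorDensity ψ ∈ D → l2sq (DAW a n μ ψ) ≤ l2sq (DAW a n μ φ)

/-- The solutions of `D^μ A W^μ φ = α φ̄`, `α ∈ ℂ`, with `‖φ‖² = P₀` and
`v ≤ |Φ(e^{-it})|² ≤ u` which determine a canonical factorization. -/
def eigenSolutions (a : ℕ → ℂ) (n μ : ℕ) (v u : ℝ → ℝ) (P₀ : ℝ) : Set (ℕ → ℂ) :=
  {φ | IsCanonical φ ∧ (∃ α : ℂ, ∀ k, DAW a n μ φ k = α * conj (φ k)) ∧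
    l2sq φ = ENNReal.ofReal P₀ ∧
    ∀ᵐ t ∂freqMeasure, v t ≤ factorDensity φ t ∧ factorDensity φ t ≤ u t}

/-- The truncated density `max{v, min{u, |c r|²}}`. -/
def truncDensity (a : ℕ → ℂ) (n μ : ℕ) (v u : ℝ → ℝ) (c : ℂ) (φ : ℕ → ℂ) (t : ℝ) : ℝ :=
  max (v t) (min (u t) (‖c * rFun a n μ φ t‖ ^ 2))

/-- `φ` has `‖φ‖² = P₀` and determines the canonical factorization of the truncated density that
is built from `c` and from `φ` itself. -/
def IsTruncSolution (a : ℕ → ℂ) (n μ : ℕ) (v u : ℝ → ℝ) (P₀ : ℝ) (c : ℂ) (φ : ℕ → ℂ) : Prop :=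
  IsCanonical φ ∧ l2sq φ = ENNReal.ofReal P₀ ∧
  ∀ᵐ t ∂freqMeasure, truncDensity a n μ v u c φ t = factorDensity φ t

/-- `ν_u`, where `ν_u P₀` is the maximum of `‖D^μ A W^μ φ‖²` over `eigenSolutions` (`0` if there
are none). -/
def nuU (a : ℕ → ℂ) (n μ : ℕ) (v u : ℝ → ℝ) (P₀ : ℝ) : ℝ≥0∞ :=
  (⨆ φ ∈ eigenSolutions a n μ v u P₀, l2sq (DAW a n μ φ)) / ENNReal.ofReal P₀

/-- `ν_u⁺`, where `ν_u⁺ P₀` is the maximum of `‖D^μ A W^μ φ‖²` over the truncated solutions (`0` if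
there are none). -/
def nuUplus (a : ℕ → ℂ) (n μ : ℕ) (v u : ℝ → ℝ) (P₀ : ℝ) : ℝ≥0∞ :=
  (⨆ φ ∈ {φ | ∃ c, IsTruncSolution a n μ v u P₀ c φ}, l2sq (DAW a n μ φ)) / ENNReal.ofReal P₀

end

/-! For a canonical `φ`, the pair (`hFun φ`, `factorDensity φ`) is a saddle point of the error Δ(h;
f) as soon as a Lagrange multiplier for the power constraint exists. Both kinds of solutions supply
one, and a saddle point whose characteristic is admissible for all densities of the class is at once
a least favorable density and a minimax-robust characteristic (`minimax_of_saddle`).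

The analysis rests on a factorization. On the circle, with z = e^{-it}, the increment factor χ is a
unimodular phase, independent of the step, times the boundary value of the outer function w_μ
(`incrFactor_eq_phase`). The function w_μ equals (1 + z + ... + z^{μ-1})^n times the n-th power of
an exponential of an absolutely convergent power series (`outerW_eq`), because log |sin(t/2)/(t/2)|
has absolutely summable Fourier coefficients. Hence every function involved has absolutely summable
coefficients.

Since D^μA is a Hankel matrix, A(e^{it})Φ_μ(z) splits into r_φ plus a part zQ(z) with Q analytic
(`mul_eq_hankel_add`). Thus h_φ = zQ/Φ_μ. Multiplied by χ, it lies in the past space of every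
density (`hFun_mem_characteristics`). The zeros of w_μ on the circle cancel, at the cost of
replacing step μ by step one, which a Cesàro argument repairs (`pastSpace_of_wiener_one`). The
remaining error (A - h_φ)χ has squared modulus |r_φ|²/|Φ|², so Δ(h_φ; f) is linear in f
(`mse_hFun`). Under f_φ this error is orthogonal to the past, so h_φ is optimal there, with error
‖D^μAW^μφ‖² (`isOptimalCharacteristic_hFun`, `mse_hFun_factorDensity`).

The saddle inequality only needs a constant M ≥ 0 with (|r_φ|²/|Φ|²)(f - f_φ) ≤ M(f - f_φ) pointwise
(`mse_le_of_multiplier`). For an eigen solution the ratio is the constant |α|². For a truncated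
solution with c ≠ 0 one takes M = |c|^{-2}: the bounds v and u are active exactly where the ratio
differs from M (`exists_multiplier_of_trunc`).

The probabilistic statements follow from equality of Gram matrices: the closed span of the pairs
(increment, spectral image) is the graph of an isometry (`norm_eq_of_mem_graphSpan`), through which
errors, estimates and innovations are transferred. -/

noncomputable section

/-! ### Absolutely convergent power series on the closed unit disk -/

/-- `F(z) = ∑ e(k) z^k` on the closed unit disk, with absolutely summable coefficients. -/
def HasWienerSeries (F : ℂ → ℂ) (e : ℕ → ℂ) : Prop :=
  (Summable fun k => ‖e k‖) ∧ ∀ z : ℂ, ‖z‖ ≤ 1 → F z = ∑' k, e k * z ^ k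

/-- The sequence of Taylor coefficients of a product. -/
def cauchyProd (e g : ℕ → ℂ) (k : ℕ) : ℂ := ∑ j ∈ Finset.range (k + 1), e (k - j) * g j

theorem summable_norm_mul_pow {e : ℕ → ℂ} (he : Summable fun k => ‖e k‖) {z : ℂ} (hz : ‖z‖ ≤ 1) :
    Summable fun k => ‖e k * z ^ k‖ := by
  refine he.of_nonneg_of_le (fun _ => norm_nonneg _) fun k => ?_
  rw [norm_mul, norm_pow]
  exact mul_le_of_le_one_right (norm_nonneg _) (pow_le_one₀ (norm_nonneg _) hz)

theorem cauchyProd_eq_antidiagonal (e g : ℕ → ℂ) (k : ℕ) :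
    cauchyProd e g k = ∑ p ∈ Finset.HasAntidiagonal.antidiagonal k, g p.1 * e p.2 := by
  rw [Finset.Nat.sum_antidiagonal_eq_sum_range_succ (fun i j => g i * e j)]
  exact Finset.sum_congr rfl fun _ _ => mul_comm _ _

theorem summable_norm_cauchyProd {e g : ℕ → ℂ} (he : Summable fun k => ‖e k‖)
    (hg : Summable fun k => ‖g k‖) : Summable fun k => ‖cauchyProd e g k‖ := by
  simp_rw [cauchyProd_eq_antidiagonal]
  exact summable_norm_sum_mul_antidiagonal_of_summable_norm hg he

theorem tsum_norm_cauchyProd_le {e g : ℕ → ℂ} (he : Summable fun k => ‖e k‖)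
    (hg : Summable fun k => ‖g k‖) :
    ∑' k, ‖cauchyProd e g k‖ ≤ (∑' k, ‖e k‖) * ∑' k, ‖g k‖ := by
  rw [mul_comm, hg.tsum_mul_tsum_eq_tsum_sum_antidiagonal he
    (hg.mul_of_nonneg he (fun _ => norm_nonneg _) fun _ => norm_nonneg _)]
  refine (summable_norm_cauchyProd he hg).tsum_le_tsum (fun k => ?_) ?_
  · rw [cauchyProd_eq_antidiagonal]
    exact (norm_sum_le _ _).trans_eq (Finset.sum_congr rfl fun _ _ => norm_mul _ _)
  · have := summable_norm_sum_mul_antidiagonal_of_summable_norm hg.norm he.norm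
    exact this.congr fun k => by
      rw [Real.norm_of_nonneg (Finset.sum_nonneg fun _ _ => by positivity)]

namespace HasWienerSeries

variable {F G : ℂ → ℂ} {e g : ℕ → ℂ}

theorem hasSum (h : HasWienerSeries F e) {z : ℂ} (hz : ‖z‖ ≤ 1) :
    HasSum (fun k => e k * z ^ k) (F z) := by
  rw [h.2 z hz]
  exact (summable_norm_mul_pow h.1 hz).of_norm.hasSum

theorem congr (h : HasWienerSeries F e) (hFG : ∀ z : ℂ, ‖z‖ ≤ 1 → G z = F z) :
    HasWienerSeries G e := ⟨h.1, fun z hz => (hFG z hz).trans (h.2 z hz)⟩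

theorem of_summable (he : Summable fun k => ‖e k‖) :
    HasWienerSeries (fun z => ∑' k, e k * z ^ k) e := ⟨he, fun _ _ => rfl⟩

theorem mul (hF : HasWienerSeries F e) (hG : HasWienerSeries G g) :
    HasWienerSeries (fun z => F z * G z) (cauchyProd e g) := by
  refine ⟨summable_norm_cauchyProd hF.1 hG.1, fun z hz => ?_⟩
  change F z * G z = _
  rw [mul_comm, hF.2 z hz, hG.2 z hz, tsum_mul_tsum_eq_tsum_sum_antidiagonal_of_summable_norm
    (summable_norm_mul_pow hG.1 hz) (summable_norm_mul_pow hF.1 hz)]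
  refine tsum_congr fun k => ?_
  rw [cauchyProd_eq_antidiagonal, Finset.sum_mul]
  refine Finset.sum_congr rfl fun p hp => ?_
  rw [← Finset.HasAntidiagonal.mem_antidiagonal.1 hp, pow_add]
  ring

theorem one : HasWienerSeries (fun _ => 1) (Pi.single 0 1) := by
  refine ⟨summable_of_hasFiniteSupport ((Set.finite_singleton 0).subset fun k hk => ?_),
    fun z _ => ?_⟩
  · by_contra h
    simp_all
  · rw [tsum_eq_single 0 (by intro b hb; simp [hb])]
    simp

theorem id_pow (j : ℕ) : HasWienerSeries (fun z => z ^ j) (Pi.single j 1) := by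
  refine ⟨summable_of_hasFiniteSupport ((Set.finite_singleton j).subset fun k hk => ?_),
    fun z _ => ?_⟩
  · by_contra h
    simp_all
  · rw [tsum_eq_single j (by intro b hb; simp [hb])]
    simp

theorem add (hF : HasWienerSeries F e) (hG : HasWienerSeries G g) :
    HasWienerSeries (fun z => F z + G z) (e + g) := by
  refine ⟨(hF.1.add hG.1).of_nonneg_of_le (fun _ => norm_nonneg _) fun k => norm_add_le _ _,
    fun z hz => ?_⟩
  change F z + G z = _
  rw [hF.2 z hz, hG.2 z hz, ← (summable_norm_mul_pow hF.1 hz).of_norm.tsum_add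
    (summable_norm_mul_pow hG.1 hz).of_norm]
  exact tsum_congr fun k => (add_mul _ _ _).symm

theorem const_mul (hF : HasWienerSeries F e) (c : ℂ) :
    HasWienerSeries (fun z => c * F z) (fun k => c * e k) := by
  refine ⟨by simpa [norm_mul] using hF.1.mul_left ‖c‖, fun z hz => ?_⟩
  change c * F z = _
  rw [hF.2 z hz, ← tsum_mul_left]
  exact tsum_congr fun k => (mul_assoc _ _ _).symm

theorem exists_sum {ι : Type*} (s : Finset ι) {F : ι → ℂ → ℂ}
    (h : ∀ i ∈ s, ∃ e, HasWienerSeries (F i) e) :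
    ∃ e, HasWienerSeries (fun z => ∑ i ∈ s, F i z) e := by
  classical
  induction s using Finset.induction_on with
  | empty => exact ⟨_, (one.const_mul 0).congr fun z _ => by simp⟩
  | insert i s hi ih =>
    obtain ⟨e, he⟩ := h i (Finset.mem_insert_self _ _)
    obtain ⟨g, hg⟩ := ih fun j hj => h j (Finset.mem_insert_of_mem hj)
    exact ⟨_, (he.add hg).congr fun z _ => by rw [Finset.sum_insert hi]⟩

/-- The coefficient norm is submultiplicative. The bound stays in the conclusion because
`exists_exp` uses it to sum the exponential series. -/
theorem exists_pow (hF : HasWienerSeries F e) (m : ℕ) :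
    ∃ g, HasWienerSeries (fun z => F z ^ m) g ∧ ∑' k, ‖g k‖ ≤ (∑' k, ‖e k‖) ^ m := by
  induction m with
  | zero =>
    refine ⟨_, by simpa using one, ?_⟩
    rw [tsum_eq_single 0 (by intro b hb; simp [hb])]
    simp
  | succ m ih =>
    obtain ⟨g, hg, hle⟩ := ih
    refine ⟨_, (hg.mul hF).congr fun z _ => pow_succ _ _, ?_⟩
    refine (tsum_norm_cauchyProd_le hg.1 hF.1).trans ?_
    rw [pow_succ]
    exact mul_le_mul_of_nonneg_right hle (tsum_nonneg fun _ => norm_nonneg _)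

/-- The m-th term of the exponential series has coefficient norm at most S^m / m!, so the double
family of coefficients is absolutely summable and the two summations may be exchanged. -/
theorem exists_exp (hF : HasWienerSeries F e) :
    ∃ g, HasWienerSeries (fun z => exp (F z)) g := by
  choose g hg hle using hF.exists_pow
  set S := ∑' k, ‖e k‖
  have hrow : ∀ m, Summable fun k => ‖((m.factorial : ℂ)⁻¹) * g m k‖ := fun m => by
    simpa [norm_mul] using (hg m).1.mul_left _
  have hsum : Summable fun p : ℕ × ℕ => ‖((p.1.factorial : ℂ)⁻¹) * g p.1 p.2‖ := by
    refine (summable_prod_of_nonneg fun _ => norm_nonneg _).2 ⟨hrow, ?_⟩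
    refine (Real.summable_pow_div_factorial S).of_nonneg_of_le
      (fun m => tsum_nonneg fun _ => norm_nonneg _) fun m => ?_
    simp only [norm_mul, tsum_mul_left, norm_inv, Complex.norm_natCast]
    rw [div_eq_inv_mul]
    exact mul_le_mul_of_nonneg_left (hle m) (by positivity)
  refine ⟨fun k => ∑' m, ((m.factorial : ℂ)⁻¹) * g m k, ?_, fun z hz => ?_⟩
  · have h2 : Summable fun p : ℕ × ℕ => ‖((p.2.factorial : ℂ)⁻¹) * g p.2 p.1‖ :=
      hsum.prod_symm
    have h3 := (summable_prod_of_nonneg fun _ => norm_nonneg _).1 h2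
    refine h3.2.of_nonneg_of_le (fun _ => norm_nonneg _) fun k => ?_
    exact norm_tsum_le_tsum_norm (h3.1 k)
  · have hz' : Summable fun p : ℕ × ℕ => ((p.1.factorial : ℂ)⁻¹) * g p.1 p.2 * z ^ p.2 := by
      refine Summable.of_norm (hsum.of_nonneg_of_le (fun _ => norm_nonneg _) fun p => ?_)
      rw [norm_mul (_ * _), norm_pow]
      exact mul_le_of_le_one_right (norm_nonneg _) (pow_le_one₀ (norm_nonneg _) hz)
    have hz2 : Summable (Function.uncurry fun m k : ℕ =>
        ((m.factorial : ℂ)⁻¹) * g m k * z ^ k) := hz'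
    simp_rw [← tsum_mul_right]
    rw [hz2.tsum_comm, Complex.exp_eq_exp_ℂ, NormedSpace.exp_eq_tsum_div]
    refine tsum_congr fun m => ?_
    simp_rw [mul_assoc]
    rw [tsum_mul_left, ← (hg m).2 z hz, div_eq_inv_mul]

theorem hasFPowerSeriesAt (he : Summable fun k => ‖e k‖)
    (h : ∀ z : ℂ, ‖z‖ < 1 → F z = ∑' k, e k * z ^ k) :
    HasFPowerSeriesAt F (FormalMultilinearSeries.ofScalars ℂ e) 0 := by
  refine ⟨1, ?_⟩
  constructor
  · refine FormalMultilinearSeries.le_radius_of_summable_norm (r := 1) _ ?_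
    refine he.of_nonneg_of_le (fun _ => by positivity) fun k => ?_
    simp
  · simp
  · intro y hy
    have hy' : ‖y‖ < 1 := by
      rw [Metric.mem_eball, edist_zero_right, ← ofReal_norm] at hy
      exact ENNReal.ofReal_lt_one.1 hy
    rw [zero_add, h y hy']
    have := (summable_norm_mul_pow he hy'.le).of_norm.hasSum
    refine this.congr_fun fun k => ?_
    simp [mul_comm]

/-- Uniqueness of power series. Only values in the open disk enter, which is where the Schwarz
integral defining `outerW` is evaluated; this identifies abstract coefficients with `wCoef`. -/
theorem iteratedDeriv_div_factorial (he : Summable fun k => ‖e k‖)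
    (h : ∀ z : ℂ, ‖z‖ < 1 → F z = ∑' k, e k * z ^ k) (k : ℕ) :
    iteratedDeriv k F 0 / (k.factorial : ℂ) = e k := by
  have h1 := hasFPowerSeriesAt he h
  have h2 := (h1.analyticAt).hasFPowerSeriesAt
  have := congrArg (fun p => p.coeff k) (h1.eq_formalMultilinearSeries h2)
  simp [FormalMultilinearSeries.coeff_ofScalars] at this
  rw [this]

end HasWienerSeries

/-! ### Canonical sequences and their inverses -/

theorem IsCanonical.summable {φ : ℕ → ℂ} (h : IsCanonical φ) : Summable fun k => ‖φ k‖ := by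
  obtain ⟨⟨r, hr, hs⟩, -⟩ := h
  refine hs.of_nonneg_of_le (fun _ => norm_nonneg _) fun k => ?_
  exact le_mul_of_one_le_right (norm_nonneg _) (one_le_pow₀ hr.le)

/-- Compactness of the closed unit disk gives a slightly larger disk on which Φ is holomorphic
without zeros. The Cauchy power series of 1/Φ then has radius greater than 1, hence converges
absolutely at radius 1. -/
theorem IsCanonical.exists_inv {φ : ℕ → ℂ} (h : IsCanonical φ) :
    ∃ κ, HasWienerSeries (fun z => (∑' k, φ k * z ^ k)⁻¹) κ := by
  obtain ⟨⟨r, hr, hs⟩, hne⟩ := h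
  set Φ : ℂ → ℂ := fun z => ∑' k, φ k * z ^ k with hΦ
  have hr0 : 0 < r := by linarith
  have hcont : DifferentiableOn ℂ Φ (Metric.ball 0 r) := by
    refine differentiableOn_tsum_of_summable_norm hs (fun k => by fun_prop) Metric.isOpen_ball ?_
    intro k z hz
    rw [norm_mul, norm_pow]
    have : ‖z‖ < r := by simpa using hz
    gcongr
  have hKc : IsCompact (Metric.closedBall (0 : ℂ) 1) := isCompact_closedBall _ _
  have hopen : IsOpen (Metric.ball (0 : ℂ) r ∩ Φ ⁻¹' {0}ᶜ) :=
    hcont.continuousOn.isOpen_inter_preimage Metric.isOpen_ball isOpen_compl_singleton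
  have hsub : Metric.closedBall (0 : ℂ) 1 ⊆ Metric.ball (0 : ℂ) r ∩ Φ ⁻¹' {0}ᶜ := by
    intro z hz
    have hz' : ‖z‖ ≤ 1 := by simpa using hz
    exact ⟨by simpa using hz'.trans_lt hr, hne z hz'⟩
  obtain ⟨δ, hδ, hth⟩ := hKc.exists_thickening_subset_open hopen hsub
  rw [thickening_closedBall hδ zero_le_one] at hth
  have hd : DifferentiableOn ℂ (fun z => (Φ z)⁻¹) (Metric.ball 0 (δ + 1)) :=
    (hcont.mono fun z hz => (hth hz).1).inv fun z hz => (hth hz).2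
  -- Any radius strictly between 1 and 1 + δ would do.
  set R : ℝ≥0 := ⟨1 + δ / 2, by positivity⟩
  have hRv : (R : ℝ) = 1 + δ / 2 := rfl
  have hd' : DifferentiableOn ℂ (fun z => (Φ z)⁻¹) (Metric.closedBall 0 R) :=
    hd.mono (Metric.closedBall_subset_ball (by rw [hRv]; linarith))
  have hR0 : 0 < R := by rw [← NNReal.coe_pos, hRv]; positivity
  have hp := hd'.hasFPowerSeriesOnBall hR0
  set p := cauchyPowerSeries (fun z => (Φ z)⁻¹) 0 R
  have h1R : (1 : ℝ≥0∞) < R := by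
    rw [ENNReal.one_lt_coe_iff, ← NNReal.coe_lt_coe, hRv]; simpa using hδ
  have hsum1 : Summable fun k => ‖p k‖ := by
    simpa using p.summable_norm_mul_pow (r := 1) (by simpa using h1R.trans_le hp.r_le)
  refine ⟨fun k => p.coeff k, ?_, fun z hz => ?_⟩
  · simpa using hsum1
  · have hz' : z ∈ Metric.eball (0 : ℂ) R := by
      rw [Metric.mem_eball, edist_zero_right, ← ofReal_norm]
      exact (ENNReal.ofReal_le_one.2 hz).trans_lt h1R
    have := (hp.hasSum hz').tsum_eq
    rw [zero_add] at this
    refine this.symm.trans ?_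
    refine tsum_congr fun k => ?_
    rw [p.apply_eq_prod_smul_coeff]
    simp [mul_comm]

/-! ### The Schwarz integral of a real function on the circle -/

/-- The Schwarz integral `(1/2π) ∫ (e^{it} + z) / (e^{it} - z) g(t) dt`. -/
def schwarzIntegral (g : ℝ → ℝ) (z : ℂ) : ℂ :=
  (1 / (2 * π)) * ∫ t in (-π)..π, ((exp (I * t) + z) / (exp (I * t) - z)) * (g t : ℂ)

theorem norm_exp_I_mul (t : ℝ) : ‖exp (I * t)‖ = 1 := by
  rw [mul_comm]; exact norm_exp_ofReal_mul_I t

theorem exp_I_mul_sub_ne_zero {z : ℂ} (hz : ‖z‖ < 1) (t : ℝ) : exp (I * t) - z ≠ 0 := by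
  intro h
  rw [sub_eq_zero] at h
  rw [← h, norm_exp_I_mul] at hz
  exact lt_irrefl _ hz

theorem continuous_schwarzKernel {z : ℂ} (hz : ‖z‖ < 1) :
    Continuous fun t : ℝ => (exp (I * t) + z) / (exp (I * t) - z) :=
  Continuous.div (by fun_prop) (by fun_prop) fun t => exp_I_mul_sub_ne_zero hz t

theorem intervalIntegrable_schwarz {z : ℂ} (hz : ‖z‖ < 1) {g : ℝ → ℝ}
    (hg : IntervalIntegrable g volume (-π) π) :
    IntervalIntegrable (fun t : ℝ => ((exp (I * t) + z) / (exp (I * t) - z)) * (g t : ℂ))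
      volume (-π) π :=
  IntervalIntegrable.continuousOn_mul (f := fun t => (g t : ℂ))
    ⟨hg.1.ofReal, hg.2.ofReal⟩ (continuous_schwarzKernel hz).continuousOn

theorem circleAverage_eq_integral_neg_pi_pi (F : ℂ → ℂ) :
    Real.circleAverage F 0 1 = (1 / (2 * π)) * ∫ t in (-π)..π, F (exp (I * t)) := by
  have hper : Function.Periodic (fun t : ℝ => F (circleMap 0 1 t)) (2 * π) := fun t => by
    simp only [periodic_circleMap 0 1 t]
  have h := hper.intervalIntegral_add_eq 0 (-π)
  rw [Real.circleAverage, ← zero_add (2 * π), h]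
  have : -π + 2 * π = π := by ring
  rw [this]
  simp [circleMap, mul_comm]

/-- Write Re F as half of F plus its conjugate. Since (ζ + z)/(ζ - z) = 2ζ/(ζ - z) - 1, the half
with F gives F(z) by Cauchy's formula, up to a multiple of F(0) = 0. On the circle the conjugate
kernel is (1 + z̄ζ)/(1 - z̄ζ), holomorphic in the disk, so the conjugate half vanishes by the mean
value property. -/
theorem schwarzIntegral_re {F : ℂ → ℂ} (hF : DiffContOnCl ℂ F (Metric.ball 0 1)) (h0 : F 0 = 0)
    {z : ℂ} (hz : ‖z‖ < 1) : schwarzIntegral (fun t => (F (exp (I * t))).re) z = F z := by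
  have hzb : z ∈ Metric.ball (0 : ℂ) 1 := by simpa using hz
  have hsph : Metric.sphere (0 : ℂ) 1 ⊆ Metric.closedBall 0 1 := Metric.sphere_subset_closedBall
  have hFc : ContinuousOn F (Metric.sphere 0 1) := by
    have := hF.continuousOn
    rw [closure_ball _ one_ne_zero] at this
    exact this.mono hsph
  have hK : DiffContOnCl ℂ (fun ζ => (1 + conj z * ζ) / (1 - conj z * ζ)) (Metric.ball 0 1) := by
    refine DiffContOnCl.mono (s := Metric.ball (0:ℂ) 1) ?_ subset_rfl
    have hne : ∀ ζ ∈ closure (Metric.ball (0 : ℂ) 1), 1 - conj z * ζ ≠ 0 := by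
      intro ζ hζ h
      rw [closure_ball _ one_ne_zero] at hζ
      have hζ' : ‖ζ‖ ≤ 1 := by simpa using hζ
      have h1 : ‖conj z * ζ‖ = 1 := by rw [← sub_eq_zero.1 h]; simp
      rw [norm_mul, RCLike.norm_conj] at h1
      nlinarith [norm_nonneg z, norm_nonneg ζ]
    constructor
    · exact DifferentiableOn.div (by fun_prop) (by fun_prop) fun ζ hζ => hne ζ (subset_closure hζ)
    · exact ContinuousOn.div (by fun_prop) (by fun_prop) hne
  have h1 : Real.circleAverage (fun ζ => ((ζ - 0) / (ζ - z)) • F ζ) 0 1 = F z :=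
    DiffContOnCl.circleAverage_smul_div (by simpa using hF) (by simpa using hzb)
  have h2 : Real.circleAverage F 0 1 = F 0 :=
    DiffContOnCl.circleAverage (by simpa using hF)
  have h3 : Real.circleAverage (fun ζ => ((1 + conj z * ζ) / (1 - conj z * ζ)) • F ζ) 0 1 =
      ((1 + conj z * 0) / (1 - conj z * 0)) • F 0 :=
    DiffContOnCl.circleAverage (f := fun ζ => ((1 + conj z * ζ) / (1 - conj z * ζ)) • F ζ)
      (by simpa using hK.smul hF)
  rw [h0, smul_zero] at h3
  rw [h0] at h2
  rw [circleAverage_eq_integral_neg_pi_pi] at h1 h2 h3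
  have hFt : Continuous fun t : ℝ => F (exp (I * t)) :=
    hFc.comp_continuous (by fun_prop) fun t => by simp
  have h3' : ((1 / (2 * π)) * ∫ t in (-π)..π,
      ((exp (I * t) + z) / (exp (I * t) - z)) * conj (F (exp (I * t))) : ℂ) = 0 := by
    rw [← map_zero (starRingEnd ℂ), ← h3, map_mul, intervalIntegral.integral_of_le (by linarith [Real.pi_pos]),
      intervalIntegral.integral_of_le (by linarith [Real.pi_pos]), ← integral_conj]
    congr 1
    · simp only [map_div₀, map_mul, map_one, map_ofNat, conj_ofReal]
    · refine integral_congr_ae (Eventually.of_forall fun t => ?_)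
      simp only [smul_eq_mul, map_mul, map_div₀, map_add, map_sub, map_one, conj_conj]
      congr 1
      have he : conj (exp (I * t)) = (exp (I * t))⁻¹ := by
        rw [← exp_conj, ← exp_neg]; simp
      have hne := exp_ne_zero (I * t)
      rw [he, ← mul_div_mul_left (1 + z * _) (1 - z * _) hne]
      congr 1 <;> field_simp
  have hc1 : Continuous fun t : ℝ => ((exp (I * t) - 0) / (exp (I * t) - z)) • F (exp (I * t)) :=
    (Continuous.div (by fun_prop) (by fun_prop) fun t => exp_I_mul_sub_ne_zero hz t).smul hFt
  have hc3 : Continuous fun t : ℝ =>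
      ((exp (I * t) + z) / (exp (I * t) - z)) * conj (F (exp (I * t))) :=
    (continuous_schwarzKernel hz).mul (continuous_conj.comp hFt)
  have key : ∀ t : ℝ, ((exp (I * t) + z) / (exp (I * t) - z)) * ((F (exp (I * t))).re : ℂ) =
      ((exp (I * t) - 0) / (exp (I * t) - z)) • F (exp (I * t)) - (1 / 2) * F (exp (I * t)) +
      (1 / 2) * (((exp (I * t) + z) / (exp (I * t) - z)) * conj (F (exp (I * t)))) := fun t => by
    have hne := exp_I_mul_sub_ne_zero hz t
    rw [re_eq_add_conj, smul_eq_mul]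
    field_simp
    ring
  rw [schwarzIntegral]
  simp_rw [key]
  rw [intervalIntegral.integral_add, intervalIntegral.integral_sub,
    intervalIntegral.integral_const_mul, intervalIntegral.integral_const_mul]
  · linear_combination h1 - (1 / 2) * h2 + (1 / 2) * h3'
  · exact hc1.intervalIntegrable _ _
  · exact (hFt.const_mul _).intervalIntegrable _ _
  · exact (hc1.sub (hFt.const_mul _)).intervalIntegrable _ _
  · exact (hc3.const_mul _).intervalIntegrable _ _

/-! ### The logarithm of `|1 - e^{itμ}|` -/

theorem countable_exp_mul_eq_one {μ : ℕ} (hμ : 0 < μ) :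
    {t : ℝ | exp (I * t * μ) = 1}.Countable := by
  refine (Set.countable_range fun k : ℤ => (2 * π * k / μ : ℝ)).mono fun t ht => ?_
  obtain ⟨k, hk⟩ := exp_eq_one_iff.1 ht
  refine ⟨k, ?_⟩
  have hμ' : (μ : ℝ) ≠ 0 := by positivity
  have h : (t : ℂ) * μ = 2 * π * k := mul_left_cancel₀ I_ne_zero (by linear_combination hk)
  have h' : t * μ = 2 * π * k := by exact_mod_cast h
  simp only
  rw [div_eq_iff hμ', h']

theorem ae_exp_mul_ne_one {μ : ℕ} (hμ : 0 < μ) : ∀ᵐ t : ℝ, exp (I * t * μ) ≠ 1 := by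
  have := (countable_exp_mul_eq_one hμ).measure_zero volume
  rw [measure_eq_zero_iff_ae_notMem] at this
  exact this

theorem intervalIntegrable_log_norm_one_sub (μ : ℕ) :
    IntervalIntegrable (fun t : ℝ => Real.log ‖1 - exp (I * t * μ)‖) volume (-π) π := by
  refine MeromorphicOn.intervalIntegrable_log_norm (f := fun t : ℝ => 1 - exp (I * t * μ))
    fun t _ => AnalyticAt.meromorphicAt ?_
  have : AnalyticAt ℝ (fun t : ℝ => (t : ℂ)) t := Complex.ofRealCLM.analyticAt t
  have h2 : AnalyticAt ℝ (fun t : ℝ => exp (I * t * μ)) t :=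
    (analyticAt_cexp.restrictScalars (𝕜 := ℝ)).comp
      ((analyticAt_const.mul this).mul analyticAt_const)
  exact analyticAt_const.sub h2

/-- A majorant uniform in r for the radial limit r → 1. From |1 - η| ≤ |1 - rη| + (1 - r) and 1 - r
≤ |1 - rη|, shrinking η loses at most a factor 2. -/
theorem abs_log_norm_one_sub_le {η : ℂ} (hη : ‖η‖ = 1) (h1 : η ≠ 1) {r : ℝ} (h0 : 0 ≤ r)
    (hr : r ≤ 1) : |Real.log ‖1 - r * η‖| ≤ Real.log 2 + |Real.log ‖1 - η‖| := by
  have hrη : ‖(r : ℂ) * η‖ = r := by rw [norm_mul, hη, mul_one, norm_real, Real.norm_of_nonneg h0]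
  have hpos : 0 < ‖1 - η‖ := norm_pos_iff.2 (sub_ne_zero.2 h1.symm)
  have hlow : ‖1 - η‖ / 2 ≤ ‖1 - r * η‖ := by
    have h2 : ‖1 - η‖ ≤ ‖1 - r * η‖ + (1 - r) := by
      have : 1 - η = (1 - r * η) - ((1 - r : ℝ) : ℂ) * η := by push_cast; ring
      rw [this]
      refine (norm_sub_le _ _).trans_eq ?_
      rw [norm_mul, hη, norm_real, Real.norm_of_nonneg (by linarith), mul_one]
    have h3 : 1 - r ≤ ‖1 - r * η‖ := by
      have := norm_sub_norm_le (1 : ℂ) (r * η)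
      rwa [hrη, norm_one] at this
    linarith
  have hup : ‖1 - r * η‖ ≤ 2 := by
    refine (norm_sub_le _ _).trans ?_
    rw [hrη, norm_one]; linarith
  have hlog2 : 0 ≤ Real.log 2 := Real.log_nonneg one_le_two
  rw [abs_le]
  constructor
  · have := Real.log_le_log (by positivity) hlow
    rw [Real.log_div hpos.ne' two_ne_zero] at this
    linarith [neg_abs_le (Real.log ‖1 - η‖)]
  · have := Real.log_le_log (lt_of_lt_of_le (by positivity) hlow) hup
    linarith [abs_nonneg (Real.log ‖1 - η‖)]

theorem one_sub_mem_slitPlane {z : ℂ} (hz : ‖z‖ < 1) : 1 - z ∈ slitPlane := by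
  refine Or.inl ?_
  have := (abs_le.1 (abs_re_le_norm z)).2
  simp only [sub_re, one_re]
  linarith

/-- The logarithm is singular at the μ-th roots of unity, so the reproducing formula is applied to
log(1 - rζ^μ) with r < 1 and followed by dominated convergence as r → 1. -/
theorem schwarzIntegral_log_norm_one_sub {μ : ℕ} (hμ : 0 < μ) {z : ℂ} (hz : ‖z‖ < 1) :
    schwarzIntegral (fun t => Real.log ‖1 - exp (I * t * μ)‖) z = log (1 - z ^ μ) := by
  have hzμ : ‖z ^ μ‖ < 1 := by rw [norm_pow]; exact pow_lt_one₀ (norm_nonneg _) hz hμ.ne'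
  set r : ℕ → ℝ := fun N => 1 - 1 / ((N : ℝ) + 1)
  have hr0 : ∀ N, 0 ≤ r N := fun N => by
    have : 1 / ((N : ℝ) + 1) ≤ 1 := by rw [div_le_one (by positivity)]; simp
    simp only [r]; linarith
  have hr1 : ∀ N, r N < 1 := fun N => by
    have : 0 < 1 / ((N : ℝ) + 1) := by positivity
    simp only [r]; linarith
  have hrlim : Tendsto r atTop (𝓝 1) := by
    simpa only [sub_zero] using
      (tendsto_const_nhds (x := (1 : ℝ))).sub tendsto_one_div_add_atTop_nhds_zero_nat
  have hrlimC : Tendsto (fun N => (r N : ℂ)) atTop (𝓝 1) := by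
    rw [← ofReal_one]
    exact (continuous_ofReal.tendsto 1).comp hrlim
  have hstep : ∀ N, schwarzIntegral (fun t => Real.log ‖1 - r N * exp (I * t * μ)‖) z =
      log (1 - r N * z ^ μ) := fun N => by
    have hlt : ∀ ζ ∈ closure (Metric.ball (0 : ℂ) 1), ‖(r N : ℂ) * ζ ^ μ‖ < 1 := fun ζ hζ => by
      rw [closure_ball _ one_ne_zero] at hζ
      have hζ' : ‖ζ‖ ≤ 1 := by simpa using hζ
      rw [norm_mul, norm_real, Real.norm_of_nonneg (hr0 N), norm_pow]
      have := pow_le_one₀ (n := μ) (norm_nonneg _) hζ'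
      nlinarith [hr0 N, hr1 N, pow_nonneg (norm_nonneg ζ) μ]
    have hd : DiffContOnCl ℂ (fun ζ => log (1 - r N * ζ ^ μ)) (Metric.ball 0 1) := by
      constructor
      · intro ζ hζ
        refine DifferentiableAt.differentiableWithinAt ?_
        exact DifferentiableAt.clog (by fun_prop)
          (one_sub_mem_slitPlane (hlt ζ (subset_closure hζ)))
      · exact ContinuousOn.clog (by fun_prop) fun ζ hζ => one_sub_mem_slitPlane (hlt ζ hζ)
    have := schwarzIntegral_re hd (by simp [hμ.ne']) hz
    rw [← this]
    simp_rw [log_re, ← exp_nat_mul]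
    congr! 7
    ring
  have hR : Tendsto (fun N => log (1 - r N * z ^ μ)) atTop (𝓝 (log (1 - z ^ μ))) := by
    refine Tendsto.clog ?_ (one_sub_mem_slitPlane hzμ)
    simpa using tendsto_const_nhds.sub (hrlimC.mul_const (z ^ μ))
  refine tendsto_nhds_unique ?_ hR
  simp_rw [← hstep]
  refine Tendsto.const_mul _ ?_
  obtain ⟨M, hM⟩ : ∃ M, ∀ t ∈ Set.uIcc (-π) π,
      ‖(exp (I * t) + z) / (exp (I * t) - z)‖ ≤ M :=
    isCompact_uIcc.exists_bound_of_continuousOn (continuous_schwarzKernel hz).continuousOn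
  have hnorm : ∀ t : ℝ, ‖exp (I * t * μ)‖ = 1 := fun t => by
    have := norm_exp_I_mul (t * μ)
    push_cast at this
    rwa [← mul_assoc] at this
  refine intervalIntegral.tendsto_integral_filter_of_dominated_convergence
    (fun t => M * (Real.log 2 + |Real.log ‖1 - exp (I * t * μ)‖|)) ?_ ?_ ?_ ?_
  · refine Eventually.of_forall fun N => ?_
    refine Measurable.aestronglyMeasurable ?_
    refine ((continuous_schwarzKernel hz).measurable).mul ?_
    refine Complex.measurable_ofReal.comp (Real.measurable_log.comp ?_)
    exact Continuous.measurable (by fun_prop)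
  · refine Eventually.of_forall fun N => ?_
    filter_upwards [ae_exp_mul_ne_one hμ] with t ht hmem
    rw [norm_mul, norm_real, Real.norm_eq_abs]
    have hM' := hM t (Set.uIoc_subset_uIcc hmem)
    exact mul_le_mul hM' (abs_log_norm_one_sub_le (hnorm t) ht (hr0 N) (hr1 N).le)
      (abs_nonneg _) ((norm_nonneg _).trans hM')
  · refine IntervalIntegrable.const_mul ?_ _
    exact (intervalIntegrable_const).add (intervalIntegrable_log_norm_one_sub μ).abs
  · filter_upwards [ae_exp_mul_ne_one hμ] with t ht _
    refine Tendsto.const_mul _ ?_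
    refine (continuous_ofReal.tendsto _).comp ?_
    refine Tendsto.log ?_ (norm_ne_zero_iff.2 (sub_ne_zero.2 ht.symm))
    refine Tendsto.norm ?_
    simpa using tendsto_const_nhds.sub (hrlimC.mul_const (exp (I * t * μ)))

/-! ### Schwarz integral through Fourier coefficients -/

/-- Fourier coefficients on `(-π, π)`. -/
def fourierCoefReal (g : ℝ → ℝ) (k : ℕ) : ℂ :=
  (1 / (2 * π)) * ∫ t in (-π)..π, exp (-(I * t * k)) * (g t : ℂ)

/-- The kernel equals 2/(1 - z e^{-it}) - 1. Its geometric expansion is integrated termwise with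
majorant |z|^k |g|, so integrability of g suffices. -/
theorem schwarzIntegral_eq_tsum {g : ℝ → ℝ} (hg : IntervalIntegrable g volume (-π) π) {z : ℂ}
    (hz : ‖z‖ < 1) :
    schwarzIntegral g z = -fourierCoefReal g 0 + 2 * ∑' k, fourierCoefReal g k * z ^ k := by
  have hgC : IntervalIntegrable (fun t => (g t : ℂ)) volume (-π) π := ⟨hg.1.ofReal, hg.2.ofReal⟩
  have hint : ∀ k : ℕ, IntervalIntegrable (fun t : ℝ => exp (-(I * t * k)) * (g t : ℂ))
      volume (-π) π := fun k => hgC.continuousOn_mul (by fun_prop)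
  have hnorm : ∀ (k : ℕ) (t : ℝ), ‖exp (-(I * t * k))‖ = 1 := fun k t => by
    have := norm_exp_I_mul (-(t * k))
    push_cast at this
    rwa [mul_neg, ← mul_assoc] at this
  have hs : HasSum (fun k : ℕ => ∫ t in (-π)..π, z ^ k * (exp (-(I * t * k)) * (g t : ℂ)))
      (∫ t in (-π)..π, (1 - z * exp (-(I * t)))⁻¹ * (g t : ℂ)) := by
    refine intervalIntegral.hasSum_integral_of_dominated_convergence
      (fun k t => ‖z‖ ^ k * |g t|) ?_ ?_ ?_ ?_ ?_
    · intro k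
      have h := ((hint k).const_mul (z ^ k)).1.aestronglyMeasurable
      rwa [← Set.uIoc_of_le (by linarith [Real.pi_pos])] at h
    · intro k
      refine Eventually.of_forall fun t _ => ?_
      rw [norm_mul, norm_mul, norm_pow, hnorm, one_mul, norm_real, Real.norm_eq_abs]
    · exact Eventually.of_forall fun t _ =>
        (summable_geometric_of_lt_one (norm_nonneg _) hz).mul_right _
    · simp_rw [tsum_mul_right]
      exact hg.abs.const_mul _
    · refine Eventually.of_forall fun t _ => ?_
      have h1 : ‖z * exp (-(I * t))‖ < 1 := by
        have := hnorm 1 t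
        simp only [Nat.cast_one, mul_one] at this
        rw [norm_mul, this, mul_one]; exact hz
      refine ((hasSum_geometric_of_norm_lt_one h1).mul_right (g t : ℂ)).congr_fun fun k => ?_
      have hk : exp (-(I * t * k)) = exp (-(I * t)) ^ k := by
        rw [← exp_nat_mul]; congr 1; ring
      rw [mul_pow, hk, mul_assoc]
  have key : ∀ t : ℝ, ((exp (I * t) + z) / (exp (I * t) - z)) * (g t : ℂ) =
      2 * ((1 - z * exp (-(I * t)))⁻¹ * (g t : ℂ)) - exp (-(I * t * (0 : ℕ))) * (g t : ℂ) :=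
    fun t => by
    have hne := exp_I_mul_sub_ne_zero hz t
    have he := exp_ne_zero (I * t)
    have h2 : 1 - z * exp (-(I * t)) = (exp (I * t) - z) / exp (I * t) := by
      rw [exp_neg]; field_simp
    rw [h2, inv_div]
    simp only [Nat.cast_zero, mul_zero, neg_zero, exp_zero, one_mul]
    field_simp
    ring
  rw [schwarzIntegral]
  simp_rw [key]
  have hI : IntervalIntegrable (fun t : ℝ => (1 - z * exp (-(I * t)))⁻¹ * (g t : ℂ))
      volume (-π) π := by
    refine hgC.continuousOn_mul (Continuous.continuousOn ?_)
    refine Continuous.inv₀ (by fun_prop) fun t h => ?_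
    have := exp_I_mul_sub_ne_zero hz t
    apply this
    have h3 := congrArg (fun x => exp (I * t) * x) h
    simp only [mul_zero] at h3
    rw [← h3, exp_neg]
    have he := exp_ne_zero (I * t)
    field_simp
  rw [intervalIntegral.integral_sub (hI.const_mul _) (hint 0),
    intervalIntegral.integral_const_mul, ← hs.tsum_eq]
  simp_rw [intervalIntegral.integral_const_mul, fourierCoefReal]
  have h5 : ∀ k : ℕ, (1 / (2 * π) * ∫ t in (-π)..π, exp (-(I * t * k)) * (g t : ℂ)) * z ^ k =
      (1 / (2 * π)) * (z ^ k * ∫ t in (-π)..π, exp (-(I * t * k)) * (g t : ℂ)) := fun k => by ring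
  simp_rw [h5, tsum_mul_left]
  ring

/-! ### The logarithm of `|1 - e^{it}| / |t|` -/

/-- The entire function `sin z / z`. -/
def entireSinc : ℂ → ℂ := dslope Complex.sin 0

theorem differentiable_entireSinc : Differentiable ℂ entireSinc := by
  have := (differentiableOn_dslope (E := ℂ) (f := Complex.sin) (s := Set.univ) (c := 0)
    univ_mem).2 differentiable_sin.differentiableOn
  exact differentiableOn_univ.1 this

theorem entireSinc_zero : entireSinc 0 = 1 := by
  rw [entireSinc, dslope_same]; simp

theorem entireSinc_of_ne {z : ℂ} (hz : z ≠ 0) : entireSinc z = Complex.sin z / z := by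
  rw [entireSinc, dslope_of_ne _ hz, slope_def_field]; simp

theorem exists_entireSinc_eq {t : ℝ} (ht : t ∈ Set.Icc (-π) π) :
    ∃ s : ℝ, 0 < s ∧ entireSinc (t / 2) = s := by
  rcases eq_or_ne t 0 with rfl | h0
  · exact ⟨1, one_pos, by simp [entireSinc_zero]⟩
  · refine ⟨Real.sin (t / 2) / (t / 2), ?_, ?_⟩
    · rcases lt_or_gt_of_ne h0 with h | h
      · exact div_pos_of_neg_of_neg (Real.sin_neg_of_neg_of_neg_pi_lt (by linarith)
          (by linarith [ht.1, Real.pi_pos])) (by linarith)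
      · exact div_pos (Real.sin_pos_of_pos_of_lt_pi (by linarith)
          (by linarith [ht.2, Real.pi_pos])) (by linarith)
    · rw [entireSinc_of_ne (by simpa using h0)]
      push_cast
      rfl

/-- `log |sin(t/2) / (t/2)|`. -/
def logSinc (t : ℝ) : ℝ := Real.log ‖entireSinc (t / 2)‖

theorem ofReal_logSinc {t : ℝ} (ht : t ∈ Set.Icc (-π) π) :
    (logSinc t : ℂ) = log (entireSinc (t / 2)) := by
  obtain ⟨s, hs, h⟩ := exists_entireSinc_eq ht
  rw [logSinc, h, norm_real, Real.norm_of_nonneg hs.le, ofReal_log hs.le]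

theorem entireSinc_half_mem_slitPlane {t : ℝ} (ht : t ∈ Set.Icc (-π) π) :
    entireSinc (t / 2) ∈ slitPlane := by
  obtain ⟨s, hs, h⟩ := exists_entireSinc_eq ht
  rw [h]; exact Or.inl (by simpa using hs)

theorem entireSinc_neg (z : ℂ) : entireSinc (-z) = entireSinc z := by
  rcases eq_or_ne z 0 with rfl | hz
  · simp
  · rw [entireSinc_of_ne hz, entireSinc_of_ne (neg_ne_zero.2 hz), Complex.sin_neg, neg_div_neg_eq]

theorem logSinc_neg (t : ℝ) : logSinc (-t) = logSinc t := by
  rw [logSinc, logSinc, ofReal_neg, neg_div, entireSinc_neg]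

/-- This rests on 1 - e^{-it} = 2i e^{-it/2} sin(t/2). -/
theorem norm_entireSinc {t : ℝ} (ht : t ≠ 0) :
    ‖entireSinc (t / 2)‖ = ‖1 - exp (-(I * t))‖ / |t| := by
  have h1 : 1 - exp (-(I * t)) = exp (-(I * t) / 2) * (2 * I) * Complex.sin (t / 2) := by
    have : exp (-(I * t)) = exp (-(I * t) / 2) * exp (-(I * t) / 2) := by
      rw [← exp_add]; congr 1; ring
    have h2 : exp (t / 2 * I) = (exp (-(I * t) / 2))⁻¹ := by
      rw [← exp_neg]; congr 1; ring
    have h3 : -(t / 2 : ℂ) * I = -(I * t) / 2 := by ring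
    rw [Complex.sin, h2, h3, this]
    have hne := exp_ne_zero (-(I * t) / 2)
    field_simp
    linear_combination ((1 : ℂ) - exp (-(I * t / 2)) ^ 2) * I_sq
  have h4 : ‖exp (-(I * t) / 2)‖ = 1 := by
    have := norm_exp_I_mul (-(t / 2))
    rw [← this]; congr 2; push_cast; ring
  rw [h1, entireSinc_of_ne (by simpa using ht)]
  simp only [norm_mul, norm_div, h4, norm_real, norm_I, Real.norm_eq_abs]
  simp
  field_simp

theorem hasDerivAt_logSinc {t : ℝ} (ht : t ∈ Set.Icc (-π) π) :
    HasDerivAt (fun s : ℝ => log (entireSinc (s / 2)))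
      (deriv entireSinc (t / 2) / 2 / entireSinc (t / 2)) t := by
  have h1 : HasDerivAt (fun s : ℂ => entireSinc (s / 2)) (deriv entireSinc (t / 2) / 2) (t : ℂ) := by
    have := (differentiable_entireSinc ((t : ℂ) / 2)).hasDerivAt.comp (t : ℂ)
      ((hasDerivAt_id (t : ℂ)).div_const 2)
    simpa [Function.comp_def, div_eq_mul_inv] using this
  exact (h1.clog (entireSinc_half_mem_slitPlane ht)).comp_ofReal

/-- Continuity of the second derivative up to the endpoints is what allows a second integration by
parts in the Fourier coefficients. -/
theorem exists_hasDerivAt_deriv_logSinc :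
    ∃ D : ℝ → ℂ, ContinuousOn D (Set.Icc (-π) π) ∧ ∀ t ∈ Set.Icc (-π) π,
      HasDerivAt (fun s : ℝ => deriv entireSinc (s / 2) / 2 / entireSinc (s / 2)) (D t) t := by
  have hd : Differentiable ℂ (deriv entireSinc) := fun z =>
    ((differentiable_entireSinc.analyticAt z).deriv).differentiableAt
  have hd2 : Continuous (deriv (deriv entireSinc)) :=
    continuous_iff_continuousAt.2 fun z => ((hd.analyticAt z).deriv).continuousAt
  refine ⟨fun t => (deriv (deriv entireSinc) (t / 2) / 2 / 2 * entireSinc (t / 2) -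
    deriv entireSinc (t / 2) / 2 * (deriv entireSinc (t / 2) / 2)) / entireSinc (t / 2) ^ 2,
    ?_, fun t ht => ?_⟩
  · have hc := differentiable_entireSinc.continuous
    have hc1 := hd.continuous
    refine ContinuousOn.div (Continuous.continuousOn (by fun_prop))
      (Continuous.continuousOn (by fun_prop)) fun t ht => ?_
    exact pow_ne_zero _ (slitPlane_ne_zero (entireSinc_half_mem_slitPlane ht))
  · have half : HasDerivAt (fun s : ℂ => s / 2) (1 / 2) (t : ℂ) := (hasDerivAt_id (t : ℂ)).div_const 2
    have h1 : HasDerivAt (fun s : ℂ => entireSinc (s / 2)) (deriv entireSinc (t / 2) / 2)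
        (t : ℂ) := by
      have := (differentiable_entireSinc ((t : ℂ) / 2)).hasDerivAt.comp (t : ℂ) half
      simpa [Function.comp_def, div_eq_mul_inv] using this
    have h2 : HasDerivAt (fun s : ℂ => deriv entireSinc (s / 2) / 2)
        (deriv (deriv entireSinc) (t / 2) / 2 / 2) (t : ℂ) := by
      have := ((hd ((t : ℂ) / 2)).hasDerivAt.comp (t : ℂ) half).div_const 2
      simpa [Function.comp_def, div_eq_mul_inv] using this
    exact (h2.div h1 (slitPlane_ne_zero (entireSinc_half_mem_slitPlane ht))).comp_ofReal

theorem continuousOn_log_entireSinc :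
    ContinuousOn (fun s : ℝ => log (entireSinc (s / 2))) (Set.Icc (-π) π) := fun _ ht =>
  (hasDerivAt_logSinc ht).continuousAt.continuousWithinAt

theorem continuousOn_logSinc : ContinuousOn logSinc (Set.Icc (-π) π) := by
  have := Complex.continuous_re.comp_continuousOn continuousOn_log_entireSinc
  refine this.congr fun t ht => ?_
  simp [← ofReal_logSinc ht]

theorem neg_pi_lt_pi : -π < π := by linarith [Real.pi_pos]

theorem norm_fourier_apply {T : ℝ} (k : ℤ) (x : AddCircle T) : ‖fourier k x‖ = 1 := by
  rw [fourier_apply]; exact Circle.norm_coe _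

theorem norm_fourierCoeffOn_le {f : ℝ → ℂ} {M : ℝ} (hM : ∀ t ∈ Set.Icc (-π) π, ‖f t‖ ≤ M) (k : ℤ) :
    ‖fourierCoeffOn neg_pi_lt_pi f k‖ ≤ M := by
  have hpi := Real.pi_pos
  have : Fact (0 < π - -π) := ⟨by linarith⟩
  rw [fourierCoeffOn_eq_integral, norm_smul]
  have h := intervalIntegral.norm_integral_le_of_norm_le_const (a := -π) (b := π) (C := M)
    (f := fun x : ℝ => fourier (-k) (x : AddCircle (π - -π)) • f x) fun t ht => by
      rw [norm_smul, norm_fourier_apply, one_mul]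
      rw [Set.uIoc_of_le neg_pi_lt_pi.le] at ht
      exact hM t (Set.Ioc_subset_Icc_self ht)
  have h2 : |π - -π| = 2 * π := by rw [abs_of_pos (by linarith)]; ring
  rw [h2] at h
  calc ‖1 / (π - -π)‖ * _ ≤ ‖1 / (π - -π)‖ * (M * (2 * π)) := by gcongr
    _ = M := by
      rw [Real.norm_of_nonneg (by rw [one_div_nonneg]; linarith)]
      field_simp
      ring

/-- Two integrations by parts. The function is even, so it takes equal values at ±π and the first
boundary term vanishes. A possible jump of the derivative there enters only at the second step,
leaving coefficients of order k^{-2}. -/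
theorem summable_fourierCoeffOn_logSinc :
    Summable fun k : ℤ =>
      ‖fourierCoeffOn neg_pi_lt_pi (fun s : ℝ => log (entireSinc (s / 2))) k‖ := by
  obtain ⟨D, hDc, hD⟩ := exists_hasDerivAt_deriv_logSinc
  set f : ℝ → ℂ := fun s => log (entireSinc (s / 2))
  set f' : ℝ → ℂ := fun s => deriv entireSinc (s / 2) / 2 / entireSinc (s / 2)
  have hpi := Real.pi_pos
  have : Fact (0 < π - -π) := ⟨by linarith⟩
  have huIcc : Set.uIcc (-π) π = Set.Icc (-π) π := Set.uIcc_of_le neg_pi_lt_pi.le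
  have hf'c : ContinuousOn f' (Set.Icc (-π) π) := fun t ht =>
    (hD t ht).continuousAt.continuousWithinAt
  obtain ⟨M, hM⟩ := isCompact_Icc.exists_bound_of_continuousOn hDc
  set K := ‖f' π - f' (-π)‖
  have hM0 : 0 ≤ M := (norm_nonneg _).trans (hM 0 ⟨by linarith, by linarith⟩)
  have hends : f π - f (-π) = 0 := by
    simp only [f, ofReal_neg, neg_div, entireSinc_neg, sub_self]
  have hbound : ∀ k : ℤ, k ≠ 0 → ‖fourierCoeffOn neg_pi_lt_pi f k‖ ≤
      (K + 2 * π * M) * (1 / (k : ℝ) ^ 2) := fun k hk => by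
    rw [fourierCoeffOn_of_hasDerivAt neg_pi_lt_pi hk
      (fun x hx => hasDerivAt_logSinc (huIcc ▸ hx))
      (ContinuousOn.intervalIntegrable (huIcc ▸ hf'c)),
      fourierCoeffOn_of_hasDerivAt (f' := D) neg_pi_lt_pi hk (fun x hx => hD x (huIcc ▸ hx))
      (ContinuousOn.intervalIntegrable (huIcc ▸ hDc)), hends, mul_zero, zero_sub]
    have hk' : 0 < |(k : ℝ)| := abs_pos.2 (by exact_mod_cast hk)
    have h1 : ‖(1 : ℂ) / (-2 * π * I * k)‖ = 1 / (2 * π * |(k : ℝ)|) := by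
      simp [abs_of_pos hpi]
    have h2 : ‖(π : ℂ) - ((-π : ℝ) : ℂ)‖ = 2 * π := by
      rw [← ofReal_sub, norm_real, Real.norm_of_nonneg (by linarith)]; ring
    have h3 := norm_fourierCoeffOn_le hM k
    rw [norm_mul, h1, norm_neg, norm_mul, h2, norm_mul, h1]
    have h4 : ‖(fourier (-k) ((-π : ℝ) : AddCircle (π - -π)) : ℂ) * (f' π - f' (-π)) -
        ((π : ℂ) - ((-π : ℝ) : ℂ)) * fourierCoeffOn neg_pi_lt_pi D k‖ ≤ K + 2 * π * M := by
      refine (norm_sub_le _ _).trans ?_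
      rw [norm_mul, norm_fourier_apply, one_mul, norm_mul, h2]
      gcongr
    calc 1 / (2 * π * |(k : ℝ)|) * (2 * π * (1 / (2 * π * |(k : ℝ)|) * _))
        ≤ 1 / (2 * π * |(k : ℝ)|) * (2 * π * (1 / (2 * π * |(k : ℝ)|) * (K + 2 * π * M))) := by
          gcongr
      _ = (K + 2 * π * M) * (1 / (k : ℝ) ^ 2) * (1 / (2 * π)) := by
          rw [← sq_abs (k : ℝ)]; field_simp
      _ ≤ (K + 2 * π * M) * (1 / (k : ℝ) ^ 2) := by
          refine mul_le_of_le_one_right (by positivity) ?_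
          rw [div_le_one (by positivity)]
          linarith [Real.pi_gt_three]
  have hs : Summable fun k : ℤ => (K + 2 * π * M) * (1 / (k : ℝ) ^ 2) :=
    (Real.summable_one_div_int_pow.2 one_lt_two).mul_left _
  refine Summable.of_norm_bounded_eventually hs ?_
  rw [Filter.eventually_cofinite]
  refine (Set.finite_singleton 0).subset fun k hk => ?_
  by_contra h
  exact hk (by simpa using hbound k h)

/-- The Fourier coefficients of `logSinc`. -/
def logSincCoef (k : ℕ) : ℂ := fourierCoefReal logSinc k

theorem fourierCoeffOn_natCast (k : ℕ) :
    fourierCoeffOn neg_pi_lt_pi (fun s : ℝ => log (entireSinc (s / 2))) k = logSincCoef k := by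
  rw [fourierCoeffOn_eq_integral, logSincCoef, fourierCoefReal, real_smul]
  congr 1
  · push_cast; ring
  · refine intervalIntegral.integral_congr fun t ht => ?_
    rw [Set.uIcc_of_le neg_pi_lt_pi.le] at ht
    simp only [smul_eq_mul, ofReal_logSinc ht, fourier_coe_apply]
    congr 2
    have := Real.pi_ne_zero
    push_cast
    field_simp
    ring

theorem fourierCoeffOn_neg_natCast (k : ℕ) :
    fourierCoeffOn neg_pi_lt_pi (fun s : ℝ => log (entireSinc (s / 2))) (-k : ℤ) =
      conj (logSincCoef k) := by
  rw [← fourierCoeffOn_natCast, fourierCoeffOn_eq_integral, fourierCoeffOn_eq_integral,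
    real_smul, real_smul, map_mul, conj_ofReal, ← intervalIntegral.intervalIntegral_conj]
  congr 1
  refine intervalIntegral.integral_congr fun t ht => ?_
  rw [Set.uIcc_of_le neg_pi_lt_pi.le] at ht
  simp only [smul_eq_mul, ← ofReal_logSinc ht, map_mul, conj_ofReal, fourier_neg, conj_conj]

theorem summable_logSincCoef : Summable fun k => ‖logSincCoef k‖ := by
  simp_rw [← fourierCoeffOn_natCast]
  exact summable_fourierCoeffOn_logSinc.comp_injective Nat.cast_injective

theorem hasSum_fourier_logSinc {t : ℝ} (ht : t ∈ Set.Icc (-π) π) :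
    HasSum (fun k : ℤ => fourierCoeffOn neg_pi_lt_pi (fun s : ℝ => log (entireSinc (s / 2))) k *
      exp (I * t * k)) (logSinc t) := by
  have hpi := Real.pi_pos
  set T : ℝ := π - -π with hT
  have hTpos : Fact (0 < T) := ⟨by rw [hT]; linarith⟩
  set f : ℝ → ℂ := fun s => log (entireSinc (s / 2)) with hf
  have hend : -π + T = π := by rw [hT]; ring
  have hc : Continuous (AddCircle.liftIco T (-π) f) := by
    refine AddCircle.liftIco_continuous ?_ ?_
    · simp only [hend, hf, ofReal_neg, neg_div, entireSinc_neg]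
    · rw [hend]; exact continuousOn_log_entireSinc
  have hcoef : ∀ k, fourierCoeff (AddCircle.liftIco T (-π) f) k =
      fourierCoeffOn neg_pi_lt_pi f k := fun k => by
    rw [fourierCoeff_liftIco_eq, fourierCoeffOn_eq_integral, fourierCoeffOn_eq_integral]
    have h2 : -π + (π - -π) = π := by ring
    simp only [fourier_coe_apply, hT, h2]
  set F : C(AddCircle T, ℂ) := ⟨_, hc⟩
  have hs : Summable (fourierCoeff F) := by
    refine Summable.of_norm (summable_fourierCoeffOn_logSinc.congr fun k => ?_)
    rw [← hcoef k]; rfl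
  have hpt : ∀ s ∈ Set.Ico (-π) π, HasSum (fun k : ℤ => fourierCoeffOn neg_pi_lt_pi f k *
      exp (I * s * k)) (logSinc s) := fun s hs' => by
    have h := has_pointwise_sum_fourier_series_of_summable hs (s : AddCircle T)
    have hv : F (s : AddCircle T) = f s :=
      AddCircle.liftIco_coe_apply (f := f) (by rwa [hend])
    rw [hv] at h
    rw [ofReal_logSinc (Set.Ico_subset_Icc_self hs')]
    refine h.congr_fun fun k => ?_
    rw [smul_eq_mul]
    congr 1
    · exact (hcoef k).symm
    · rw [fourier_coe_apply, hT]
      congr 1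
      have := Real.pi_ne_zero
      push_cast
      field_simp
      ring
  -- The lift to the circle represents the function on [-π, π) only. The endpoint π is reached from
  -- -π by evenness and periodicity of the exponentials.
  rcases ht.2.eq_or_lt with rfl | hlt
  · have h := hpt (-π) ⟨le_rfl, neg_pi_lt_pi⟩
    rw [logSinc_neg] at h
    refine h.congr_fun fun k => ?_
    congr 1
    rw [exp_eq_exp_iff_exists_int]
    exact ⟨k, by push_cast; ring⟩
  · exact hpt t ⟨ht.1, hlt⟩

/-- Coefficients of the analytic completion of `logSinc`. -/
def sincSeries (k : ℕ) : ℂ := if k = 0 then logSincCoef 0 else 2 * logSincCoef k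

theorem summable_sincSeries : Summable fun k => ‖sincSeries k‖ := by
  refine (summable_logSincCoef.mul_left 2).of_nonneg_of_le (fun _ => norm_nonneg _) fun k => ?_
  rw [sincSeries]
  split_ifs with h
  · subst h; linarith [norm_nonneg (logSincCoef 0)]
  · simp

theorem tsum_sincSeries {z : ℂ} (hz : ‖z‖ ≤ 1) :
    ∑' k, sincSeries k * z ^ k = -logSincCoef 0 + 2 * ∑' k, logSincCoef k * z ^ k := by
  have h1 := (summable_norm_mul_pow summable_sincSeries hz).of_norm
  have h2 := (summable_norm_mul_pow summable_logSincCoef hz).of_norm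
  rw [h1.tsum_eq_zero_add, h2.tsum_eq_zero_add]
  simp only [sincSeries, pow_zero, mul_one, if_true, Nat.add_eq_zero_iff, one_ne_zero, and_false,
    if_false, mul_assoc, tsum_mul_left]
  ring

theorem schwarzIntegral_logSinc {z : ℂ} (hz : ‖z‖ < 1) :
    schwarzIntegral logSinc z = ∑' k, sincSeries k * z ^ k := by
  rw [schwarzIntegral_eq_tsum (ContinuousOn.intervalIntegrable
    (by rw [Set.uIcc_of_le neg_pi_lt_pi.le]; exact continuousOn_logSinc)) hz,
    tsum_sincSeries hz.le]
  rfl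

/-- Coefficients of opposite frequencies are conjugate because the function is real. Doubling the
positive frequencies therefore keeps the real part equal to the two-sided Fourier series. -/
theorem re_tsum_sincSeries {t : ℝ} (ht : t ∈ Set.Icc (-π) π) :
    (∑' k, sincSeries k * exp (I * t) ^ k).re = logSinc t := by
  have hz : ‖exp (I * t)‖ ≤ 1 := (norm_exp_I_mul t).le
  rw [tsum_sincSeries hz]
  have h := hasSum_fourier_logSinc ht
  have h2 := (summable_norm_mul_pow summable_logSincCoef hz).of_norm.hasSum
  set S := ∑' k, logSincCoef k * exp (I * t) ^ k
  have h3 : HasSum (fun k : ℕ => conj (logSincCoef k * exp (I * t) ^ k)) (conj S) :=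
    h2.mapL (Complex.conjCLE : ℂ →L[ℝ] ℂ)
  have hk : ∀ k : ℤ, exp (I * t * k) = exp (I * t) ^ k := fun k => by
    rw [← exp_int_mul]; congr 1; ring
  have h4 := HasSum.of_nat_of_neg (f := fun k : ℤ =>
    fourierCoeffOn neg_pi_lt_pi (fun s : ℝ => log (entireSinc (s / 2))) k * exp (I * t * k))
    (h2.congr_fun fun k => by
      rw [fourierCoeffOn_natCast, hk, zpow_natCast]) (h3.congr_fun fun k => by
      rw [fourierCoeffOn_neg_natCast, map_mul, map_pow, hk, zpow_neg, zpow_natCast, ← inv_pow,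
        ← exp_conj, ← exp_neg]
      simp)
  have h5 := h.unique h4
  have h6 := congrArg re h5
  simp only [ofReal_re, Int.cast_zero, mul_zero, exp_zero, mul_one, sub_re, add_re, conj_re] at h6
  have h7 : fourierCoeffOn neg_pi_lt_pi (fun s : ℝ => log (entireSinc (s / 2))) 0 =
      logSincCoef 0 := fourierCoeffOn_natCast 0
  rw [h7] at h6
  rw [h6]
  simp
  ring

/-! ### The outer function `w_μ` -/

/-- The analytic completion of `logSinc`, on the closed unit disk. -/
def sincLog (z : ℂ) : ℂ := ∑' k, sincSeries k * z ^ k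

theorem hasWienerSeries_sincLog : HasWienerSeries sincLog sincSeries :=
  HasWienerSeries.of_summable summable_sincSeries

theorem norm_exp_neg_I_mul (t : ℝ) : ‖exp (-(I * t))‖ = 1 := by
  have := norm_exp_I_mul (-t)
  rwa [ofReal_neg, mul_neg] at this

theorem norm_exp_sincLog {t : ℝ} (ht : t ∈ Set.Icc (-π) π) (h0 : t ≠ 0) :
    ‖exp (sincLog (exp (-(I * t))))‖ = ‖1 - exp (-(I * t))‖ / |t| := by
  have ht' : -t ∈ Set.Icc (-π) π := ⟨by linarith [ht.2], by linarith [ht.1]⟩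
  have h := re_tsum_sincSeries ht'
  rw [ofReal_neg, mul_neg, logSinc_neg] at h
  rw [norm_exp, sincLog, h, logSinc, ← norm_entireSinc h0, Real.exp_log]
  obtain ⟨s, hs, he⟩ := exists_entireSinc_eq ht
  rw [he]; simpa using hs.ne'

theorem norm_one_sub_exp_neg (t : ℝ) (μ : ℕ) :
    ‖1 - exp (-(I * t * μ))‖ = ‖1 - exp (I * t * μ)‖ := by
  rw [← RCLike.norm_conj, map_sub, map_one, ← exp_conj]
  simp

/-- Inserting |1 - e^{it}| separates the two difficulties: the quotient by it is the modulus of a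
geometric sum, and its own quotient by |t| is the smooth function sinc. -/
theorem log_incr_eq (n : ℕ) {μ : ℕ} {t : ℝ} (ht : t ≠ 0)
    (h1 : exp (I * t * (1 : ℕ)) ≠ 1) (hμ : exp (I * t * μ) ≠ 1) :
    Real.log (‖1 - exp (-(I * t * μ))‖ ^ (2 * n) / t ^ (2 * n)) =
      2 * n * (Real.log ‖1 - exp (I * t * μ)‖ - Real.log ‖1 - exp (I * t * (1 : ℕ))‖ +
        logSinc t) := by
  have hx1 : ‖1 - exp (I * t * (1 : ℕ))‖ ≠ 0 := norm_ne_zero_iff.2 (sub_ne_zero.2 h1.symm)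
  have hxμ : ‖1 - exp (I * t * μ)‖ ≠ 0 := norm_ne_zero_iff.2 (sub_ne_zero.2 hμ.symm)
  have h2 : t ^ (2 * n) = |t| ^ (2 * n) := by rw [pow_mul, pow_mul, sq_abs]
  have h3 := norm_one_sub_exp_neg t 1
  rw [Nat.cast_one, mul_one] at h3
  rw [logSinc, norm_entireSinc ht, h3, h2, ← div_pow, Real.log_pow, norm_one_sub_exp_neg,
    Real.log_div hxμ (abs_ne_zero.2 ht), Real.log_div (by simpa using hx1) (abs_ne_zero.2 ht)]
  push_cast
  rw [mul_one]
  ring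

theorem intervalIntegrable_logSinc : IntervalIntegrable logSinc volume (-π) π :=
  ContinuousOn.intervalIntegrable
    (by rw [Set.uIcc_of_le neg_pi_lt_pi.le]; exact continuousOn_logSinc)

/-- The constant 1/(4π) is half the Schwarz normalization, which turns the exponent 2n into n. After
exponentiation, (1 - z^μ)/(1 - z) becomes a polynomial, so the right-hand side extends continuously
to the closed disk. -/
theorem outerW_eq (n : ℕ) {μ : ℕ} (hμ : 0 < μ) {z : ℂ} (hz : ‖z‖ < 1) :
    outerW n μ z = (∑ j ∈ Finset.range μ, z ^ j) ^ n * exp (sincLog z) ^ n := by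
  have hexp : (1 / (4 * π)) * ∫ t in (-π)..π, ((exp (I * t) + z) / (exp (I * t) - z)) *
      ((Real.log (‖1 - exp (-(I * t * μ))‖ ^ (2 * n) / t ^ (2 * n)) : ℝ) : ℂ) =
      n * (log (1 - z ^ μ) - log (1 - z ^ 1) + sincLog z) := by
    rw [← schwarzIntegral_log_norm_one_sub hμ hz, ← schwarzIntegral_log_norm_one_sub one_pos hz,
      sincLog, ← schwarzIntegral_logSinc hz]
    have hcong : ∫ t in (-π)..π, ((exp (I * t) + z) / (exp (I * t) - z)) *
        ((Real.log (‖1 - exp (-(I * t * μ))‖ ^ (2 * n) / t ^ (2 * n)) : ℝ) : ℂ) =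
        ∫ t in (-π)..π, (2 * n) * (((exp (I * t) + z) / (exp (I * t) - z)) *
          ((Real.log ‖1 - exp (I * t * μ)‖ : ℝ) : ℂ) - ((exp (I * t) + z) / (exp (I * t) - z)) *
          ((Real.log ‖1 - exp (I * t * (1 : ℕ))‖ : ℝ) : ℂ) +
          ((exp (I * t) + z) / (exp (I * t) - z)) * ((logSinc t : ℝ) : ℂ)) := by
      refine intervalIntegral.integral_congr_ae ?_
      have h0 : ∀ᵐ t : ℝ, t ≠ 0 := by simp [ae_iff]
      filter_upwards [h0, ae_exp_mul_ne_one hμ, ae_exp_mul_ne_one one_pos] with t ht hm h1 _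
      rw [log_incr_eq n ht h1 hm]
      push_cast
      ring
    have hA := intervalIntegrable_schwarz hz (intervalIntegrable_log_norm_one_sub μ)
    have hB := intervalIntegrable_schwarz hz (intervalIntegrable_log_norm_one_sub 1)
    have hC := intervalIntegrable_schwarz hz intervalIntegrable_logSinc
    rw [hcong, intervalIntegral.integral_const_mul, intervalIntegral.integral_add (hA.sub hB) hC,
      intervalIntegral.integral_sub hA hB]
    have hcomb : ∀ A B C : ℂ, 1 / (4 * (π : ℂ)) * (2 * n * (A - B + C)) =
        n * (1 / (2 * π) * A - 1 / (2 * π) * B + 1 / (2 * π) * C) := fun A B C => by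
      have := ofReal_ne_zero.2 Real.pi_ne_zero
      field_simp
      ring
    exact hcomb _ _ _
  have hz1 : 1 - z ≠ 0 := slitPlane_ne_zero (one_sub_mem_slitPlane hz)
  have hzμ : 1 - z ^ μ ≠ 0 := by
    refine slitPlane_ne_zero (one_sub_mem_slitPlane ?_)
    rw [norm_pow]; exact pow_lt_one₀ (norm_nonneg _) hz hμ.ne'
  have hgeom : (1 - z ^ μ) / (1 - z) = ∑ j ∈ Finset.range μ, z ^ j := by
    rw [div_eq_iff hz1, geom_sum_mul_neg]
  rw [outerW, hexp, exp_nat_mul, exp_add, exp_sub, exp_log hzμ, pow_one, exp_log hz1, hgeom,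
    mul_pow]

/-- The boundary-continuous form of `w_μ` on the closed disk. -/
def outerFun (n μ : ℕ) (z : ℂ) : ℂ := (∑ j ∈ Finset.range μ, z ^ j) ^ n * exp (sincLog z) ^ n

theorem exists_hasWienerSeries_outerFun (n μ : ℕ) : ∃ e, HasWienerSeries (outerFun n μ) e := by
  obtain ⟨e, he⟩ := HasWienerSeries.exists_sum (Finset.range μ) (F := fun j z => z ^ j)
    fun j _ => ⟨_, HasWienerSeries.id_pow j⟩
  obtain ⟨p, hp, -⟩ := he.exists_pow n
  obtain ⟨g, hg⟩ := hasWienerSeries_sincLog.exists_exp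
  obtain ⟨q, hq, -⟩ := hg.exists_pow n
  exact ⟨_, hp.mul hq⟩

theorem hasWienerSeries_outerFun (n : ℕ) {μ : ℕ} (hμ : 0 < μ) :
    HasWienerSeries (outerFun n μ) (wCoef n μ) := by
  obtain ⟨e, h⟩ := exists_hasWienerSeries_outerFun n μ
  have hw : wCoef n μ = e := funext fun k => HasWienerSeries.iteratedDeriv_div_factorial h.1
    (fun z hz => (outerW_eq n hμ hz).trans (h.2 z hz.le)) k
  rwa [hw]

theorem hasWienerSeries_Wapply (n : ℕ) {μ : ℕ} (hμ : 0 < μ) {φ : ℕ → ℂ}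
    (hφ : Summable fun k => ‖φ k‖) :
    HasWienerSeries (fun z => outerFun n μ z * ∑' k, φ k * z ^ k) (Wapply n μ φ) :=
  (hasWienerSeries_outerFun n hμ).mul (HasWienerSeries.of_summable hφ)

theorem exists_hasWienerSeries_exp_neg_sincLog (n : ℕ) :
    ∃ g, HasWienerSeries (fun z => (exp (sincLog z) ^ n)⁻¹) g := by
  obtain ⟨g, hg⟩ := (hasWienerSeries_sincLog.const_mul (-n)).exists_exp
  refine ⟨g, hg.congr fun z _ => ?_⟩
  rw [← exp_nat_mul, ← exp_neg, neg_mul]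

/-! ### Frequency functions -/

/-- The point `e^{-it}` of the unit circle. -/
def circ (t : ℝ) : ℂ := exp (-(I * t))

theorem norm_circ (t : ℝ) : ‖circ t‖ = 1 := norm_exp_neg_I_mul t

theorem circ_ne_zero (t : ℝ) : circ t ≠ 0 := exp_ne_zero _

theorem continuous_circ : Continuous circ := by unfold circ; fun_prop

theorem exp_neg_mul_natCast (t : ℝ) (k : ℕ) : exp (-(I * t * k)) = circ t ^ k := by
  rw [circ, ← exp_nat_mul]; congr 1; ring

theorem exp_mul_intCast (t : ℝ) (k : ℤ) : exp (I * t * k) = circ t ^ (-k) := by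
  rw [circ, ← exp_int_mul]; congr 1; push_cast; ring

theorem exp_mul_natCast (t : ℝ) (k : ℕ) : exp (I * t * k) = conj (circ t) ^ k := by
  rw [circ, ← exp_conj, ← exp_nat_mul]; congr 1; simp; ring

theorem conj_circ (t : ℝ) : conj (circ t) = (circ t)⁻¹ := by
  rw [circ, ← exp_conj, ← exp_neg]; simp

theorem norm_exp_mul_intCast (t : ℝ) (k : ℤ) : ‖exp (I * t * k)‖ = 1 := by
  rw [exp_mul_intCast, norm_zpow, norm_circ, one_zpow]

theorem factorFun_eq (φ : ℕ → ℂ) (t : ℝ) : factorFun φ t = ∑' k, φ k * circ t ^ k := by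
  simp_rw [factorFun, exp_neg_mul_natCast]

theorem HasWienerSeries.continuous_circ {F : ℂ → ℂ} {e : ℕ → ℂ} (h : HasWienerSeries F e) :
    Continuous fun t => F (circ t) := by
  have : (fun t => F (circ t)) = fun t => ∑' k, e k * circ t ^ k :=
    funext fun t => h.2 _ (norm_circ t).le
  rw [this]
  refine continuous_tsum (fun k => continuous_const.mul (_root_.continuous_circ.pow k)) h.1
    fun k t => ?_
  rw [norm_mul, norm_pow, norm_circ, one_pow, mul_one]

theorem HasWienerSeries.norm_circ_le {F : ℂ → ℂ} {e : ℕ → ℂ} (h : HasWienerSeries F e) (t : ℝ) :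
    ‖F (circ t)‖ ≤ ∑' k, ‖e k‖ := by
  rw [h.2 _ (norm_circ t).le]
  refine tsum_of_norm_bounded h.1.hasSum fun k => ?_
  rw [norm_mul, norm_pow, norm_circ, one_pow, mul_one]

theorem factorFun_ne_zero {φ : ℕ → ℂ} (hφ : IsCanonical φ) (t : ℝ) : factorFun φ t ≠ 0 := by
  rw [factorFun_eq]; exact hφ.2 _ (norm_circ t).le

theorem continuous_factorFun {φ : ℕ → ℂ} (hφ : Summable fun k => ‖φ k‖) :
    Continuous (factorFun φ) := by
  simp_rw [funext (factorFun_eq φ)]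
  exact (HasWienerSeries.of_summable hφ).continuous_circ

theorem factorFun_Wapply (n : ℕ) {μ : ℕ} (hμ : 0 < μ) {φ : ℕ → ℂ} (hφ : Summable fun k => ‖φ k‖)
    (t : ℝ) : factorFun (Wapply n μ φ) t = outerFun n μ (circ t) * factorFun φ t := by
  rw [factorFun_eq, factorFun_eq, ← (hasWienerSeries_Wapply n hμ hφ).2 _ (norm_circ t).le]

theorem summable_Wapply (n : ℕ) {μ : ℕ} (hμ : 0 < μ) {φ : ℕ → ℂ} (hφ : Summable fun k => ‖φ k‖) :
    Summable fun k => ‖Wapply n μ φ k‖ := (hasWienerSeries_Wapply n hμ hφ).1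

/-- The unimodular factor of the increments of step one. -/
def phaseFun (n : ℕ) (t : ℝ) : ℂ := incrFactor n 1 t / exp (sincLog (circ t)) ^ n

theorem incrFactor_eq_geom (n s : ℕ) (t : ℝ) :
    incrFactor n s t = (∑ j ∈ Finset.range s, circ t ^ j) ^ n * incrFactor n 1 t := by
  have h : 1 - exp (-(I * t * s)) = (∑ j ∈ Finset.range s, circ t ^ j) * (1 - circ t) := by
    rw [exp_neg_mul_natCast, geom_sum_mul_neg]
  rw [incrFactor, h, incrFactor, exp_neg_mul_natCast, pow_one, mul_pow, mul_div_assoc]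

/-- The phase does not depend on the step. It disappears from all moduli, and one innovation
sequence can serve the increments of every positive step. -/
theorem incrFactor_eq_phase (n s : ℕ) (t : ℝ) :
    incrFactor n s t = phaseFun n t * outerFun n s (circ t) := by
  have : exp (sincLog (circ t)) ^ n ≠ 0 := pow_ne_zero _ (exp_ne_zero _)
  rw [incrFactor_eq_geom, phaseFun, outerFun]
  field_simp

theorem norm_phaseFun (n : ℕ) {t : ℝ} (ht : t ∈ Set.Ioc (-π) π) (h0 : t ≠ 0) :
    ‖phaseFun n t‖ = 1 := by
  have h1 : ‖exp (sincLog (circ t)) ^ n‖ ≠ 0 := norm_ne_zero_iff.2 (pow_ne_zero _ (exp_ne_zero _))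
  rw [phaseFun, norm_div, div_eq_one_iff_eq h1, norm_pow, circ,
    norm_exp_sincLog (Set.Ioc_subset_Icc_self ht) h0, incrFactor, Nat.cast_one, mul_one, norm_div,
    norm_pow, norm_pow, norm_mul, norm_I, one_mul, norm_real, div_pow, Real.norm_eq_abs]

theorem ae_freq_mem : ∀ᵐ t ∂freqMeasure, t ∈ Set.Ioc (-π) π := ae_restrict_mem measurableSet_Ioc

theorem ae_freq_ne_zero : ∀ᵐ t ∂freqMeasure, t ≠ 0 :=
  ae_restrict_of_ae (by simp [ae_iff])

theorem ae_freq_norm_phaseFun (n : ℕ) : ∀ᵐ t ∂freqMeasure, ‖phaseFun n t‖ = 1 := by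
  filter_upwards [ae_freq_mem, ae_freq_ne_zero] with t ht h0 using norm_phaseFun n ht h0

theorem ae_freq_circ_pow_ne_one {μ : ℕ} (hμ : 0 < μ) : ∀ᵐ t ∂freqMeasure, circ t ^ μ ≠ 1 := by
  refine ae_restrict_of_ae ?_
  filter_upwards [ae_exp_mul_ne_one hμ] with t ht h
  apply ht
  rw [exp_mul_natCast, ← map_pow, h, map_one]

theorem geom_circ_ne_zero {μ : ℕ} {t : ℝ} (h : circ t ^ μ ≠ 1) :
    ∑ j ∈ Finset.range μ, circ t ^ j ≠ 0 := fun h0 => by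
  have := geom_sum_mul_neg (circ t) μ
  rw [h0, zero_mul, eq_comm, sub_eq_zero] at this
  exact h this.symm

theorem ae_freq_outerFun_ne_zero (n : ℕ) {μ : ℕ} (hμ : 0 < μ) :
    ∀ᵐ t ∂freqMeasure, outerFun n μ (circ t) ≠ 0 := by
  filter_upwards [ae_freq_circ_pow_ne_one hμ] with t ht
  exact mul_ne_zero (pow_ne_zero _ (geom_circ_ne_zero ht)) (pow_ne_zero _ (exp_ne_zero _))

theorem ae_freq_incrFactor_ne_zero (n : ℕ) {μ : ℕ} (hμ : 0 < μ) :
    ∀ᵐ t ∂freqMeasure, incrFactor n μ t ≠ 0 := by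
  filter_upwards [ae_freq_outerFun_ne_zero n hμ, ae_freq_norm_phaseFun n] with t h1 h2
  rw [incrFactor_eq_phase]
  refine mul_ne_zero (fun h => ?_) h1
  rw [h, norm_zero] at h2
  exact zero_ne_one h2

theorem measurable_incrFactor (n μ : ℕ) : Measurable (incrFactor n μ) := by
  unfold incrFactor
  exact Measurable.div (Continuous.measurable (by fun_prop)) (Continuous.measurable (by fun_prop))

/-! ### The Hankel operator `D^μ A` -/

/-- The defining series depends on the two indices only through their sum, so D^μA is a Hankel
matrix; this is what makes r_φ the analytic part in e^{it} of a product. -/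
theorem DAentry_eq (a : ℕ → ℂ) (n μ k m : ℕ) : DAentry a n μ k m = bCoef a n μ (k + m) := by
  rw [DAentry, bCoef]
  congr! 2 with l
  rw [mul_comm, show k + l + m = k + m + l by ring]

theorem DAapply_eq (a : ℕ → ℂ) (n μ : ℕ) (x : ℕ → ℂ) (k : ℕ) :
    DAapply a n μ x k = ∑' m, bCoef a n μ (k + m) * x m := by
  simp_rw [DAapply, DAentry_eq]

theorem summable_hankel {b x : ℕ → ℂ} (hb : Summable fun k => ‖b k‖)
    (hx : Summable fun k => ‖x k‖) : Summable fun p : ℕ × ℕ => ‖b (p.1 + p.2) * x p.2‖ := by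
  have h := (hb.mul_of_nonneg hx (fun _ => norm_nonneg _) fun _ => norm_nonneg _)
  have hinj : Function.Injective fun p : ℕ × ℕ => (p.1 + p.2, p.2) := by
    rintro ⟨a, b⟩ ⟨c, d⟩ h
    simp only [Prod.mk.injEq] at h ⊢
    omega
  refine (h.comp_injective hinj).congr fun p => ?_
  simp

theorem summable_norm_hankel_apply {b x : ℕ → ℂ} (hb : Summable fun k => ‖b k‖)
    (hx : Summable fun k => ‖x k‖) : Summable fun k => ‖∑' m, b (k + m) * x m‖ := by
  have h := (summable_prod_of_nonneg fun _ => norm_nonneg _).1 (summable_hankel hb hx)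
  exact h.2.of_nonneg_of_le (fun _ => norm_nonneg _) fun k => norm_tsum_le_tsum_norm (h.1 k)

theorem summable_coanalytic {b x : ℕ → ℂ} (hb : Summable fun k => ‖b k‖)
    (hx : Summable fun k => ‖x k‖) :
    Summable fun p : ℕ × ℕ => ‖b p.2 * x (p.2 + 1 + p.1)‖ := by
  have h := (hb.mul_of_nonneg hx (fun _ => norm_nonneg _) fun _ => norm_nonneg _)
  have hinj : Function.Injective fun p : ℕ × ℕ => (p.2, p.2 + 1 + p.1) := by
    rintro ⟨a, b⟩ ⟨c, d⟩ h
    simp only [Prod.mk.injEq] at h ⊢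
    omega
  exact (h.comp_injective hinj).congr fun p => by simp

theorem summable_norm_coanalytic {b x : ℕ → ℂ} (hb : Summable fun k => ‖b k‖)
    (hx : Summable fun k => ‖x k‖) : Summable fun j => ‖∑' k, b k * x (k + 1 + j)‖ := by
  have h := (summable_prod_of_nonneg fun _ => norm_nonneg _).1 (summable_coanalytic hb hx)
  exact h.2.of_nonneg_of_le (fun _ => norm_nonneg _) fun k => norm_tsum_le_tsum_norm (h.1 k)

/-- Splitting of a double series according to the sign of the difference of the indices. -/
theorem tsum_prod_split {G : ℕ × ℕ → ℂ} (hG : Summable G) :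
    ∑' q, G q = (∑' p : ℕ × ℕ, G (p.1 + p.2, p.2)) + ∑' p : ℕ × ℕ, G (p.2, p.2 + 1 + p.1) := by
  have h1 : Function.Injective fun p : ℕ × ℕ => (p.1 + p.2, p.2) := by
    rintro ⟨a, b⟩ ⟨c, d⟩ h
    simp only [Prod.mk.injEq] at h ⊢
    omega
  have h2 : Function.Injective fun p : ℕ × ℕ => (p.2, p.2 + 1 + p.1) := by
    rintro ⟨a, b⟩ ⟨c, d⟩ h
    simp only [Prod.mk.injEq] at h ⊢
    omega
  have hc : IsCompl (Set.range fun p : ℕ × ℕ => (p.1 + p.2, p.2))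
      (Set.range fun p : ℕ × ℕ => (p.2, p.2 + 1 + p.1)) := by
    rw [isCompl_iff, Set.disjoint_iff_forall_ne, codisjoint_iff_le_sup]
    constructor
    · rintro _ ⟨⟨a, b⟩, rfl⟩ _ ⟨⟨c, d⟩, rfl⟩ h
      simp only [Prod.mk.injEq] at h
      omega
    · rintro q -
      rcases le_or_gt q.2 q.1 with h | h
      · exact Or.inl ⟨(q.1 - q.2, q.2), Prod.ext (by simp only; omega) rfl⟩
      · exact Or.inr ⟨(q.2 - q.1 - 1, q.1), Prod.ext rfl (by simp only; omega)⟩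
  have s1 := (h1.hasSum_range_iff (f := G)).2 (hG.comp_injective h1).hasSum
  have s2 := (h2.hasSum_range_iff (f := G)).2 (hG.comp_injective h2).hasSum
  exact (HasSum.add_isCompl hc s1 s2).tsum_eq

/-- The product of an analytic and a coanalytic series on the unit circle is the sum of its
analytic part, given by a Hankel operator, and its strictly coanalytic part. -/
theorem mul_eq_hankel_add {b x : ℕ → ℂ} (hb : Summable fun k => ‖b k‖)
    (hx : Summable fun k => ‖x k‖) {z : ℂ} (hz : ‖z‖ = 1) :
    (∑' k, b k * z⁻¹ ^ k) * ∑' k, x k * z ^ k =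
      (∑' k, (∑' m, b (k + m) * x m) * z⁻¹ ^ k) +
        z * ∑' j, (∑' k, b k * x (k + 1 + j)) * z ^ j := by
  have hz0 : z ≠ 0 := by rintro rfl; simp at hz
  have hzi : ‖z⁻¹‖ = 1 := by rw [norm_inv, hz, inv_one]
  have hB := summable_norm_mul_pow hb hzi.le
  have hX := summable_norm_mul_pow hx hz.le
  have hp : Summable fun q : ℕ × ℕ => (b q.1 * z⁻¹ ^ q.1) * (x q.2 * z ^ q.2) :=
    summable_mul_of_summable_norm (f := fun k => b k * z⁻¹ ^ k) (g := fun k => x k * z ^ k) hB hX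
  have h1 : ∀ p : ℕ × ℕ, (b (p.1 + p.2) * z⁻¹ ^ (p.1 + p.2)) * (x p.2 * z ^ p.2) =
      b (p.1 + p.2) * x p.2 * z⁻¹ ^ p.1 := fun p => by
    rw [pow_add, inv_pow, inv_pow]
    field_simp
  have h2 : ∀ p : ℕ × ℕ, (b p.2 * z⁻¹ ^ p.2) * (x (p.2 + 1 + p.1) * z ^ (p.2 + 1 + p.1)) =
      z * (b p.2 * x (p.2 + 1 + p.1) * z ^ p.1) := fun p => by
    rw [pow_add, pow_add, inv_pow]
    field_simp
  have hs1 : Summable fun p : ℕ × ℕ => b (p.1 + p.2) * x p.2 * z⁻¹ ^ p.1 := by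
    refine Summable.of_norm ((summable_hankel hb hx).congr fun p => ?_)
    rw [norm_mul (_ * _), norm_pow, hzi, one_pow, mul_one]
  have hs2 : Summable fun p : ℕ × ℕ => b p.2 * x (p.2 + 1 + p.1) * z ^ p.1 := by
    refine Summable.of_norm ((summable_coanalytic hb hx).congr fun p => ?_)
    rw [norm_mul (_ * _), norm_pow, hz, one_pow, mul_one]
  have e1 : ∑' p : ℕ × ℕ, (b (p.1 + p.2) * z⁻¹ ^ (p.1 + p.2)) * (x p.2 * z ^ p.2) =
      ∑' k, (∑' m, b (k + m) * x m) * z⁻¹ ^ k := by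
    rw [tsum_congr h1, hs1.tsum_prod]
    exact tsum_congr fun k => tsum_mul_right (f := fun m => b (k + m) * x m) (a := z⁻¹ ^ k)
  have e2 : ∑' p : ℕ × ℕ, (b p.2 * z⁻¹ ^ p.2) * (x (p.2 + 1 + p.1) * z ^ (p.2 + 1 + p.1)) =
      z * ∑' j, (∑' k, b k * x (k + 1 + j)) * z ^ j := by
    rw [tsum_congr h2, tsum_mul_left, hs2.tsum_prod]
    exact congrArg (z * ·) (tsum_congr fun j =>
      tsum_mul_right (f := fun k => b k * x (k + 1 + j)) (a := z ^ j))
  have e0 := tsum_mul_tsum_of_summable_norm (f := fun k => b k * z⁻¹ ^ k)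
    (g := fun k => x k * z ^ k) hB hX
  refine e0.trans ((tsum_prod_split hp).trans ?_)
  exact congrArg₂ (· + ·) e1 e2

/-! ### Trigonometric series -/

instance : IsFiniteMeasure freqMeasure := by
  unfold freqMeasure; infer_instance

theorem integral_exp_mul_intCast (k : ℤ) :
    ∫ t, exp (I * t * k) ∂freqMeasure = if k = 0 then (2 * π : ℂ) else 0 := by
  rw [freqMeasure, ← intervalIntegral.integral_of_le neg_pi_lt_pi.le]
  split_ifs with h
  · subst h
    simp
    ring
  · have hk : I * (k : ℂ) ≠ 0 := mul_ne_zero I_ne_zero (by exact_mod_cast h)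
    have : ∀ t : ℝ, exp (I * t * k) = exp (I * k * t) := fun t => by congr 1; ring
    simp_rw [this]
    rw [integral_exp_mul_complex hk, div_eq_zero_iff]
    left
    rw [sub_eq_zero, exp_eq_exp_iff_exists_int]
    exact ⟨k, by push_cast; ring⟩

/-- Termwise integration of an absolutely convergent trigonometric series. -/
theorem integral_tsum_exp {ι : Type*} [Countable ι] {c : ι → ℂ} (hc : Summable fun i => ‖c i‖)
    (ν : ι → ℤ) :
    ∫ t, ∑' i, c i * exp (I * t * ν i) ∂freqMeasure =
      2 * π * ∑' i, if ν i = 0 then c i else 0 := by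
  have hint : ∀ i, Integrable (fun t : ℝ => c i * exp (I * t * ν i)) freqMeasure := fun i =>
    Integrable.of_bound (Continuous.aestronglyMeasurable (by fun_prop)) ‖c i‖
      (Eventually.of_forall fun t => by rw [norm_mul, norm_exp_mul_intCast, mul_one])
  rw [← integral_tsum_of_summable_integral_norm hint, ← tsum_mul_left]
  · refine tsum_congr fun i => ?_
    rw [integral_const_mul, integral_exp_mul_intCast]
    split_ifs <;> ring
  · simp_rw [norm_mul, norm_exp_mul_intCast, mul_one]
    simpa using hc.mul_left _

theorem integral_norm_sq_tsum {c : ℕ → ℂ} (hc : Summable fun i => ‖c i‖) :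
    ∫ t, ‖∑' k : ℕ, c k * exp (I * t * k)‖ ^ 2 ∂freqMeasure = 2 * π * ∑' k, ‖c k‖ ^ 2 := by
  have hexp : ∀ (t : ℝ) (k : ℕ), ‖exp (I * t * k)‖ = 1 := fun t k => by
    simpa using norm_exp_mul_intCast t k
  have h1 : ∀ t : ℝ, ((‖∑' k : ℕ, c k * exp (I * t * k)‖ ^ 2 : ℝ) : ℂ) =
      ∑' p : ℕ × ℕ, c p.1 * conj (c p.2) * exp (I * t * ((p.1 : ℤ) - (p.2 : ℤ) : ℤ)) := fun t => by
    have hs : Summable fun k : ℕ => ‖c k * exp (I * t * k)‖ :=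
      hc.congr fun k => by rw [norm_mul, hexp, mul_one]
    rw [ofReal_pow, ← mul_conj', conj_tsum, tsum_mul_tsum_of_summable_norm hs
      (hs.congr fun k => (RCLike.norm_conj _).symm)]
    refine tsum_congr fun p => ?_
    rw [map_mul, ← exp_conj]
    have : exp (I * t * ((p.1 : ℤ) - (p.2 : ℤ) : ℤ)) = exp (I * t * p.1) *
        exp (conj (I * t * p.2)) := by
      rw [← exp_add]; congr 1; simp; ring
    rw [this]; ring
  have hc2 : Summable fun p : ℕ × ℕ => ‖c p.1 * conj (c p.2)‖ := by
    have := hc.mul_of_nonneg hc (fun _ => norm_nonneg _) fun _ => norm_nonneg _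
    exact this.congr fun p => by simp
  have h2 := integral_tsum_exp hc2 fun p => (p.1 : ℤ) - (p.2 : ℤ)
  simp_rw [← h1] at h2
  rw [integral_complex_ofReal] at h2
  have h3 : ∑' p : ℕ × ℕ, (if ((p.1 : ℤ) - (p.2 : ℤ)) = 0 then c p.1 * conj (c p.2) else 0) =
      ((∑' k, ‖c k‖ ^ 2 : ℝ) : ℂ) := by
    rw [Summable.tsum_prod]
    · rw [ofReal_tsum]
      refine tsum_congr fun k => ?_
      rw [tsum_eq_single k]
      · simp [mul_conj']
      · intro l hl
        rw [if_neg]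
        simpa [sub_eq_zero] using hl.symm
    · refine Summable.of_norm (hc2.of_nonneg_of_le (fun _ => norm_nonneg _) fun p => ?_)
      split_ifs
      · rfl
      · simpa using by positivity
  rw [h3] at h2
  exact_mod_cast h2

theorem integral_norm_sq_factorFun {φ : ℕ → ℂ} (hφ : Summable fun k => ‖φ k‖) :
    ∫ t, factorDensity φ t ∂freqMeasure = 2 * π * ∑' k, ‖φ k‖ ^ 2 := by
  have h := integral_norm_sq_tsum (c := fun k => conj (φ k)) (by simpa using hφ)
  simp only [RCLike.norm_conj] at h
  rw [← h]
  refine integral_congr_ae (Eventually.of_forall fun t => ?_)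
  simp only [factorDensity]
  rw [← RCLike.norm_conj, factorFun, conj_tsum]
  congr 2
  refine tsum_congr fun k => ?_
  rw [map_mul, ← exp_conj]
  simp

theorem summable_norm_sq {x : ℕ → ℂ} (hx : Summable fun k => ‖x k‖) :
    Summable fun k => ‖x k‖ ^ 2 := by
  have hb : ∀ k, ‖x k‖ ≤ ∑' j, ‖x j‖ := fun k => hx.le_tsum k fun _ _ => norm_nonneg _
  refine (hx.mul_left (∑' j, ‖x j‖)).of_nonneg_of_le (fun _ => by positivity) fun k => ?_
  rw [sq]
  exact mul_le_mul_of_nonneg_right (hb k) (norm_nonneg _)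

theorem l2sq_eq_ofReal {x : ℕ → ℂ} (hx : Summable fun k => ‖x k‖) :
    l2sq x = ENNReal.ofReal (∑' k, ‖x k‖ ^ 2) := by
  have h2 := summable_norm_sq hx
  rw [ENNReal.ofReal_tsum_of_nonneg (fun _ => by positivity) h2, l2sq]
  refine tsum_congr fun k => ?_
  rw [ENNReal.ofReal_pow (norm_nonneg _), ofReal_norm]

/-! ### Closed spans -/

section ClosedSpan

variable {α : Type*} [MeasurableSpace α] {ν : Measure α} {S : Set (α → ℂ)}

theorem closedSpanL2_congr {g g' : α → ℂ} (h : g =ᵐ[ν] g') (hg : g ∈ closedSpanL2 ν S) :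
    g' ∈ closedSpanL2 ν S := by
  refine ⟨hg.1.congr h, fun ε hε => ?_⟩
  obtain ⟨p, hp, hle⟩ := hg.2 ε hε
  refine ⟨p, hp, le_of_eq_of_le (eLpNorm_congr_ae ?_) hle⟩
  filter_upwards [h] with x hx
  simp [hx]

theorem span_subset_closedSpanL2 (hS : ∀ g ∈ S, AEStronglyMeasurable g ν) {g : α → ℂ}
    (hg : g ∈ Submodule.span ℂ S) : g ∈ closedSpanL2 ν S := by
  refine ⟨?_, fun ε _ => ⟨g, hg, by simp⟩⟩
  induction hg using Submodule.span_induction with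
  | mem x hx => exact hS x hx
  | zero => exact aestronglyMeasurable_zero
  | add x y _ _ hx hy => exact hx.add hy
  | smul c x _ hx => exact hx.const_smul c

theorem tendsto_eLpNorm_of_bounded [IsFiniteMeasure ν] {G : ℕ → α → ℂ} {g : α → ℂ} {C : ℝ}
    (hG : ∀ N, AEStronglyMeasurable (G N) ν) (hbd : ∀ N, ∀ᵐ t ∂ν, ‖G N t‖ ≤ C)
    (hlim : ∀ᵐ t ∂ν, Tendsto (fun N => G N t) atTop (𝓝 (g t))) :
    Tendsto (fun N => eLpNorm (g - G N) 2 ν) atTop (𝓝 0) := by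
  have hg : AEStronglyMeasurable g ν := aestronglyMeasurable_of_tendsto_ae _ hG hlim
  have hgC : ∀ᵐ t ∂ν, ‖g t‖ ≤ C := by
    filter_upwards [hlim, ae_all_iff.2 hbd] with t h1 h2
    exact le_of_tendsto h1.norm (Eventually.of_forall h2)
  have h : Tendsto (fun N => ∫⁻ t, ‖(g - G N) t‖ₑ ^ (2 : ℝ) ∂ν) atTop (𝓝 (∫⁻ _, 0 ∂ν)) := by
    refine tendsto_lintegral_of_dominated_convergence'
      (fun _ => ENNReal.ofReal (2 * C) ^ (2 : ℝ)) (fun N => ?_) (fun N => ?_) ?_ ?_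
    · exact (hg.sub (hG N)).enorm.pow_const _
    · filter_upwards [hgC, hbd N] with t h1 h2
      refine ENNReal.rpow_le_rpow ?_ zero_le_two
      rw [← ofReal_norm]
      refine ENNReal.ofReal_le_ofReal ((norm_sub_le _ _).trans (by linarith))
    · rw [lintegral_const]
      exact ENNReal.mul_ne_top (ENNReal.rpow_ne_top_of_nonneg zero_le_two ENNReal.ofReal_ne_top)
        (measure_ne_top _ _)
    · filter_upwards [hlim] with t ht
      have h1 : Tendsto (fun N => (g - G N) t) atTop (𝓝 0) := by
        simpa using (tendsto_const_nhds (x := g t)).sub ht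
      have h2 := h1.enorm
      have h3 := (ENNReal.continuous_rpow_const (y := 2)).tendsto ‖(0 : ℂ)‖ₑ |>.comp h2
      simpa [Function.comp_def] using h3
  simp_rw [eLpNorm_eq_lintegral_rpow_enorm_toReal two_ne_zero ENNReal.ofNat_ne_top]
  have h4 := ((ENNReal.continuous_rpow_const (y := 1 / 2)).tendsto (∫⁻ _, 0 ∂ν)).comp h
  simpa [Function.comp_def] using h4

theorem closedSpanL2_of_tendsto_bounded [IsFiniteMeasure ν] {G : ℕ → α → ℂ} {g : α → ℂ} {C : ℝ}
    (hG : ∀ N, G N ∈ closedSpanL2 ν S) (hbd : ∀ N, ∀ᵐ t ∂ν, ‖G N t‖ ≤ C)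
    (hlim : ∀ᵐ t ∂ν, Tendsto (fun N => G N t) atTop (𝓝 (g t)))
    (hS : ∀ s ∈ S, AEStronglyMeasurable s ν) : g ∈ closedSpanL2 ν S := by
  have hgm : AEStronglyMeasurable g ν :=
    aestronglyMeasurable_of_tendsto_ae _ (fun N => (hG N).1) hlim
  refine ⟨hgm, fun ε hε => ?_⟩
  have h := tendsto_eLpNorm_of_bounded (fun N => (hG N).1) hbd hlim
  have hε2 : 0 < ε / 2 := ENNReal.half_pos hε.ne'
  obtain ⟨N, hN⟩ := (h.eventually (gt_mem_nhds hε2)).exists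
  obtain ⟨p, hp, hle⟩ := (hG N).2 (ε / 2) hε2
  refine ⟨p, hp, ?_⟩
  have hpm := (span_subset_closedSpanL2 hS hp).1
  have : g - p = (g - G N) + (G N - p) := by abel
  rw [this]
  refine (eLpNorm_add_le (hgm.sub (hG N).1) ((hG N).1.sub hpm) one_le_two).trans ?_
  rw [← ENNReal.add_halves ε]
  exact add_le_add hN.le hle

/-- The classes in `L²(ν)` of the functions in `S`. -/
def lpSet (ν : Measure α) (S : Set (α → ℂ)) : Set (Lp ℂ 2 ν) := {x | ∃ s ∈ S, x =ᵐ[ν] s}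

/-- The closed subspace of `L²(ν)` generated by `S`. -/
def lpSpan (ν : Measure α) (S : Set (α → ℂ)) : Submodule ℂ (Lp ℂ 2 ν) :=
  (Submodule.span ℂ (lpSet ν S)).topologicalClosure

theorem exists_span_lpSet (hS : ∀ g ∈ S, MemLp g 2 ν) {p : α → ℂ} (hp : p ∈ Submodule.span ℂ S) :
    ∃ x ∈ Submodule.span ℂ (lpSet ν S), x =ᵐ[ν] p := by
  induction hp using Submodule.span_induction with
  | mem x hx =>
    exact ⟨(hS x hx).toLp, Submodule.subset_span ⟨x, hx, (hS x hx).coeFn_toLp⟩,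
      (hS x hx).coeFn_toLp⟩
  | zero => exact ⟨0, Submodule.zero_mem _, Lp.coeFn_zero _ _ _⟩
  | add x y _ _ hx hy =>
    obtain ⟨u, hu, hux⟩ := hx
    obtain ⟨w, hw, hwy⟩ := hy
    exact ⟨u + w, Submodule.add_mem _ hu hw, (Lp.coeFn_add u w).trans (hux.add hwy)⟩
  | smul c x _ hx =>
    obtain ⟨u, hu, hux⟩ := hx
    exact ⟨c • u, Submodule.smul_mem _ c hu, (Lp.coeFn_smul c u).trans (hux.const_smul c)⟩

theorem exists_span_of_mem_span_lpSet {x : Lp ℂ 2 ν} (hx : x ∈ Submodule.span ℂ (lpSet ν S)) :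
    ∃ p ∈ Submodule.span ℂ S, x =ᵐ[ν] p := by
  induction hx using Submodule.span_induction with
  | mem x hx =>
    obtain ⟨s, hs, h⟩ := hx
    exact ⟨s, Submodule.subset_span hs, h⟩
  | zero => exact ⟨0, Submodule.zero_mem _, Lp.coeFn_zero _ _ _⟩
  | add x y _ _ hx hy =>
    obtain ⟨u, hu, hux⟩ := hx
    obtain ⟨w, hw, hwy⟩ := hy
    exact ⟨u + w, Submodule.add_mem _ hu hw, (Lp.coeFn_add x y).trans (hux.add hwy)⟩
  | smul c x _ hx =>
    obtain ⟨u, hu, hux⟩ := hx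
    exact ⟨c • u, Submodule.smul_mem _ c hu, (Lp.coeFn_smul c x).trans (hux.const_smul c)⟩

theorem edist_eq_eLpNorm_of_ae {x y : Lp ℂ 2 ν} {g p : α → ℂ} (hx : x =ᵐ[ν] g) (hy : y =ᵐ[ν] p) :
    edist x y = eLpNorm (g - p) 2 ν := by
  rw [Lp.edist_def]
  exact eLpNorm_congr_ae (hx.sub hy)

/-- The passage from functions to the Hilbert space `Lp`, where closed subspaces and orthogonality
are available. -/
theorem mem_closedSpanL2_iff (hS : ∀ g ∈ S, MemLp g 2 ν) {g : α → ℂ} :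
    g ∈ closedSpanL2 ν S ↔ ∃ x ∈ lpSpan ν S, x =ᵐ[ν] g := by
  constructor
  · rintro ⟨hgm, hg⟩
    have hgL : MemLp g 2 ν := by
      obtain ⟨p, hp, hle⟩ := hg 1 one_pos
      obtain ⟨x, -, hx⟩ := exists_span_lpSet hS hp
      have hpL : MemLp p 2 ν := (memLp_congr_ae hx).1 (Lp.memLp x)
      have hd : MemLp (g - p) 2 ν := ⟨hgm.sub hpL.1, hle.trans_lt ENNReal.one_lt_top⟩
      simpa using hd.add hpL
    refine ⟨hgL.toLp, ?_, hgL.coeFn_toLp⟩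
    rw [lpSpan, ← SetLike.mem_coe, Submodule.topologicalClosure_coe, EMetric.mem_closure_iff]
    intro ε hε
    obtain ⟨p, hp, hle⟩ := hg (ε / 2) (ENNReal.half_pos hε.ne')
    obtain ⟨x, hx, hxp⟩ := exists_span_lpSet hS hp
    -- Halving does not decrease ∞, so this case needs only finiteness of the distance.
    by_cases htop : ε = ∞
    · exact ⟨x, hx, by rw [htop]; exact edist_lt_top _ _⟩
    · refine ⟨x, hx, ?_⟩
      rw [edist_eq_eLpNorm_of_ae hgL.coeFn_toLp hxp]
      exact hle.trans_lt (ENNReal.half_lt_self hε.ne' htop)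
  · rintro ⟨x, hx, hxg⟩
    refine ⟨(Lp.aestronglyMeasurable x).congr hxg, fun ε hε => ?_⟩
    rw [lpSpan, ← SetLike.mem_coe, Submodule.topologicalClosure_coe, EMetric.mem_closure_iff] at hx
    obtain ⟨y, hy, hlt⟩ := hx ε hε
    obtain ⟨p, hp, hyp⟩ := exists_span_of_mem_span_lpSet hy
    refine ⟨p, hp, ?_⟩
    rw [← edist_eq_eLpNorm_of_ae hxg hyp]
    exact hlt.le

theorem isClosed_lpSpan : IsClosed (lpSpan ν S : Set (Lp ℂ 2 ν)) :=
  Submodule.isClosed_topologicalClosure _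

theorem closedSpanL2_subset {T : Set (α → ℂ)} (hS : ∀ g ∈ S, MemLp g 2 ν)
    (hT : ∀ g ∈ T, MemLp g 2 ν) (h : ∀ s ∈ S, s ∈ closedSpanL2 ν T) :
    closedSpanL2 ν S ⊆ closedSpanL2 ν T := by
  intro g hg
  obtain ⟨x, hx, hxg⟩ := (mem_closedSpanL2_iff hS).1 hg
  refine (mem_closedSpanL2_iff hT).2 ⟨x, ?_, hxg⟩
  refine Submodule.topologicalClosure_minimal _ (Submodule.span_le.2 ?_) isClosed_lpSpan hx
  rintro y ⟨s, hs, hys⟩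
  obtain ⟨y', hy', hys'⟩ := (mem_closedSpanL2_iff hT).1 (h s hs)
  have : y = y' := Lp.ext (hys.trans hys'.symm)
  rwa [this]

end ClosedSpan

/-! ### Spectral measures -/

theorem specMeasure_absolutelyContinuous (f : ℝ → ℝ) : specMeasure f ≪ freqMeasure :=
  withDensity_absolutelyContinuous _ _

theorem isFiniteMeasure_specMeasure {f : ℝ → ℝ} (hf : IsSpectralDensity f) :
    IsFiniteMeasure (specMeasure f) :=
  isFiniteMeasure_withDensity_ofReal (hf.2.div_const _).2

theorem specMeasure_congr {f g : ℝ → ℝ} (h : f =ᵐ[freqMeasure] g) :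
    specMeasure f = specMeasure g :=
  withDensity_congr_ae (by filter_upwards [h] with t ht; rw [ht])

theorem aestronglyMeasurable_incrFun (n μ : ℕ) (f : ℝ → ℝ) (k : ℤ) :
    AEStronglyMeasurable (fun t : ℝ => exp (I * t * k) * incrFactor n μ t) (specMeasure f) :=
  ((Continuous.measurable (by fun_prop)).mul (measurable_incrFactor n μ)).aestronglyMeasurable

theorem exists_ae_norm_incrFactor_le (n μ : ℕ) :
    ∃ C, 0 ≤ C ∧ ∀ᵐ t ∂freqMeasure, ‖incrFactor n μ t‖ ≤ C := by
  obtain ⟨e, he⟩ := exists_hasWienerSeries_outerFun n μ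
  refine ⟨∑' k, ‖e k‖, tsum_nonneg fun _ => norm_nonneg _, ?_⟩
  filter_upwards [ae_freq_norm_phaseFun n] with t ht
  rw [incrFactor_eq_phase, norm_mul, ht, one_mul]
  exact he.norm_circ_le t

theorem memLp_incrFun (n μ : ℕ) {f : ℝ → ℝ} (hf : IsSpectralDensity f) (k : ℤ) :
    MemLp (fun t : ℝ => exp (I * t * k) * incrFactor n μ t) 2 (specMeasure f) := by
  have := isFiniteMeasure_specMeasure hf
  obtain ⟨C, -, hC⟩ := exists_ae_norm_incrFactor_le n μ
  refine MemLp.of_bound (aestronglyMeasurable_incrFun n μ f k) C ?_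
  filter_upwards [(specMeasure_absolutelyContinuous f).ae_le hC] with t ht
  rwa [norm_mul, norm_exp_mul_intCast, one_mul]

/-- The extra factor e^{-it} moves the exponents k ≥ 0 to the frequencies -(k+1) ≤ -1. Partial sums
are bounded by the coefficient norm, so bounded convergence applies under any finite spectral
measure. -/
theorem pastSpace_of_wiener (n μ : ℕ) {f : ℝ → ℝ} (hf : IsSpectralDensity f) {U : ℂ → ℂ}
    {g : ℕ → ℂ} (hU : HasWienerSeries U g) :
    (fun t => incrFactor n μ t * (circ t * U (circ t))) ∈ pastSpace n μ f := by
  have := isFiniteMeasure_specMeasure hf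
  obtain ⟨C, hC0, hC⟩ := exists_ae_norm_incrFactor_le n μ
  have hmeas : ∀ s ∈ {g | ∃ k : ℤ, k ≤ -1 ∧ g = fun t : ℝ => exp (I * t * k) * incrFactor n μ t},
      AEStronglyMeasurable s (specMeasure f) := by
    rintro _ ⟨k, -, rfl⟩
    exact aestronglyMeasurable_incrFun n μ f k
  have hterm : ∀ (t : ℝ) (k : ℕ), g k * (exp (I * t * (-(k + 1) : ℤ)) * incrFactor n μ t) =
      incrFactor n μ t * (circ t * (g k * circ t ^ k)) := fun t k => by
    rw [exp_mul_intCast, neg_neg, zpow_add₀ (circ_ne_zero t), zpow_natCast, zpow_one]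
    ring
  refine closedSpanL2_of_tendsto_bounded (C := C * ∑' k, ‖g k‖) (G := fun N =>
    ∑ k ∈ Finset.range N, g k • fun t : ℝ => exp (I * t * (-(k + 1) : ℤ)) * incrFactor n μ t)
    (fun N => span_subset_closedSpanL2 hmeas ?_) (fun N => ?_) ?_ hmeas
  · refine Submodule.sum_mem _ fun k _ => Submodule.smul_mem _ _ (Submodule.subset_span ?_)
    exact ⟨-(k + 1), by omega, rfl⟩
  · filter_upwards [(specMeasure_absolutelyContinuous f).ae_le hC] with t ht
    simp only [Finset.sum_apply, Pi.smul_apply, smul_eq_mul, hterm]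
    rw [← Finset.mul_sum, ← Finset.mul_sum, norm_mul, norm_mul, norm_circ, one_mul]
    refine mul_le_mul ht ?_ (norm_nonneg _) hC0
    refine (norm_sum_le _ _).trans ?_
    simp only [norm_mul, norm_pow, norm_circ, one_pow, mul_one]
    exact hU.1.sum_le_tsum _ fun _ _ => norm_nonneg _
  · refine Eventually.of_forall fun t => ?_
    simp only [Finset.sum_apply, Pi.smul_apply, smul_eq_mul, hterm]
    simp_rw [← Finset.mul_sum]
    exact ((hU.hasSum (norm_circ t).le).tendsto_sum_nat.const_mul _).const_mul _

/-! ### Reduction of step-one increments to step-μ increments -/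

/-- Cesàro approximate identity vanishing at the roots of unity. -/
def cesaroFun (μ N : ℕ) (z : ℂ) : ℂ :=
  (1 / ((N : ℂ) + 1)) * ∑ k ∈ Finset.range (N + 1), (1 - (z ^ μ) ^ k)

theorem norm_cesaroFun_le (μ N : ℕ) {z : ℂ} (hz : ‖z‖ = 1) : ‖cesaroFun μ N z‖ ≤ 2 := by
  have h1 : ‖∑ k ∈ Finset.range (N + 1), (1 - (z ^ μ) ^ k)‖ ≤ ((N : ℝ) + 1) * 2 := by
    refine (norm_sum_le_of_le _ (fun k _ => (norm_sub_le _ _).trans_eq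
      (by rw [norm_one, norm_pow, norm_pow, hz, one_pow, one_pow]) : ∀ k ∈ Finset.range (N + 1),
        ‖(1 : ℂ) - (z ^ μ) ^ k‖ ≤ 1 + 1)).trans_eq ?_
    simp
    ring
  have h2 : ‖(1 : ℂ) / ((N : ℂ) + 1)‖ = 1 / ((N : ℝ) + 1) := by
    rw [norm_div, norm_one]
    congr 1
    have := Complex.norm_natCast (N + 1)
    push_cast at this
    exact this
  rw [cesaroFun, norm_mul, h2, one_div_mul_eq_div, div_le_iff₀ (by positivity)]
  linarith

theorem tendsto_cesaroFun (μ : ℕ) {z : ℂ} (hz : ‖z‖ = 1) (h1 : z ^ μ ≠ 1) :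
    Tendsto (fun N => cesaroFun μ N z) atTop (𝓝 1) := by
  have hw : ‖z ^ μ‖ = 1 := by rw [norm_pow, hz, one_pow]
  set w := z ^ μ
  have h0 : Tendsto (fun N : ℕ => (1 / ((N : ℂ) + 1)) * ∑ k ∈ Finset.range (N + 1), w ^ k) atTop
      (𝓝 0) := by
    refine squeeze_zero_norm (a := fun N : ℕ => (1 / ((N : ℝ) + 1)) * (2 / ‖w - 1‖)) (fun N => ?_) ?_
    · have h2 : ‖(1 : ℂ) / ((N : ℂ) + 1)‖ = 1 / ((N : ℝ) + 1) := by
        rw [norm_div, norm_one]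
        congr 1
        have := Complex.norm_natCast (N + 1)
        push_cast at this
        exact this
      rw [norm_mul, h2, geom_sum_eq h1, norm_div]
      gcongr
      refine (norm_sub_le _ _).trans_eq ?_
      rw [norm_pow, hw, one_pow, norm_one]; norm_num
    · simpa using tendsto_one_div_add_atTop_nhds_zero_nat.mul_const (2 / ‖w - 1‖)
  have h3 : (fun N => cesaroFun μ N z) =
      fun N : ℕ => 1 - (1 / ((N : ℂ) + 1)) * ∑ k ∈ Finset.range (N + 1), w ^ k := by
    funext N
    have : (N : ℂ) + 1 ≠ 0 := by exact_mod_cast N.succ_ne_zero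
    rw [cesaroFun, Finset.sum_sub_distrib, mul_sub]
    simp [w]
    field_simp
  rw [h3]
  simpa using tendsto_const_nhds.sub h0

/-- Each 1 - w^k is divisible by 1 - w. Such a factor is needed to create a step-μ difference out of
a step-one difference. -/
theorem exists_cesaroFun_eq (μ N : ℕ) : ∃ (R : ℂ → ℂ) (e : ℕ → ℂ), HasWienerSeries R e ∧
    ∀ z, cesaroFun μ N z = (1 - z ^ μ) * R z := by
  have h : ∀ k ∈ Finset.range (N + 1), ∃ e, HasWienerSeries
      (fun z => ∑ i ∈ Finset.range k, z ^ (μ * i)) e := fun k _ =>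
    HasWienerSeries.exists_sum _ fun i _ => ⟨_, HasWienerSeries.id_pow (μ * i)⟩
  obtain ⟨e, he⟩ := HasWienerSeries.exists_sum (Finset.range (N + 1)) h
  refine ⟨_, _, he.const_mul (1 / ((N : ℂ) + 1)), fun z => ?_⟩
  change _ = (1 - z ^ μ) * ((1 / ((N : ℂ) + 1)) *
    ∑ k ∈ Finset.range (N + 1), ∑ i ∈ Finset.range k, z ^ (μ * i))
  rw [cesaroFun, mul_left_comm, Finset.mul_sum (a := 1 - z ^ μ)]
  congr 1
  refine Finset.sum_congr rfl fun k _ => ?_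
  simp_rw [pow_mul]
  rw [mul_neg_geom_sum]

/-- Since (1 - z^μ)^n times the step-one factor is (1 - z)^n times the step-μ factor, multiplication
by the n-th power of a Cesàro function lands in the step-μ past. These multipliers are bounded by
2^n and tend to 1 off the roots of unity, a null set. -/
theorem pastSpace_of_wiener_one (n : ℕ) {μ : ℕ} (hμ : 0 < μ) {f : ℝ → ℝ}
    (hf : IsSpectralDensity f) {U : ℂ → ℂ} {g : ℕ → ℂ} (hU : HasWienerSeries U g) :
    (fun t => incrFactor n 1 t * (circ t * U (circ t))) ∈ pastSpace n μ f := by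
  have := isFiniteMeasure_specMeasure hf
  obtain ⟨C, hC0, hC⟩ := exists_ae_norm_incrFactor_le n 1
  have hmeas : ∀ s ∈ {g | ∃ k : ℤ, k ≤ -1 ∧ g = fun t : ℝ => exp (I * t * k) * incrFactor n μ t},
      AEStronglyMeasurable s (specMeasure f) := by
    rintro _ ⟨k, -, rfl⟩
    exact aestronglyMeasurable_incrFun n μ f k
  refine closedSpanL2_of_tendsto_bounded (C := C * (∑' k, ‖g k‖) * 2 ^ n) (G := fun N t =>
    incrFactor n 1 t * (circ t * U (circ t)) * cesaroFun μ N (circ t) ^ n)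
    (fun N => ?_) (fun N => ?_) ?_ hmeas
  · obtain ⟨R, e, hR, heq⟩ := exists_cesaroFun_eq μ N
    obtain ⟨e1, he1⟩ := HasWienerSeries.exists_sum {0, 1} (F := fun j z => (-1) ^ j * z ^ j)
      fun j _ => ⟨_, (HasWienerSeries.id_pow j).const_mul ((-1) ^ j)⟩
    obtain ⟨e2, he2, -⟩ := (he1.mul hR).exists_pow n
    refine closedSpanL2_congr (Eventually.of_forall fun t => ?_)
      (pastSpace_of_wiener n μ hf (hU.mul he2))
    simp only [heq]
    have h1 : (1 - circ t ^ μ) ^ n * incrFactor n 1 t =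
        (1 - circ t) ^ n * incrFactor n μ t := by
      rw [incrFactor_eq_geom n μ, ← geom_sum_mul_neg, mul_pow]
      ring
    have h2 : ∑ j ∈ ({0, 1} : Finset ℕ), (-1 : ℂ) ^ j * circ t ^ j = 1 - circ t := by
      simp [sub_eq_add_neg]
    rw [h2, mul_pow, mul_pow]
    linear_combination (-(circ t * U (circ t)) * R (circ t) ^ n) * h1
  · filter_upwards [(specMeasure_absolutelyContinuous f).ae_le hC] with t ht
    rw [norm_mul, norm_mul, norm_mul, norm_circ, one_mul, norm_pow]
    have h1 := hU.norm_circ_le t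
    have h2 := norm_cesaroFun_le μ N (norm_circ t)
    gcongr
  · filter_upwards [(specMeasure_absolutelyContinuous f).ae_le (ae_freq_circ_pow_ne_one hμ)]
      with t ht
    simpa using ((tendsto_cesaroFun μ (norm_circ t) ht).pow n).const_mul
      (incrFactor n 1 t * (circ t * U (circ t)))

/-! ### The spectral characteristic of a canonical factorization -/

theorem symbolA_eq (a : ℕ → ℂ) (n μ : ℕ) (t : ℝ) :
    symbolA a n μ t = ∑' k, bCoef a n μ k * (circ t)⁻¹ ^ k := by
  simp_rw [symbolA, exp_mul_natCast, conj_circ]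

theorem rFun_eq (a : ℕ → ℂ) (n μ : ℕ) (φ : ℕ → ℂ) (t : ℝ) :
    rFun a n μ φ t = ∑' k, DAW a n μ φ k * (circ t)⁻¹ ^ k := by
  simp_rw [rFun, exp_mul_natCast, conj_circ]

theorem summable_DAW {a : ℕ → ℂ} {n μ : ℕ} (ha : AdmissibleCoef a n μ) (hμ : 0 < μ) {φ : ℕ → ℂ}
    (hφ : Summable fun k => ‖φ k‖) : Summable fun k => ‖DAW a n μ φ k‖ := by
  simp_rw [DAW, DAapply_eq]
  exact summable_norm_hankel_apply ha.summable_b (summable_Wapply n hμ hφ)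

theorem continuous_rFun {a : ℕ → ℂ} {n μ : ℕ} (ha : AdmissibleCoef a n μ) (hμ : 0 < μ) {φ : ℕ → ℂ}
    (hφ : Summable fun k => ‖φ k‖) : Continuous (rFun a n μ φ) := by
  unfold rFun
  refine continuous_tsum (fun k => by fun_prop) (summable_DAW ha hμ hφ) fun k t => ?_
  have := norm_exp_mul_intCast t k
  rw [Int.cast_natCast] at this
  rw [norm_mul, this, mul_one]

theorem factorFun_Wapply_ne_zero {n μ : ℕ} (hμ : 0 < μ) {φ : ℕ → ℂ} (hφ : IsCanonical φ) :
    ∀ᵐ t ∂freqMeasure, factorFun (Wapply n μ φ) t ≠ 0 := by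
  filter_upwards [ae_freq_outerFun_ne_zero n hμ] with t ht
  rw [factorFun_Wapply n hμ hφ.summable]
  exact mul_ne_zero ht (factorFun_ne_zero hφ t)

/-- The function `h_φ` belongs to the past of every spectral density. -/
theorem hFun_mem_characteristics {a : ℕ → ℂ} {n μ : ℕ} (ha : AdmissibleCoef a n μ) (hμ : 0 < μ)
    {φ : ℕ → ℂ} (hφ : IsCanonical φ) {f : ℝ → ℝ} (hf : IsSpectralDensity f) :
    hFun a n μ φ ∈ characteristics n μ f := by
  have hx := summable_Wapply n hμ hφ.summable
  obtain ⟨κ, hκ⟩ := hφ.exists_inv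
  obtain ⟨g, hg⟩ := exists_hasWienerSeries_exp_neg_sincLog n
  have hQ := HasWienerSeries.of_summable (summable_norm_coanalytic ha.summable_b hx)
  have hV := (hQ.mul hκ).mul hg
  refine closedSpanL2_congr ?_ (pastSpace_of_wiener_one n hμ hf hV)
  refine (specMeasure_absolutelyContinuous f).ae_le ?_
  filter_upwards [factorFun_Wapply_ne_zero (n := n) hμ hφ] with t hW
  have hsplit := mul_eq_hankel_add ha.summable_b hx (norm_circ t)
  have hΦ := factorFun_ne_zero hφ t
  have hw : exp (sincLog (circ t)) ^ n ≠ 0 := pow_ne_zero _ (exp_ne_zero _)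
  rw [← factorFun_eq (Wapply n μ φ), ← symbolA_eq] at hsplit
  rw [← factorFun_eq φ]
  have hr : rFun a n μ φ t = ∑' k, (∑' m, bCoef a n μ (k + m) * Wapply n μ φ m) *
      (circ t)⁻¹ ^ k := by
    simp_rw [rFun_eq, DAW, DAapply_eq]
  rw [← hr] at hsplit
  set Q := ∑' j, (∑' k, bCoef a n μ k * Wapply n μ φ (k + 1 + j)) * circ t ^ j
  -- Subtracting r_φ/Φ_μ leaves exactly the strictly coanalytic part. Its denominator contains the
  -- outer factor of χ, which cancels in h_φχ and with it the zeros on the circle.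
  have hh : hFun a n μ φ t = circ t * Q / factorFun (Wapply n μ φ) t := by
    rw [hFun, eq_div_iff hW, sub_mul, inv_mul_cancel_right₀ hW, hsplit]
    ring
  have hχ : incrFactor n 1 t = phaseFun n t * exp (sincLog (circ t)) ^ n := by
    rw [phaseFun, div_mul_cancel₀ _ hw]
  rw [factorFun_Wapply n hμ hφ.summable] at hW hh
  have hO := left_ne_zero_of_mul hW
  rw [hh, incrFactor_eq_phase n μ, hχ]
  field_simp

/-! ### The error of h_φ as a linear functional of the density, and optimality of h_φ -/

theorem lintegral_specMeasure {f : ℝ → ℝ} (hf : IsSpectralDensity f) (g : ℝ → ℝ≥0∞) :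
    ∫⁻ t, g t ∂(specMeasure f) = ∫⁻ t, ENNReal.ofReal (f t / (2 * π)) * g t ∂freqMeasure :=
  lintegral_withDensity_eq_lintegral_mul_non_measurable₀ _
    (hf.2.div_const _).1.aemeasurable.ennreal_ofReal
    (Eventually.of_forall fun _ => ENNReal.ofReal_lt_top) g

theorem integral_specMeasure {f : ℝ → ℝ} (hf : IsSpectralDensity f) (g : ℝ → ℂ) :
    ∫ t, g t ∂(specMeasure f) = (1 / (2 * π)) * ∫ t, f t * g t ∂freqMeasure := by
  rw [specMeasure, integral_withDensity_eq_integral_toReal_smul₀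
    (hf.2.div_const _).1.aemeasurable.ennreal_ofReal
    (Eventually.of_forall fun _ => ENNReal.ofReal_lt_top), ← integral_const_mul]
  refine integral_congr_ae ?_
  filter_upwards [hf.1] with t ht
  rw [ENNReal.toReal_ofReal (by positivity), real_smul]
  push_cast
  ring

/-- The ratio `|r_φ|² / |Φ|²` whose integral against a density is the error of `h_φ`. -/
def errRatio (a : ℕ → ℂ) (n μ : ℕ) (φ : ℕ → ℂ) (t : ℝ) : ℝ :=
  ‖rFun a n μ φ t‖ ^ 2 / factorDensity φ t

theorem errRatio_nonneg (a : ℕ → ℂ) (n μ : ℕ) (φ : ℕ → ℂ) (t : ℝ) : 0 ≤ errRatio a n μ φ t :=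
  div_nonneg (by positivity) (sq_nonneg _)

theorem factorDensity_pos {φ : ℕ → ℂ} (hφ : IsCanonical φ) (t : ℝ) : 0 < factorDensity φ t :=
  pow_pos (norm_pos_iff.2 (factorFun_ne_zero hφ t)) 2

theorem continuous_factorDensity {φ : ℕ → ℂ} (hφ : Summable fun k => ‖φ k‖) :
    Continuous (factorDensity φ) := (continuous_factorFun hφ).norm.pow 2

theorem integrable_errRatio_mul {a : ℕ → ℂ} {n μ : ℕ} (ha : AdmissibleCoef a n μ) (hμ : 0 < μ)
    {φ : ℕ → ℂ} (hφ : IsCanonical φ) {f : ℝ → ℝ} (hf : IsSpectralDensity f) :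
    Integrable (fun t => errRatio a n μ φ t * f t) freqMeasure := by
  have hc : Continuous (errRatio a n μ φ) :=
    ((continuous_rFun ha hμ hφ.summable).norm.pow 2).div
      (continuous_factorDensity hφ.summable) fun t => (factorDensity_pos hφ t).ne'
  obtain ⟨M, hM⟩ := (isCompact_Icc (a := -π) (b := π)).exists_bound_of_continuousOn hc.continuousOn
  refine hf.2.bdd_mul hc.aestronglyMeasurable (c := M) ?_
  filter_upwards [ae_freq_mem] with t ht
  exact hM t (Set.Ioc_subset_Icc_self ht)

/-- The error is r_φχ/Φ_μ, and |χ| cancels the modulus of the outer factor of Φ_μ. The resulting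
ratio is continuous and does not involve the density under which the error is measured. -/
theorem norm_error_hFun {a : ℕ → ℂ} {n μ : ℕ} (hμ : 0 < μ)
    {φ : ℕ → ℂ} (hφ : IsCanonical φ) : ∀ᵐ t ∂freqMeasure,
      ‖(symbolA a n μ t - hFun a n μ φ t) * incrFactor n μ t‖ ^ 2 = errRatio a n μ φ t := by
  filter_upwards [ae_freq_outerFun_ne_zero n hμ, ae_freq_norm_phaseFun n] with t hO hθ
  have hΦ := norm_ne_zero_iff.2 (factorFun_ne_zero hφ t)
  have hO' := norm_ne_zero_iff.2 hO
  rw [hFun, sub_sub_cancel, incrFactor_eq_phase, factorFun_Wapply n hμ hφ.summable, errRatio,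
    factorDensity]
  simp only [norm_mul, norm_inv, hθ]
  field_simp

theorem mse_hFun {a : ℕ → ℂ} {n μ : ℕ} (ha : AdmissibleCoef a n μ) (hμ : 0 < μ)
    {φ : ℕ → ℂ} (hφ : IsCanonical φ) {f : ℝ → ℝ} (hf : IsSpectralDensity f) :
    mse a n μ (hFun a n μ φ) f =
      ENNReal.ofReal ((1 / (2 * π)) * ∫ t, errRatio a n μ φ t * f t ∂freqMeasure) := by
  rw [mse, lintegral_specMeasure hf, ← integral_const_mul, ofReal_integral_eq_lintegral_ofReal
    ((integrable_errRatio_mul ha hμ hφ hf).const_mul _)]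
  · refine lintegral_congr_ae ?_
    filter_upwards [norm_error_hFun (a := a) (n := n) hμ hφ, hf.1] with t ht h0
    rw [← ofReal_norm, ← ENNReal.ofReal_pow (norm_nonneg _), ht,
      ← ENNReal.ofReal_mul (by positivity)]
    congr 1
    ring
  · filter_upwards [hf.1] with t h0
    have := errRatio_nonneg a n μ φ t
    simp only [Pi.zero_apply]
    positivity

theorem isSpectralDensity_factorDensity {φ : ℕ → ℂ} (hφ : Summable fun k => ‖φ k‖) :
    IsSpectralDensity (factorDensity φ) := by
  refine ⟨Eventually.of_forall fun t => sq_nonneg _, ?_⟩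
  refine ((continuous_factorDensity hφ).continuousOn.integrableOn_Icc (a := -π) (b := π)).mono_set
    Set.Ioc_subset_Icc_self

/-- The density cancels the denominator of the ratio, leaving the integral of |r_φ|², which Parseval
evaluates. -/
theorem mse_hFun_factorDensity {a : ℕ → ℂ} {n μ : ℕ} (ha : AdmissibleCoef a n μ) (hμ : 0 < μ)
    {φ : ℕ → ℂ} (hφ : IsCanonical φ) :
    mse a n μ (hFun a n μ φ) (factorDensity φ) = l2sq (DAW a n μ φ) := by
  have hs := summable_DAW ha hμ hφ.summable
  rw [mse_hFun ha hμ hφ (isSpectralDensity_factorDensity hφ.summable), l2sq_eq_ofReal hs]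
  have h1 : ∀ t, errRatio a n μ φ t * factorDensity φ t = ‖rFun a n μ φ t‖ ^ 2 := fun t =>
    div_mul_cancel₀ _ (factorDensity_pos hφ t).ne'
  simp_rw [h1, rFun]
  rw [integral_norm_sq_tsum hs, ← mul_assoc, one_div_mul_cancel (by positivity), one_mul]

/-- Orthogonality of the error of `h_φ` to the past. -/
theorem integral_past_mul_error {a : ℕ → ℂ} {n μ : ℕ} (ha : AdmissibleCoef a n μ) (hμ : 0 < μ)
    {φ : ℕ → ℂ} (hφ : IsCanonical φ) {k : ℤ} (hk : k ≤ -1) :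
    ∫ t, (symbolA a n μ t - hFun a n μ φ t) * incrFactor n μ t *
      conj (exp (I * t * k) * incrFactor n μ t) ∂(specMeasure (factorDensity φ)) = 0 := by
  have hr := summable_DAW ha hμ hφ.summable
  have hx := summable_Wapply n hμ hφ.summable
  have hc : Summable fun p : ℕ × ℕ => ‖DAW a n μ φ p.1 * conj (Wapply n μ φ p.2)‖ :=
    (hr.mul_of_nonneg hx (fun _ => norm_nonneg _) fun _ => norm_nonneg _).congr
      fun p => by simp
  -- Against f_φ the integrand collapses to r_φ(e^{it}) times the conjugate of Φ_μ(e^{-it}) times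
  -- e^{-itk}. Its frequencies i + j - k are all at least 1 when k ≤ -1.
  have h0 := integral_tsum_exp hc fun p => (p.1 : ℤ) + p.2 - k
  have hz : ∀ p : ℕ × ℕ, (if (p.1 : ℤ) + p.2 - k = 0 then
      DAW a n μ φ p.1 * conj (Wapply n μ φ p.2) else 0) = 0 := fun p => by
    rw [if_neg]; omega
  simp_rw [hz, tsum_zero, mul_zero] at h0
  rw [integral_specMeasure (isSpectralDensity_factorDensity hφ.summable), mul_eq_zero]
  right
  rw [← h0]
  refine integral_congr_ae ?_
  filter_upwards [ae_freq_outerFun_ne_zero n hμ, ae_freq_norm_phaseFun n] with t hO hθ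
  have hΦ := factorFun_ne_zero hφ t
  have hW := factorFun_Wapply n hμ hφ.summable t
  have hrs : Summable fun i : ℕ => ‖DAW a n μ φ i * exp (I * t * i)‖ := hr.congr fun i => by
    have := norm_exp_mul_intCast t i
    rw [Int.cast_natCast] at this
    rw [norm_mul, this, mul_one]
  have hxs : Summable fun j : ℕ => ‖conj (Wapply n μ φ j * exp (-(I * t * j)))‖ :=
    hx.congr fun j => by
      rw [RCLike.norm_conj, norm_mul, exp_neg_mul_natCast, norm_pow, norm_circ, one_pow, mul_one]
  have hprod := tsum_mul_tsum_of_summable_norm hrs hxs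
  rw [← conj_tsum] at hprod
  change rFun a n μ φ t * conj (factorFun (Wapply n μ φ) t) = _ at hprod
  have hsum : ∑' p : ℕ × ℕ, DAW a n μ φ p.1 * conj (Wapply n μ φ p.2) *
      exp (I * t * ((p.1 : ℤ) + p.2 - k : ℤ)) =
      rFun a n μ φ t * conj (factorFun (Wapply n μ φ) t) * exp (-(I * t * k)) := by
    rw [hprod, ← tsum_mul_right]
    refine tsum_congr fun p => ?_
    have : exp (I * t * ((p.1 : ℤ) + p.2 - k : ℤ)) =
        exp (I * t * p.1) * conj (exp (-(I * t * p.2))) * exp (-(I * t * k)) := by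
      rw [← exp_conj, ← exp_add, ← exp_add]
      congr 1
      simp
      ring
    rw [this, map_mul]
    ring
  rw [hsum, hFun, sub_sub_cancel, hW, incrFactor_eq_phase, factorDensity, map_mul, map_mul, map_mul]
  have hθ2 : phaseFun n t * conj (phaseFun n t) = 1 := by
    rw [mul_conj', hθ]; norm_num
  have he : conj (exp (I * t * k)) = exp (-(I * t * k)) := by
    rw [← exp_conj]; congr 1; simp
  have hd : ((‖factorFun φ t‖ ^ 2 : ℝ) : ℂ) = factorFun φ t * conj (factorFun φ t) := by
    rw [mul_conj']; push_cast; rfl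
  rw [he, hd, mul_inv]
  have : outerFun n μ (circ t) ≠ 0 := hO
  field_simp
  linear_combination (rFun a n μ φ t * conj (factorFun φ t) *
    conj (outerFun n μ (circ t))) * hθ2

theorem mse_eq_eLpNorm_sq (a : ℕ → ℂ) (n μ : ℕ) (h : ℝ → ℂ) (f : ℝ → ℝ) :
    mse a n μ h f =
      eLpNorm (fun t => (symbolA a n μ t - h t) * incrFactor n μ t) 2 (specMeasure f) ^ 2 := by
  rw [eLpNorm_eq_lintegral_rpow_enorm_toReal two_ne_zero ENNReal.ofNat_ne_top, mse,
    ← ENNReal.rpow_natCast, ← ENNReal.rpow_mul]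
  simp

theorem measurable_symbolA {a : ℕ → ℂ} {n μ : ℕ} (ha : AdmissibleCoef a n μ) :
    Continuous (symbolA a n μ) := by
  unfold symbolA
  refine continuous_tsum (fun k => by fun_prop) ha.summable_b fun k t => ?_
  have := norm_exp_mul_intCast t k
  rw [Int.cast_natCast] at this
  rw [norm_mul, this, mul_one]

theorem norm_symbolA_le {a : ℕ → ℂ} {n μ : ℕ} (ha : AdmissibleCoef a n μ) (t : ℝ) :
    ‖symbolA a n μ t‖ ≤ ∑' k, ‖bCoef a n μ k‖ := by
  rw [symbolA_eq]
  refine tsum_of_norm_bounded ha.summable_b.hasSum fun k => ?_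
  rw [norm_mul, norm_pow, norm_inv, norm_circ, inv_one, one_pow, mul_one]

theorem memLp_symbolA_mul {a : ℕ → ℂ} {n μ : ℕ} (ha : AdmissibleCoef a n μ) {f : ℝ → ℝ}
    (hf : IsSpectralDensity f) :
    MemLp (fun t => symbolA a n μ t * incrFactor n μ t) 2 (specMeasure f) := by
  have := isFiniteMeasure_specMeasure hf
  obtain ⟨C, hC0, hC⟩ := exists_ae_norm_incrFactor_le n μ
  refine MemLp.of_bound ((measurable_symbolA ha).measurable.mul
    (measurable_incrFactor n μ)).aestronglyMeasurable ((∑' k, ‖bCoef a n μ k‖) * C) ?_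
  filter_upwards [(specMeasure_absolutelyContinuous f).ae_le hC] with t ht
  rw [norm_mul]
  exact mul_le_mul (norm_symbolA_le ha t) ht (norm_nonneg _) (tsum_nonneg fun _ => norm_nonneg _)

/-- Orthogonality of the error to the generators passes to their closed span, because orthogonal
complements are closed. Pythagoras then compares h_φ with any other characteristic. -/
theorem isOptimalCharacteristic_hFun {a : ℕ → ℂ} {n μ : ℕ} (ha : AdmissibleCoef a n μ) (hμ : 0 < μ)
    {φ : ℕ → ℂ} (hφ : IsCanonical φ) :
    IsOptimalCharacteristic a n μ (factorDensity φ) (hFun a n μ φ) := by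
  set f := factorDensity φ with hfdef
  have hf : IsSpectralDensity f := isSpectralDensity_factorDensity hφ.summable
  have hmem := hFun_mem_characteristics ha hμ hφ hf
  refine ⟨hmem, le_antisymm (le_iInf₂ fun h hh => ?_) (iInf₂_le _ hmem)⟩
  set F := specMeasure f
  have hS : ∀ g ∈ {g | ∃ k : ℤ, k ≤ -1 ∧ g = fun t : ℝ => exp (I * t * k) * incrFactor n μ t},
      MemLp g 2 F := by
    rintro _ ⟨k, -, rfl⟩
    exact memLp_incrFun n μ hf k
  obtain ⟨x, hx, hxh⟩ := (mem_closedSpanL2_iff hS).1 hh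
  obtain ⟨y, hy, hyh⟩ := (mem_closedSpanL2_iff hS).1 hmem
  have hA := memLp_symbolA_mul ha hf
  set z : Lp ℂ 2 F := hA.toLp
  have hz : z =ᵐ[F] fun t => symbolA a n μ t * incrFactor n μ t := hA.coeFn_toLp
  have hzy : (z - y : Lp ℂ 2 F) =ᵐ[F]
      fun t => (symbolA a n μ t - hFun a n μ φ t) * incrFactor n μ t := by
    filter_upwards [Lp.coeFn_sub z y, hz, hyh] with t h1 h2 h3
    rw [h1, Pi.sub_apply, h2, h3, sub_mul]
  have horth : ∀ w ∈ lpSpan F {g | ∃ k : ℤ, k ≤ -1 ∧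
      g = fun t : ℝ => exp (I * t * k) * incrFactor n μ t}, inner ℂ (z - y) w = 0 := by
    intro w hw
    have hle : lpSpan F {g | ∃ k : ℤ, k ≤ -1 ∧
        g = fun t : ℝ => exp (I * t * k) * incrFactor n μ t} ≤ (ℂ ∙ (z - y))ᗮ := by
      refine Submodule.topologicalClosure_minimal _ (Submodule.span_le.2 ?_)
        (Submodule.isClosed_orthogonal _)
      rintro w ⟨_, ⟨k, hk, rfl⟩, hws⟩
      rw [SetLike.mem_coe, Submodule.mem_orthogonal_singleton_iff_inner_left, L2.inner_def,
        ← integral_past_mul_error ha hμ hφ hk]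
      refine integral_congr_ae ?_
      filter_upwards [hzy, hws] with t h1 h2
      rw [RCLike.inner_apply, h1, h2]
    exact Submodule.mem_orthogonal_singleton_iff_inner_right.1 (hle hw)
  have hnorm : ∀ (u : Lp ℂ 2 F) (g : ℝ → ℂ), u =ᵐ[F] g → eLpNorm g 2 F = ‖u‖ₑ := fun u g hu => by
    rw [Lp.enorm_def, eLpNorm_congr_ae hu]
  have hzx : (z - x : Lp ℂ 2 F) =ᵐ[F] fun t => (symbolA a n μ t - h t) * incrFactor n μ t := by
    filter_upwards [Lp.coeFn_sub z x, hz, hxh] with t h1 h2 h3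
    rw [h1, Pi.sub_apply, h2, h3, sub_mul]
  rw [mse_eq_eLpNorm_sq, mse_eq_eLpNorm_sq, hnorm _ _ hzy, hnorm _ _ hzx]
  have hpy := norm_add_sq_eq_norm_sq_add_norm_sq_of_inner_eq_zero (z - y) (y - x)
    (horth _ (Submodule.sub_mem _ hy hx))
  rw [sub_add_sub_cancel] at hpy
  have hle : ‖z - y‖ ≤ ‖z - x‖ := by
    refine le_of_sq_le_sq ?_ (norm_nonneg _)
    nlinarith [norm_nonneg (y - x)]
  rw [← ofReal_norm, ← ofReal_norm]
  gcongr

/-! ### Isometric correspondence of families with equal Gram matrices -/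

section Graph

variable {ι E K : Type*} [NormedAddCommGroup E] [InnerProductSpace ℂ E] [NormedAddCommGroup K]
  [InnerProductSpace ℂ K] {x : ι → E} {y : ι → K} {J : Set ι}

/-- The closed span of the pairs `(x i, y i)`, `i ∈ J`. -/
def graphSpan (x : ι → E) (y : ι → K) (J : Set ι) : Submodule ℂ (E × K) :=
  (Submodule.span ℂ ((fun i => (x i, y i)) '' J)).topologicalClosure

theorem isClosed_graphSpan : IsClosed (graphSpan x y J : Set (E × K)) :=
  Submodule.isClosed_topologicalClosure _

theorem pair_mem_graphSpan {i : ι} (hi : i ∈ J) : (x i, y i) ∈ graphSpan x y J :=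
  Submodule.le_topologicalClosure _ (Submodule.subset_span ⟨i, hi, rfl⟩)

theorem graphSpan_mono {J' : Set ι} (h : J ⊆ J') : graphSpan x y J ≤ graphSpan x y J' :=
  Submodule.topologicalClosure_mono (Submodule.span_mono (Set.image_mono h))

theorem HasSum.mem_submodule {M κ : Type*} [AddCommGroup M] [Module ℂ M] [TopologicalSpace M]
    {V : Submodule ℂ M} (hV : IsClosed (V : Set M)) {g : κ → M} {s : M} (hs : HasSum g s)
    (hg : ∀ k, g k ∈ V) : s ∈ V :=
  hV.mem_of_tendsto hs (Eventually.of_forall fun _ => Submodule.sum_mem _ fun k _ => hg k)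

/-- For fixed q the asserted equality cuts out the kernel of a continuous functional, so it suffices
to check generators. Used once in each argument, it extends equality of Gram matrices to the whole
closed span. -/
theorem graphSpan_le_of_inner {q : E × K} (hq : ∀ i, inner ℂ q.1 (x i) = inner ℂ q.2 (y i))
    {p : E × K} (hp : p ∈ graphSpan x y J) : inner ℂ q.1 p.1 = inner ℂ q.2 p.2 := by
  let L : E × K →L[ℂ] ℂ := (innerSL ℂ q.1).comp (ContinuousLinearMap.fst ℂ E K) -
    (innerSL ℂ q.2).comp (ContinuousLinearMap.snd ℂ E K)
  have hle : graphSpan x y J ≤ L.ker := by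
    refine Submodule.topologicalClosure_minimal _ (Submodule.span_le.2 ?_) L.isClosed_ker
    rintro _ ⟨i, -, rfl⟩
    simp [L, hq i]
  have := hle hp
  simpa [L, sub_eq_zero] using this

theorem inner_eq_of_mem_graphSpan (hxy : ∀ i j, inner ℂ (x i) (x j) = inner ℂ (y i) (y j))
    {p q : E × K} (hp : p ∈ graphSpan x y J) (hq : q ∈ graphSpan x y J) :
    inner ℂ p.1 q.1 = inner ℂ p.2 q.2 := by
  refine graphSpan_le_of_inner (fun i => ?_) hq
  rw [← inner_conj_symm, ← inner_conj_symm p.2]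
  exact congrArg _ (graphSpan_le_of_inner (q := (x i, y i)) (hxy i) hp)

theorem norm_eq_of_mem_graphSpan (hxy : ∀ i j, inner ℂ (x i) (x j) = inner ℂ (y i) (y j))
    {p : E × K} (hp : p ∈ graphSpan x y J) : ‖p.1‖ = ‖p.2‖ := by
  have h := inner_eq_of_mem_graphSpan hxy hp hp
  rw [inner_self_eq_norm_sq_to_K, inner_self_eq_norm_sq_to_K] at h
  have h2 : ‖p.1‖ ^ 2 = ‖p.2‖ ^ 2 := by exact_mod_cast h
  exact (sq_eq_sq₀ (norm_nonneg _) (norm_nonneg _)).1 h2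

theorem fst_mem_of_mem_graphSpan {p : E × K} (hp : p ∈ graphSpan x y J) :
    p.1 ∈ (Submodule.span ℂ (x '' J)).topologicalClosure := by
  have hle : graphSpan x y J ≤ ((Submodule.span ℂ (x '' J)).topologicalClosure).comap
      (LinearMap.fst ℂ E K) := by
    refine Submodule.topologicalClosure_minimal _ (Submodule.span_le.2 ?_) ?_
    · rintro _ ⟨i, hi, rfl⟩
      exact Submodule.le_topologicalClosure _ (Submodule.subset_span ⟨i, hi, rfl⟩)
    · exact (Submodule.isClosed_topologicalClosure _).preimage continuous_fst
  exact hle hp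

theorem swap_mem_graphSpan {p : E × K} (hp : p ∈ graphSpan x y J) :
    (p.2, p.1) ∈ graphSpan y x J := by
  have hle : graphSpan x y J ≤ (graphSpan y x J).comap
      ((LinearMap.snd ℂ E K).prod (LinearMap.fst ℂ E K)) := by
    refine Submodule.topologicalClosure_minimal _ (Submodule.span_le.2 ?_) ?_
    · rintro _ ⟨i, hi, rfl⟩
      exact pair_mem_graphSpan hi
    · exact isClosed_graphSpan.preimage (continuous_snd.prodMk continuous_fst)
  exact hle hp

/-- Finite combinations lift directly. Equality of norms on the graph makes the lifts of a
convergent sequence Cauchy, and completeness together with closedness of the graph gives the limit.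
-/
theorem exists_mem_graphSpan [CompleteSpace K]
    (hxy : ∀ i j, inner ℂ (x i) (x j) = inner ℂ (y i) (y j)) {u : E}
    (hu : u ∈ (Submodule.span ℂ (x '' J)).topologicalClosure) :
    ∃ v, (u, v) ∈ graphSpan x y J := by
  have hlift : ∀ s ∈ Submodule.span ℂ (x '' J), ∃ v, (s, v) ∈ graphSpan x y J := by
    intro s hs
    induction hs using Submodule.span_induction with
    | mem s hs =>
      obtain ⟨i, hi, rfl⟩ := hs
      exact ⟨_, pair_mem_graphSpan hi⟩
    | zero => exact ⟨0, Submodule.zero_mem _⟩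
    | add s t _ _ hs ht =>
      obtain ⟨v, hv⟩ := hs
      obtain ⟨w, hw⟩ := ht
      exact ⟨v + w, Submodule.add_mem _ hv hw⟩
    | smul c s _ hs =>
      obtain ⟨v, hv⟩ := hs
      exact ⟨c • v, Submodule.smul_mem _ c hv⟩
  rw [← SetLike.mem_coe, Submodule.topologicalClosure_coe, mem_closure_iff_seq_limit] at hu
  obtain ⟨s, hs, hlim⟩ := hu
  choose v hv using fun k => hlift (s k) (hs k)
  have hcau : CauchySeq v := by
    have hc := hlim.cauchySeq
    rw [Metric.cauchySeq_iff] at hc ⊢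
    intro ε hε
    obtain ⟨N, hN⟩ := hc ε hε
    refine ⟨N, fun k hk l hl => ?_⟩
    have h := norm_eq_of_mem_graphSpan hxy (Submodule.sub_mem _ (hv k) (hv l))
    rw [Prod.mk_sub_mk] at h
    rw [dist_eq_norm, ← h, ← dist_eq_norm]
    exact hN k hk l hl
  obtain ⟨v', hv'⟩ := cauchySeq_tendsto_of_complete hcau
  exact ⟨v', isClosed_graphSpan.mem_of_tendsto (hlim.prodMk_nhds hv') (Eventually.of_forall hv)⟩

end Graph

theorem lpSpan_eq_of_family {α ι : Type*} [MeasurableSpace α] {ν : Measure α} {S : Set (α → ℂ)}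
    {J : Set ι} {F : ι → α → ℂ} {y : ι → Lp ℂ 2 ν} (hS : ∀ g, g ∈ S ↔ ∃ i ∈ J, g = F i)
    (hy : ∀ i, y i =ᵐ[ν] F i) :
    lpSpan ν S = (Submodule.span ℂ (y '' J)).topologicalClosure := by
  have : lpSet ν S = y '' J := by
    ext x
    constructor
    · rintro ⟨s, hs, hxs⟩
      obtain ⟨i, hi, rfl⟩ := (hS s).1 hs
      exact ⟨i, hi, Lp.ext ((hy i).trans hxs.symm)⟩
    · rintro ⟨i, hi, rfl⟩
      exact ⟨F i, (hS _).2 ⟨i, hi, rfl⟩, hy i⟩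
  rw [lpSpan, this]

theorem tsum_smul_ae_eq {α : Type*} [MeasurableSpace α] {ν : Measure α} {y : ℕ → Lp ℂ 2 ν}
    {F : ℕ → α → ℂ} (hy : ∀ k, y k =ᵐ[ν] F k) {g : ℕ → ℂ} (hg : Summable fun k => ‖g k • y k‖) :
    (∑' k, g k • y k : Lp ℂ 2 ν) =ᵐ[ν] fun t => ∑' k, g k * F k t := by
  have h1 : ∑' k, ‖g k • y k‖ₑ ≠ ∞ := tsum_enorm_ne_top_iff_summable_norm.2 hg
  filter_upwards [Lp.coeFn_tsum h1, ae_all_iff.2 fun k => Lp.coeFn_smul (g k) (y k),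
    ae_all_iff.2 hy] with t h2 h3 h4
  rw [h2]
  refine tsum_congr fun k => ?_
  rw [h3 k, Pi.smul_apply, h4 k, smul_eq_mul]

/-! ### Increments and their spectral images -/

section Increments

variable {Ω : Type w} [MeasurableSpace Ω] {P : Measure Ω} {n : ℕ} {f : ℝ → ℝ} {ξ : ℤ → Ω → ℂ}

/-- The class of an increment in `L²(P)`. -/
def incrVec (hξ : HasIncrementDensity P n f ξ) (s : ℕ) (m : ℤ) : Lp ℂ 2 P :=
  (hξ.memLp m s).toLp

/-- The spectral image of an increment. -/
def specVec (hf : IsSpectralDensity f) (n s : ℕ) (m : ℤ) : Lp ℂ 2 (specMeasure f) :=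
  (memLp_incrFun n s hf m).toLp

theorem coeFn_incrVec (hξ : HasIncrementDensity P n f ξ) (s : ℕ) (m : ℤ) :
    incrVec hξ s m =ᵐ[P] increment n ξ m s := (hξ.memLp m s).coeFn_toLp

theorem coeFn_specVec (hf : IsSpectralDensity f) (n s : ℕ) (m : ℤ) :
    specVec hf n s m =ᵐ[specMeasure f] fun t : ℝ => exp (I * t * m) * incrFactor n s t :=
  (memLp_incrFun n s hf m).coeFn_toLp

/-- The structural formula read as an inner product: t^{2n} = (it)^n(-it)^n distributes the
denominator over one increment factor and the conjugate of the other. Two different steps are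
allowed because the innovations built from step one must be compared with increments of all steps.
-/
theorem gram_eq (hf : IsSpectralDensity f) (hξ : HasIncrementDensity P n f ξ) (s₁ s₂ : ℕ)
    (m₁ m₂ : ℤ) : inner ℂ (incrVec hξ s₁ m₁) (incrVec hξ s₂ m₂) =
      inner ℂ (specVec hf n s₁ m₁) (specVec hf n s₂ m₂) := by
  rw [L2.inner_def, L2.inner_def]
  have h1 : ∫ ω, inner ℂ (incrVec hξ s₁ m₁ ω) (incrVec hξ s₂ m₂ ω) ∂P =
      ∫ ω, increment n ξ (m₁ + (m₂ - m₁)) s₂ ω * conj (increment n ξ m₁ s₁ ω) ∂P := by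
    refine integral_congr_ae ?_
    filter_upwards [coeFn_incrVec hξ s₁ m₁, coeFn_incrVec hξ s₂ m₂] with ω h1 h2
    rw [RCLike.inner_apply, h1, h2, add_sub_cancel]
  rw [h1, hξ.structural]
  refine integral_congr_ae ?_
  filter_upwards [coeFn_specVec hf n s₁ m₁, coeFn_specVec hf n s₂ m₂] with t h1 h2
  rw [RCLike.inner_apply, h1, h2, map_mul]
  have e1 : exp (I * t * (m₂ - m₁ : ℤ)) = exp (I * t * m₂) * conj (exp (I * t * m₁)) := by
    rw [← exp_conj, ← exp_add]; congr 1; simp; ring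
  have e2 : conj (incrFactor n s₁ t) = (1 - exp (I * s₁ * t)) ^ n / (-(I * t)) ^ n := by
    rw [incrFactor, map_div₀, map_pow, map_pow, map_sub, map_one, ← exp_conj]
    simp
    ring_nf
  have e3 : (I * t : ℂ) ^ n * (-(I * t)) ^ n = (t : ℂ) ^ (2 * n) := by
    rw [← mul_pow, pow_mul]; congr 1; linear_combination (-(t : ℂ) ^ 2) * I_sq
  have e4 : exp (-(I * (s₂ : ℤ) * t)) = exp (-(I * t * s₂)) := by congr 1; push_cast; ring
  rw [e1, e2, incrFactor, ← e3, e4, Int.cast_natCast, one_div, mul_inv]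
  ring

theorem norm_specVec (hf : IsSpectralDensity f) (n s : ℕ) (m : ℤ) :
    ‖specVec hf n s m‖ = ‖specVec hf n s 0‖ := by
  rw [specVec, specVec, Lp.norm_toLp, Lp.norm_toLp]
  congr 1
  refine eLpNorm_congr_norm_ae (Eventually.of_forall fun t => ?_)
  simp only [norm_mul, norm_exp_mul_intCast]

theorem norm_incrVec (hf : IsSpectralDensity f) (hξ : HasIncrementDensity P n f ξ) (s : ℕ)
    (m : ℤ) : ‖incrVec hξ s m‖ = ‖specVec hf n s 0‖ := by
  rw [← norm_specVec hf n s m]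
  have h := gram_eq hf hξ s s m m
  rw [inner_self_eq_norm_sq_to_K, inner_self_eq_norm_sq_to_K] at h
  have h2 : ‖incrVec hξ s m‖ ^ 2 = ‖specVec hf n s m‖ ^ 2 := by exact_mod_cast h
  exact (sq_eq_sq₀ (norm_nonneg _) (norm_nonneg _)).1 h2

theorem summable_smul_incrVec (hf : IsSpectralDensity f) (hξ : HasIncrementDensity P n f ξ) (s : ℕ)
    {g : ℕ → ℂ} (hg : Summable fun k => ‖g k‖) (m : ℕ → ℤ) :
    Summable fun k => ‖g k • incrVec hξ s (m k)‖ := by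
  simp_rw [norm_smul, norm_incrVec hf]
  exact hg.mul_right _

theorem summable_smul_specVec (hf : IsSpectralDensity f) (n s : ℕ)
    {g : ℕ → ℂ} (hg : Summable fun k => ‖g k‖) (m : ℕ → ℤ) :
    Summable fun k => ‖g k • specVec hf n s (m k)‖ := by
  simp_rw [norm_smul, norm_specVec hf n s (m _)]
  exact hg.mul_right _

/-- Absolutely convergent combinations of increments correspond to those of their spectral
images. -/
theorem tsum_mem_graphSpan (hf : IsSpectralDensity f) (hξ : HasIncrementDensity P n f ξ) {s : ℕ}
    {g : ℕ → ℂ} (hg : Summable fun k => ‖g k‖) {m : ℕ → ℤ} {ι : Type*} {J : Set ι}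
    {x : ι → Lp ℂ 2 P} {y : ι → Lp ℂ 2 (specMeasure f)}
    (hJ : ∀ k, ∃ i ∈ J, x i = incrVec hξ s (m k) ∧ y i = specVec hf n s (m k)) :
    (∑' k, g k • incrVec hξ s (m k), ∑' k, g k • specVec hf n s (m k)) ∈ graphSpan x y J := by
  have h1 := (summable_smul_incrVec hf hξ s hg m).of_norm.hasSum
  have h2 := (summable_smul_specVec hf n s hg m).of_norm.hasSum
  refine HasSum.mem_submodule isClosed_graphSpan (h1.prodMk h2) fun k => ?_
  obtain ⟨i, hi, hx, hy⟩ := hJ k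
  rw [← hx, ← hy]
  exact Submodule.smul_mem _ (g k) (pair_mem_graphSpan hi)

/-! ### Spectral errors are mean square errors -/

variable {a : ℕ → ℂ} {μ : ℕ}

/-- The class of the functional `Bξ`. -/
def functionalBVec (a : ℕ → ℂ) (μ : ℕ) (hξ : HasIncrementDensity P n f ξ) : Lp ℂ 2 P :=
  ∑' k : ℕ, bCoef a n μ k • incrVec hξ μ k

/-- The spectral image of the functional `Bξ`. -/
def symbolVec (a : ℕ → ℂ) (n μ : ℕ) (hf : IsSpectralDensity f) : Lp ℂ 2 (specMeasure f) :=
  ∑' k : ℕ, bCoef a n μ k • specVec hf n μ k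

theorem coeFn_functionalBVec (ha : AdmissibleCoef a n μ) (hf : IsSpectralDensity f)
    (hξ : HasIncrementDensity P n f ξ) :
    functionalBVec a μ hξ =ᵐ[P] functionalB a n μ ξ :=
  tsum_smul_ae_eq (fun k => coeFn_incrVec hξ μ k)
    (summable_smul_incrVec hf hξ μ ha.summable_b fun k => k)

theorem coeFn_symbolVec (ha : AdmissibleCoef a n μ) (hf : IsSpectralDensity f) :
    symbolVec a n μ hf =ᵐ[specMeasure f] fun t => symbolA a n μ t * incrFactor n μ t := by
  refine (tsum_smul_ae_eq (fun k => coeFn_specVec hf n μ k)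
    (summable_smul_specVec hf n μ ha.summable_b fun k => k)).trans (Eventually.of_forall fun t => ?_)
  simp only [symbolA, ← mul_assoc, tsum_mul_right, Int.cast_natCast]

/-- The correspondence of the increments of step `μ` with their spectral images. -/
def corr (hf : IsSpectralDensity f) (hξ : HasIncrementDensity P n f ξ) (μ : ℕ) (J : Set ℤ) :
    Submodule ℂ (Lp ℂ 2 P × Lp ℂ 2 (specMeasure f)) :=
  graphSpan (incrVec hξ μ) (specVec hf n μ) J

theorem functionalB_mem_corr (ha : AdmissibleCoef a n μ) (hf : IsSpectralDensity f)
    (hξ : HasIncrementDensity P n f ξ) :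
    (functionalBVec a μ hξ, symbolVec a n μ hf) ∈ corr hf hξ μ Set.univ :=
  tsum_mem_graphSpan hf hξ ha.summable_b fun k => ⟨k, Set.mem_univ _, rfl, rfl⟩

/-- The term -Vξ occurs in both the functional and its estimate and cancels pointwise. No square
integrability of the initial values is required. -/
theorem estimateError_eq (ha : AdmissibleCoef a n μ) (hf : IsSpectralDensity f)
    (hξ : HasIncrementDensity P n f ξ) {X : Ω → ℂ} {x : Lp ℂ 2 P} (hx : x =ᵐ[P] X) :
    estimateError P a n μ ξ X = ‖functionalBVec a μ hξ - x‖ₑ ^ 2 := by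
  rw [Lp.enorm_def, eLpNorm_eq_lintegral_rpow_enorm_toReal two_ne_zero ENNReal.ofNat_ne_top,
    estimateError, ← ENNReal.rpow_natCast, ← ENNReal.rpow_mul]
  simp only [ENNReal.toReal_ofNat, Nat.cast_ofNat, one_div, isUnit_iff_ne_zero, ne_eq,
    OfNat.ofNat_ne_zero, not_false_eq_true, IsUnit.inv_mul_cancel, ENNReal.rpow_one,
    ENNReal.rpow_ofNat]
  refine lintegral_congr_ae ?_
  filter_upwards [coeFn_functionalBVec ha hf hξ, hx, Lp.coeFn_sub (functionalBVec a μ hξ) x]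
    with ω h1 h2 h3
  rw [h3, Pi.sub_apply, h1, h2, functionalA]
  congr 2
  ring

theorem mse_eq_norm (ha : AdmissibleCoef a n μ) (hf : IsSpectralDensity f) {h : ℝ → ℂ}
    {y : Lp ℂ 2 (specMeasure f)} (hy : y =ᵐ[specMeasure f] fun t => h t * incrFactor n μ t) :
    mse a n μ h f = ‖symbolVec a n μ hf - y‖ₑ ^ 2 := by
  rw [mse_eq_eLpNorm_sq, Lp.enorm_def]
  congr 1
  refine eLpNorm_congr_ae ?_
  filter_upwards [coeFn_symbolVec ha hf, hy, Lp.coeFn_sub (symbolVec a n μ hf) y] with t h1 h2 h3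
  rw [h3, Pi.sub_apply, h1, h2, sub_mul]

/-- The pair of Bξ and its symbol, minus the pair of estimate and characteristic, lies in the graph
of the isometry; its two components therefore have equal norms. -/
theorem error_eq_of_mem_corr (ha : AdmissibleCoef a n μ) (hf : IsSpectralDensity f)
    (hξ : HasIncrementDensity P n f ξ) {X : Ω → ℂ} {h : ℝ → ℂ} {x : Lp ℂ 2 P}
    {y : Lp ℂ 2 (specMeasure f)} (hx : x =ᵐ[P] X)
    (hy : y =ᵐ[specMeasure f] fun t => h t * incrFactor n μ t) {J : Set ℤ}
    (hxy : (x, y) ∈ corr hf hξ μ J) : estimateError P a n μ ξ X = mse a n μ h f := by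
  rw [estimateError_eq ha hf hξ hx, mse_eq_norm ha hf hy, ← ofReal_norm, ← ofReal_norm]
  have hmem := Submodule.sub_mem _ (functionalB_mem_corr ha hf hξ)
    (graphSpan_mono (Set.subset_univ J) hxy)
  have := norm_eq_of_mem_graphSpan (fun i j => gram_eq hf hξ μ μ i j) hmem
  simp only [Prod.mk_sub_mk] at this
  rw [this]

theorem pastSpace_lpSpan (hf : IsSpectralDensity f) (n μ : ℕ) :
    lpSpan (specMeasure f) {g | ∃ k : ℤ, k ≤ -1 ∧
      g = fun t : ℝ => exp (I * t * k) * incrFactor n μ t} =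
      (Submodule.span ℂ (specVec hf n μ '' Set.Iic (-1))).topologicalClosure :=
  lpSpan_eq_of_family (fun _ => Iff.rfl) fun k => coeFn_specVec hf n μ k

theorem increments_lpSpan (hξ : HasIncrementDensity P n f ξ) (μ : ℕ) :
    lpSpan P {Y | ∃ m : ℤ, m ≤ -1 ∧ Y = increment n ξ m μ} =
      (Submodule.span ℂ (incrVec hξ μ '' Set.Iic (-1))).topologicalClosure :=
  lpSpan_eq_of_family (fun _ => Iff.rfl) fun k => coeFn_incrVec hξ μ k

theorem mem_characteristics_iff (hf : IsSpectralDensity f) {h : ℝ → ℂ} :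
    h ∈ characteristics n μ f ↔
      ∃ y ∈ (Submodule.span ℂ (specVec hf n μ '' Set.Iic (-1))).topologicalClosure,
        y =ᵐ[specMeasure f] fun t => h t * incrFactor n μ t := by
  rw [← pastSpace_lpSpan hf n μ]
  refine mem_closedSpanL2_iff ?_
  rintro _ ⟨k, -, rfl⟩
  exact memLp_incrFun n μ hf k

theorem exists_corr_of_mem_characteristics (hf : IsSpectralDensity f)
    (hξ : HasIncrementDensity P n f ξ) {h : ℝ → ℂ} (hh : h ∈ characteristics n μ f) :
    ∃ x y, (x, y) ∈ corr hf hξ μ (Set.Iic (-1)) ∧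
      y =ᵐ[specMeasure f] fun t => h t * incrFactor n μ t := by
  obtain ⟨y, hy, hyh⟩ := (mem_characteristics_iff hf).1 hh
  obtain ⟨x, hx⟩ := exists_mem_graphSpan (x := specVec hf n μ) (y := incrVec hξ μ)
    (fun i j => (gram_eq hf hξ μ μ i j).symm) hy
  exact ⟨x, y, swap_mem_graphSpan hx, hyh⟩

theorem coeFn_linearCombination_specVec (hf : IsSpectralDensity f) (c : ℤ →₀ ℂ) :
    (∑ m ∈ c.support, c m • specVec hf n μ m : Lp ℂ 2 (specMeasure f)) =ᵐ[specMeasure f]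
      fun t : ℝ => ∑ m ∈ c.support, c m * (exp (I * t * m) * incrFactor n μ t) := by
  refine (Lp.coeFn_fun_finsetSum _ _).trans ?_
  filter_upwards [ae_all_iff.2 fun m => Lp.coeFn_smul (c m) (specVec hf n μ m),
    ae_all_iff.2 fun m => coeFn_specVec hf n μ m] with t h1 h2
  refine Finset.sum_congr rfl fun m _ => ?_
  rw [h1 m, Pi.smul_apply, h2 m, smul_eq_mul]

theorem coeFn_linearCombination_incrVec (hξ : HasIncrementDensity P n f ξ) (c : ℤ →₀ ℂ) :
    (∑ m ∈ c.support, c m • incrVec hξ μ m : Lp ℂ 2 P) =ᵐ[P]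
      fun ω => ∑ m ∈ c.support, c m * increment n ξ m μ ω := by
  refine (Lp.coeFn_fun_finsetSum _ _).trans ?_
  filter_upwards [ae_all_iff.2 fun m => Lp.coeFn_smul (c m) (incrVec hξ μ m),
    ae_all_iff.2 fun m => coeFn_incrVec hξ μ m] with t h1 h2
  refine Finset.sum_congr rfl fun m _ => ?_
  rw [h1 m, Pi.smul_apply, h2 m, smul_eq_mul]

theorem hasSpectralCharacteristic_of_mem_corr (hf : IsSpectralDensity f)
    (hξ : HasIncrementDensity P n f ξ) {h : ℝ → ℂ} {x : Lp ℂ 2 P}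
    {y : Lp ℂ 2 (specMeasure f)} (hy : y =ᵐ[specMeasure f] fun t => h t * incrFactor n μ t)
    (hxy : (x, y) ∈ corr hf hξ μ (Set.Iic (-1))) : HasSpectralCharacteristic P n μ f ξ h x := by
  refine ⟨Lp.aestronglyMeasurable x, fun ε hε => ?_⟩
  rw [corr, graphSpan, ← SetLike.mem_coe, Submodule.topologicalClosure_coe,
    EMetric.mem_closure_iff] at hxy
  obtain ⟨p, hp, hlt⟩ := hxy ε hε
  rw [SetLike.mem_coe, Finsupp.mem_span_image_iff_linearCombination] at hp
  obtain ⟨c, hc, rfl⟩ := hp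
  have hfst : (Finsupp.linearCombination ℂ (fun i => (incrVec hξ μ i, specVec hf n μ i)) c).1 =
      ∑ m ∈ c.support, c m • incrVec hξ μ m := by
    rw [Finsupp.linearCombination_apply, Finsupp.sum, Prod.fst_sum]; rfl
  have hsnd : (Finsupp.linearCombination ℂ (fun i => (incrVec hξ μ i, specVec hf n μ i)) c).2 =
      ∑ m ∈ c.support, c m • specVec hf n μ m := by
    rw [Finsupp.linearCombination_apply, Finsupp.sum, Prod.snd_sum]; rfl
  rw [Prod.edist_eq, max_lt_iff, hfst, hsnd,
    edist_eq_eLpNorm_of_ae (Filter.EventuallyEq.refl _ _) (coeFn_linearCombination_incrVec hξ c),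
    edist_eq_eLpNorm_of_ae hy (coeFn_linearCombination_specVec hf c)] at hlt
  exact ⟨c, fun m hm => hc hm, hlt.1.le, hlt.2.le⟩

theorem exists_corr_of_hasSpectralCharacteristic (hf : IsSpectralDensity f)
    (hξ : HasIncrementDensity P n f ξ) {h : ℝ → ℂ} (hh : h ∈ characteristics n μ f) {X : Ω → ℂ}
    (hX : HasSpectralCharacteristic P n μ f ξ h X) :
    ∃ x y, (x, y) ∈ corr hf hξ μ (Set.Iic (-1)) ∧ x =ᵐ[P] X ∧
      y =ᵐ[specMeasure f] fun t => h t * incrFactor n μ t := by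
  have hXL : MemLp X 2 P := by
    obtain ⟨c, -, hc, -⟩ := hX.2 1 one_pos
    have hp : MemLp (fun ω => ∑ m ∈ c.support, c m * increment n ξ m μ ω) 2 P :=
      (memLp_congr_ae (coeFn_linearCombination_incrVec hξ c)).1 (Lp.memLp _)
    have hd : MemLp (X - fun ω => ∑ m ∈ c.support, c m * increment n ξ m μ ω) 2 P :=
      ⟨hX.1.sub hp.1, hc.trans_lt ENNReal.one_lt_top⟩
    simpa using hd.add hp
  obtain ⟨y, -, hy⟩ := (mem_characteristics_iff hf).1 hh
  refine ⟨hXL.toLp, y, ?_, hXL.coeFn_toLp, hy⟩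
  rw [corr, graphSpan, ← SetLike.mem_coe, Submodule.topologicalClosure_coe,
    EMetric.mem_closure_iff]
  intro ε hε
  by_cases htop : ε = ∞
  · exact ⟨0, Submodule.zero_mem _, by rw [htop]; exact edist_lt_top _ _⟩
  obtain ⟨c, hc, h1, h2⟩ := hX.2 (ε / 2) (ENNReal.half_pos hε.ne')
  refine ⟨(∑ m ∈ c.support, c m • incrVec hξ μ m, ∑ m ∈ c.support, c m • specVec hf n μ m), ?_, ?_⟩
  · have : ((∑ m ∈ c.support, c m • incrVec hξ μ m, ∑ m ∈ c.support, c m • specVec hf n μ m) :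
        Lp ℂ 2 P × Lp ℂ 2 (specMeasure f)) =
        ∑ m ∈ c.support, c m • (incrVec hξ μ m, specVec hf n μ m) := by
      ext1 <;> simp [Prod.fst_sum, Prod.snd_sum]
    rw [this]
    exact Submodule.sum_mem _ fun m hm => Submodule.smul_mem _ _
      (Submodule.subset_span ⟨m, hc m hm, rfl⟩)
  · rw [Prod.edist_eq, max_lt_iff,
      edist_eq_eLpNorm_of_ae hXL.coeFn_toLp (coeFn_linearCombination_incrVec hξ c),
      edist_eq_eLpNorm_of_ae hy (coeFn_linearCombination_specVec hf c)]
    have hlt := ENNReal.half_lt_self hε.ne' htop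
    exact ⟨h1.trans_lt hlt, h2.trans_lt hlt⟩

theorem optimalEstimateError_eq (ha : AdmissibleCoef a n μ) (hμ : 0 < μ)
    (hf : IsSpectralDensity f) (hξ : HasIncrementDensity P n f ξ) :
    optimalEstimateError P a n μ ξ = optMse a n μ f := by
  refine le_antisymm (le_iInf₂ fun h hh => ?_) (le_iInf₂ fun X hX => ?_)
  · obtain ⟨x, y, hxy, hy⟩ := exists_corr_of_mem_characteristics hf hξ hh
    rw [← error_eq_of_mem_corr ha hf hξ (Filter.EventuallyEq.refl _ _) hy hxy]
    refine iInf₂_le _ ((mem_closedSpanL2_iff ?_).2 ⟨x, ?_, Filter.EventuallyEq.refl _ _⟩)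
    · rintro _ ⟨m, -, rfl⟩
      exact hξ.memLp m μ
    · rw [increments_lpSpan hξ]
      exact fst_mem_of_mem_graphSpan hxy
  · obtain ⟨x, hx, hxX⟩ := (mem_closedSpanL2_iff (by
      rintro _ ⟨m, -, rfl⟩
      exact hξ.memLp m μ)).1 hX
    rw [increments_lpSpan hξ] at hx
    obtain ⟨y, hxy⟩ := exists_mem_graphSpan (fun i j => gram_eq hf hξ μ μ i j) hx
    -- The increment factor vanishes only on a null set, so every element of the spectral past has
    -- the form hχ and the infimum over h misses nothing.
    have hy : y =ᵐ[specMeasure f] fun t => (y t / incrFactor n μ t) * incrFactor n μ t := by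
      filter_upwards [(specMeasure_absolutelyContinuous f).ae_le
        (ae_freq_incrFactor_ne_zero n hμ)] with t ht
      rw [div_mul_cancel₀ _ ht]
    rw [error_eq_of_mem_corr ha hf hξ hxX hy hxy]
    exact iInf₂_le _ ((mem_characteristics_iff hf).2
      ⟨y, fst_mem_of_mem_graphSpan (swap_mem_graphSpan hxy), hy⟩)

end Increments

/-! ### The moving average representation -/

section Innovations

variable {Ω : Type w} [MeasurableSpace Ω] {P : Measure Ω} {n : ℕ} {f : ℝ → ℝ} {ξ : ℤ → Ω → ℂ}

/-- The innovation at time `m` built from the coefficients `κ`. -/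
def innovVec (hξ : HasIncrementDensity P n f ξ) (κ : ℕ → ℂ) (m : ℤ) : Lp ℂ 2 P :=
  ∑' j : ℕ, κ j • incrVec hξ 1 (m - j)

/-- The spectral image of the innovation at time `m`. -/
def innovSpec (hf : IsSpectralDensity f) (n : ℕ) (κ : ℕ → ℂ) (m : ℤ) : Lp ℂ 2 (specMeasure f) :=
  ∑' j : ℕ, κ j • specVec hf n 1 (m - j)

/-- For step one the geometric sum is 1, so the outer factor has no zeros on the closed disk and can
be inverted with summable coefficients. For larger steps and n ≥ 1 it vanishes at roots of unity,
which is why innovations are built from step-one increments. -/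
theorem exists_innovation_coef (n : ℕ) {φ : ℕ → ℂ} (hφ : IsCanonical φ) :
    ∃ κ, HasWienerSeries (fun z => (exp (sincLog z) ^ n)⁻¹ * (∑' k, φ k * z ^ k)⁻¹) κ := by
  obtain ⟨κ, hκ⟩ := hφ.exists_inv
  obtain ⟨g, hg⟩ := exists_hasWienerSeries_exp_neg_sincLog n
  exact ⟨_, hg.mul hκ⟩

theorem exp_mul_sub_natCast (t : ℝ) (m : ℤ) (j : ℕ) :
    exp (I * t * (m - j : ℤ)) = exp (I * t * m) * circ t ^ j := by
  rw [exp_mul_intCast, exp_mul_intCast, neg_sub, sub_eq_neg_add, zpow_add₀ (circ_ne_zero t),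
    zpow_natCast]

variable {φ κ : ℕ → ℂ}

theorem coeFn_innovSpec (hf : IsSpectralDensity f)
    (hκ : HasWienerSeries (fun z => (exp (sincLog z) ^ n)⁻¹ * (∑' k, φ k * z ^ k)⁻¹) κ) (m : ℤ) :
    innovSpec hf n κ m =ᵐ[specMeasure f]
      fun t => exp (I * t * m) * (phaseFun n t / factorFun φ t) := by
  refine (tsum_smul_ae_eq (fun j : ℕ => coeFn_specVec hf n 1 (m - j))
    (summable_smul_specVec hf n 1 hκ.1 _)).trans (Eventually.of_forall fun t => ?_)
  have h := hκ.2 _ (norm_circ t).le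
  have e : ∀ j : ℕ, κ j * (exp (I * t * (m - j : ℤ)) * incrFactor n 1 t) =
      exp (I * t * m) * incrFactor n 1 t * (κ j * circ t ^ j) := fun j => by
    rw [exp_mul_sub_natCast]; ring
  simp only [e, tsum_mul_left, ← h]
  rw [← factorFun_eq, phaseFun, div_eq_mul_inv, div_eq_mul_inv]
  ring

/-- The density |Φ|² cancels 1/|Φ|² and the phase is unimodular, so only exponentials of different
frequencies remain. -/
theorem inner_innovSpec (hφ : IsCanonical φ) (hf : IsSpectralDensity (factorDensity φ))
    (hκ : HasWienerSeries (fun z => (exp (sincLog z) ^ n)⁻¹ * (∑' k, φ k * z ^ k)⁻¹) κ)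
    (k m : ℤ) : inner ℂ (innovSpec hf n κ k) (innovSpec hf n κ m) = if m = k then (1 : ℂ) else 0 := by
  rw [L2.inner_def]
  have h1 : ∫ t, inner ℂ (innovSpec hf n κ k t) (innovSpec hf n κ m t)
      ∂(specMeasure (factorDensity φ)) =
      ∫ t : ℝ, exp (I * t * m) * (phaseFun n t / factorFun φ t) *
        conj (exp (I * t * k) * (phaseFun n t / factorFun φ t))
        ∂(specMeasure (factorDensity φ)) := by
    refine integral_congr_ae ?_
    filter_upwards [coeFn_innovSpec hf hκ k, coeFn_innovSpec hf hκ m] with t h1 h2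
    rw [RCLike.inner_apply, h1, h2]
  have h2 : ∫ t : ℝ, (factorDensity φ t : ℂ) *
      (exp (I * t * m) * (phaseFun n t / factorFun φ t) *
        conj (exp (I * t * k) * (phaseFun n t / factorFun φ t))) ∂freqMeasure =
      ∫ t : ℝ, exp (I * t * (m - k : ℤ)) ∂freqMeasure := by
    refine integral_congr_ae ?_
    filter_upwards [ae_freq_norm_phaseFun n] with t ht
    have hΦ := factorFun_ne_zero hφ t
    have e1 : (factorDensity φ t : ℂ) = factorFun φ t * conj (factorFun φ t) := by
      rw [factorDensity, mul_conj, normSq_eq_norm_sq]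
    have e2 : phaseFun n t * conj (phaseFun n t) = 1 := by
      rw [mul_conj, normSq_eq_norm_sq, ht]; simp
    have e3 : conj (exp (I * t * k)) = exp (-(I * t * k)) := by
      rw [← exp_conj]; congr 1; simp
    have e4 : exp (I * t * (m - k : ℤ)) = exp (I * t * m) * exp (-(I * t * k)) := by
      rw [← exp_add]; congr 1; push_cast; ring
    have hΦ' : conj (factorFun φ t) ≠ 0 := (map_ne_zero _).2 hΦ
    rw [e4, map_mul, map_div₀, e3, e1]
    field_simp
    exact e2
  rw [h1, integral_specMeasure hf, h2, integral_exp_mul_intCast]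
  simp only [sub_eq_zero]
  split_ifs
  · have : (π : ℂ) ≠ 0 := ofReal_ne_zero.2 Real.pi_ne_zero
    field_simp
  · rw [mul_zero]

theorem norm_innovSpec (hφ : IsCanonical φ) (hf : IsSpectralDensity (factorDensity φ))
    (hκ : HasWienerSeries (fun z => (exp (sincLog z) ^ n)⁻¹ * (∑' k, φ k * z ^ k)⁻¹) κ)
    (m : ℤ) : ‖innovSpec hf n κ m‖ = 1 := by
  have h := inner_self_eq_norm_sq (𝕜 := ℂ) (innovSpec hf n κ m)
  rw [inner_innovSpec hφ hf hκ m m, if_pos rfl, RCLike.one_re] at h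
  exact (pow_eq_one_iff_of_nonneg (norm_nonneg _) two_ne_zero).1 h.symm

/-- Relative to the innovation phase/Φ, an increment of step s has transfer function w_sΦ. This is a
power series in e^{-it} with coefficients W^sφ, hence the expansion is one-sided. -/
theorem specVec_eq_tsum (hφ : IsCanonical φ) (hf : IsSpectralDensity (factorDensity φ))
    (hκ : HasWienerSeries (fun z => (exp (sincLog z) ^ n)⁻¹ * (∑' k, φ k * z ^ k)⁻¹) κ)
    {s : ℕ} (hs : 0 < s) (m : ℤ) :
    specVec hf n s m = ∑' j : ℕ, Wapply n s φ j • innovSpec hf n κ (m - j) := by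
  have hW := summable_Wapply n hs hφ.summable
  refine Lp.ext ((coeFn_specVec hf n s m).trans ?_)
  refine EventuallyEq.symm ((tsum_smul_ae_eq (fun j : ℕ => coeFn_innovSpec hf hκ (m - j)) ?_).trans
    (Eventually.of_forall fun t => ?_))
  · simpa only [norm_smul, norm_innovSpec hφ hf hκ, mul_one] using hW
  have e : ∀ j : ℕ, Wapply n s φ j *
      (exp (I * t * (m - j : ℤ)) * (phaseFun n t / factorFun φ t)) =
      exp (I * t * m) * (phaseFun n t / factorFun φ t) * (Wapply n s φ j * circ t ^ j) :=
    fun j => by rw [exp_mul_sub_natCast]; ring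
  have hΦ := factorFun_ne_zero hφ t
  simp only [e, tsum_mul_left]
  rw [← factorFun_eq, factorFun_Wapply n hs hφ.summable, incrFactor_eq_phase]
  field_simp

theorem innov_mem_graphSpan (hf : IsSpectralDensity f) (hξ : HasIncrementDensity P n f ξ)
    (hκ : Summable fun k => ‖κ k‖) (m : ℤ) :
    (innovVec hξ κ m, innovSpec hf n κ m) ∈ graphSpan (fun p : ℕ × ℤ => incrVec hξ p.1 p.2)
      (fun p : ℕ × ℤ => specVec hf n p.1 p.2) Set.univ :=
  tsum_mem_graphSpan hf hξ hκ fun j => ⟨(1, m - j), Set.mem_univ _, rfl, rfl⟩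

theorem inner_innovVec (hφ : IsCanonical φ) (hξ : HasIncrementDensity P n (factorDensity φ) ξ)
    (hκ : HasWienerSeries (fun z => (exp (sincLog z) ^ n)⁻¹ * (∑' k, φ k * z ^ k)⁻¹) κ)
    (k m : ℤ) : inner ℂ (innovVec hξ κ k) (innovVec hξ κ m) = if m = k then (1 : ℂ) else 0 := by
  have hf := isSpectralDensity_factorDensity hφ.summable
  rw [← inner_innovSpec hφ hf hκ k m]
  exact inner_eq_of_mem_graphSpan (fun i j => gram_eq hf hξ _ _ _ _)
    (innov_mem_graphSpan hf hξ hκ.1 k) (innov_mem_graphSpan hf hξ hκ.1 m)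

theorem norm_innovVec (hφ : IsCanonical φ) (hξ : HasIncrementDensity P n (factorDensity φ) ξ)
    (hκ : HasWienerSeries (fun z => (exp (sincLog z) ^ n)⁻¹ * (∑' k, φ k * z ^ k)⁻¹) κ)
    (m : ℤ) : ‖innovVec hξ κ m‖ = 1 := by
  have h := inner_self_eq_norm_sq (𝕜 := ℂ) (innovVec hξ κ m)
  rw [inner_innovVec hφ hξ hκ m m, if_pos rfl, RCLike.one_re] at h
  exact (pow_eq_one_iff_of_nonneg (norm_nonneg _) two_ne_zero).1 h.symm

/-- The sum and the increment have the same spectral image, so their difference is paired with 0 in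
the graph of the isometry and has norm zero. -/
theorem hasSum_innovVec (hφ : IsCanonical φ) (hξ : HasIncrementDensity P n (factorDensity φ) ξ)
    (hκ : HasWienerSeries (fun z => (exp (sincLog z) ^ n)⁻¹ * (∑' k, φ k * z ^ k)⁻¹) κ)
    {s : ℕ} (hs : 0 < s) (m : ℤ) :
    HasSum (fun j : ℕ => Wapply n s φ j • innovVec hξ κ (m - j)) (incrVec hξ s m) := by
  have hf := isSpectralDensity_factorDensity hφ.summable
  have hW := summable_Wapply n hs hφ.summable
  have hgram : ∀ p q : ℕ × ℤ, inner ℂ (incrVec hξ p.1 p.2) (incrVec hξ q.1 q.2) =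
      inner ℂ (specVec hf n p.1 p.2) (specVec hf n q.1 q.2) := fun p q => gram_eq hf hξ _ _ _ _
  have h1 : Summable fun j : ℕ => Wapply n s φ j • innovVec hξ κ (m - j) := by
    refine Summable.of_norm (hW.congr fun j => ?_)
    rw [norm_smul, norm_innovVec hφ hξ hκ, mul_one]
  have h2 : Summable fun j : ℕ => Wapply n s φ j • innovSpec hf n κ (m - j) := by
    refine Summable.of_norm (hW.congr fun j => ?_)
    rw [norm_smul, norm_innovSpec hφ hf hκ, mul_one]
  have hmem : (∑' j : ℕ, Wapply n s φ j • innovVec hξ κ (m - j), specVec hf n s m) ∈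
      graphSpan (fun p : ℕ × ℤ => incrVec hξ p.1 p.2) (fun p : ℕ × ℤ => specVec hf n p.1 p.2)
        Set.univ := by
    rw [specVec_eq_tsum hφ hf hκ hs]
    exact HasSum.mem_submodule isClosed_graphSpan (h1.hasSum.prodMk h2.hasSum) fun j =>
      Submodule.smul_mem _ (Wapply n s φ j) (innov_mem_graphSpan hf hξ hκ.1 (m - j))
  have hpair : (incrVec hξ s m, specVec hf n s m) ∈
      graphSpan (fun p : ℕ × ℤ => incrVec hξ p.1 p.2) (fun p : ℕ × ℤ => specVec hf n p.1 p.2)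
        Set.univ := pair_mem_graphSpan (x := fun p : ℕ × ℤ => incrVec hξ p.1 p.2)
          (y := fun p : ℕ × ℤ => specVec hf n p.1 p.2) (i := (s, m)) (Set.mem_univ _)
  have hz := norm_eq_of_mem_graphSpan hgram (Submodule.sub_mem _ hmem hpair)
  rw [Prod.mk_sub_mk, sub_self, norm_zero, norm_eq_zero, sub_eq_zero] at hz
  exact hz ▸ h1.hasSum

/-- Mean zero is orthogonality to the constant 1, a closed linear condition, so it passes from the
increments to their convergent sums. -/
theorem integral_innovVec [IsProbabilityMeasure P] (hf : IsSpectralDensity f)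
    (hξ : HasIncrementDensity P n f ξ) (hκ : Summable fun k => ‖κ k‖) (m : ℤ) :
    ∫ ω, innovVec hξ κ m ω ∂P = 0 := by
  have hconst : MemLp (fun _ : Ω => (1 : ℂ)) 2 P := memLp_const 1
  have hint : ∀ x : Lp ℂ 2 P, inner ℂ hconst.toLp x = ∫ ω, x ω ∂P := fun x => by
    rw [L2.inner_def]
    refine integral_congr_ae ?_
    filter_upwards [hconst.coeFn_toLp] with ω h
    rw [RCLike.inner_apply, h, map_one, mul_one]
  have hmem : innovVec hξ κ m ∈ (innerSL ℂ (hconst.toLp : Lp ℂ 2 P)).ker := by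
    refine HasSum.mem_submodule (innerSL ℂ _).isClosed_ker
      (summable_smul_incrVec hf hξ 1 hκ fun j : ℕ => m - j).of_norm.hasSum fun j => ?_
    refine Submodule.smul_mem _ _ ?_
    change inner ℂ hconst.toLp _ = 0
    rw [hint, integral_congr_ae (coeFn_incrVec hξ 1 _), hξ.mean_zero]
  rw [← hint]
  exact hmem

/-- Increments of any positive step are one-sided sums of innovations, and innovations are one-sided
sums of step-one increments. The two inclusions of pasts give canonicity. -/
theorem HasIncrementDensity.hasMovingAverage [IsProbabilityMeasure P] {μ : ℕ} (hμ : 0 < μ)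
    (hφ : IsCanonical φ) (hξ : HasIncrementDensity P n (factorDensity φ) ξ) :
    HasMovingAverage P n μ (Wapply n μ φ) ξ := by
  have hf := isSpectralDensity_factorDensity hφ.summable
  obtain ⟨κ, hκ⟩ := exists_innovation_coef n hφ
  have hS : ∀ t : ℤ, ∀ X ∈ {X | ∃ m s : ℤ, m ≤ t ∧ 0 < s ∧ X = increment n ξ m s}, MemLp X 2 P := by
    rintro t _ ⟨m, s, -, -, rfl⟩
    exact hξ.memLp m s
  have hT : ∀ t : ℤ, ∀ X ∈ {X : Ω → ℂ | ∃ m : ℤ, m ≤ t ∧ X = innovVec hξ κ m}, MemLp X 2 P := by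
    rintro t _ ⟨m, -, rfl⟩
    exact Lp.memLp _
  refine ⟨fun m => innovVec hξ κ m, fun m => Lp.memLp _, integral_innovVec hf hξ hκ.1, fun m k => ?_,
    fun t => Set.Subset.antisymm (closedSpanL2_subset (hS t) (hT t) ?_)
      (closedSpanL2_subset (hT t) (hS t) ?_), ?_, fun m => ?_⟩
  · rw [← inner_innovVec hφ hξ hκ k m, L2.inner_def]
    simp only [RCLike.inner_apply]
  · rintro _ ⟨m, s, hm, hs, rfl⟩
    lift s to ℕ using hs.le
    refine (mem_closedSpanL2_iff (hT t)).2 ⟨incrVec hξ s m, ?_, coeFn_incrVec hξ s m⟩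
    refine HasSum.mem_submodule isClosed_lpSpan
      (hasSum_innovVec hφ hξ hκ (by exact_mod_cast hs) m) fun j => ?_
    exact Submodule.smul_mem _ _ (Submodule.le_topologicalClosure _ (Submodule.subset_span
      ⟨_, ⟨m - j, by omega, rfl⟩, Filter.EventuallyEq.refl _ _⟩))
  · rintro _ ⟨m, hm, rfl⟩
    refine (mem_closedSpanL2_iff (hS t)).2 ⟨innovVec hξ κ m, ?_, Filter.EventuallyEq.refl _ _⟩
    refine HasSum.mem_submodule isClosed_lpSpan
      (summable_smul_incrVec hf hξ 1 hκ.1 fun j : ℕ => m - j).of_norm.hasSum fun j => ?_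
    exact Submodule.smul_mem _ _ (Submodule.le_topologicalClosure _ (Submodule.subset_span
      ⟨_, ⟨m - j, 1, by omega, one_pos, rfl⟩, by simpa using coeFn_incrVec hξ 1 (m - j)⟩))
  · have hs := summable_Wapply n hμ hφ.summable
    exact (summable_norm_sq hs)
  · have h := (hasSum_innovVec hφ hξ hκ hμ m).tendsto_sum_nat
    rw [tendsto_iff_edist_tendsto_0] at h
    refine h.congr fun N => ?_
    rw [edist_comm]
    refine edist_eq_eLpNorm_of_ae (coeFn_incrVec hξ μ m) ((Lp.coeFn_fun_finsetSum _ _).trans ?_)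
    filter_upwards [ae_all_iff.2 fun k : ℕ =>
      Lp.coeFn_smul (Wapply n μ φ k) (innovVec hξ κ (m - k))] with ω h1
    refine Finset.sum_congr rfl fun k _ => ?_
    rw [h1 k, Pi.smul_apply, smul_eq_mul]

theorem HasIncrementDensity.congr {g : ℝ → ℝ} (hξ : HasIncrementDensity P n f ξ)
    (h : f =ᵐ[freqMeasure] g) : HasIncrementDensity P n g ξ :=
  ⟨hξ.memLp, hξ.mean_zero, by rw [← specMeasure_congr h]; exact hξ.structural⟩

end Innovations

/-! ### Saddle points and least favorable densities -/

section Saddle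

variable {a : ℕ → ℂ} {n μ : ℕ} {φ : ℕ → ℂ} {D : Set (ℝ → ℝ)} {f g v u : ℝ → ℝ} {P₀ : ℝ}

theorem IsOptimalCharacteristic.congr {h : ℝ → ℂ} (hh : IsOptimalCharacteristic a n μ f h)
    (hfg : f =ᵐ[freqMeasure] g) : IsOptimalCharacteristic a n μ g h := by
  have e := specMeasure_congr hfg
  simp only [IsOptimalCharacteristic, optMse, characteristics, pastSpace, mse] at hh ⊢
  rwa [← e]

/-- A saddle point of the error yields a least favorable density and a minimax-robust spectral
characteristic. -/
theorem minimax_of_saddle {h₀ : ℝ → ℂ} (hD : h₀ ∈ characteristicsOn n μ D) (hf : f ∈ D)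
    (hopt : IsOptimalCharacteristic a n μ f h₀)
    (hs : ∀ g ∈ D, mse a n μ h₀ g ≤ mse a n μ h₀ f) :
    IsLeastFavorable a n μ D f ∧ IsMinimaxRobust a n μ D h₀ := by
  refine ⟨⟨hf, fun g hg => ?_⟩, hD, ⟨f, hf, hs⟩, fun h hh => ?_⟩
  · rw [← hopt.2]
    exact (iInf₂_le _ (hD g hg)).trans (hs g hg)
  · refine (iSup₂_le hs).trans (hopt.2.le.trans ?_)
    exact (iInf₂_le h (hh f hf)).trans (le_iSup₂_of_le f hf le_rfl)

/-- For every canonical ψ the objective is the optimal error under f_ψ, so the extremum problem is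
the least favorable problem restricted to canonical densities. -/
theorem solvesExtremal_of_isLeastFavorable (ha : AdmissibleCoef a n μ) (hμ : 0 < μ)
    (hφ : IsCanonical φ) (h : IsLeastFavorable a n μ D (factorDensity φ)) :
    SolvesExtremal a n μ D φ := by
  refine ⟨hφ, h.1, fun ψ hψ hmem => ?_⟩
  rw [← mse_hFun_factorDensity ha hμ hψ, ← mse_hFun_factorDensity ha hμ hφ,
    (isOptimalCharacteristic_hFun ha hμ hψ).2, (isOptimalCharacteristic_hFun ha hμ hφ).2]
  exact h.2 _ hmem

theorem integral_factorDensity_of_l2sq (hφ : IsCanonical φ) (hP₀ : 0 < P₀)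
    (hn : l2sq φ = ENNReal.ofReal P₀) : ∫ t, factorDensity φ t ∂freqMeasure = 2 * π * P₀ := by
  rw [l2sq_eq_ofReal hφ.summable,
    ENNReal.ofReal_eq_ofReal_iff (tsum_nonneg fun _ => by positivity) hP₀.le] at hn
  rw [integral_norm_sq_factorFun hφ.summable, hn]

theorem factorDensity_mem_bandClass (hφ : IsCanonical φ) (hP₀ : 0 < P₀)
    (hn : l2sq φ = ENNReal.ofReal P₀)
    (hb : ∀ᵐ t ∂freqMeasure, v t ≤ factorDensity φ t ∧ factorDensity φ t ≤ u t) :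
    factorDensity φ ∈ bandClass v u P₀ := by
  refine ⟨isSpectralDensity_factorDensity hφ.summable, hb, ?_⟩
  rw [integral_factorDensity_of_l2sq hφ hP₀ hn]
  have := Real.pi_pos
  field_simp
  exact le_rfl

theorem bandClass_congr (h : f =ᵐ[freqMeasure] g) (hf : f ∈ bandClass v u P₀) :
    g ∈ bandClass v u P₀ := by
  refine ⟨⟨?_, hf.1.2.congr h⟩, ?_, ?_⟩
  · filter_upwards [h, hf.1.1] with t h1 h2
    rwa [← h1]
  · filter_upwards [h, hf.2.1] with t h1 h2
    rwa [← h1]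
  · rw [← integral_congr_ae h]
    exact hf.2.2

/-- A pointwise Lagrange multiplier for the power constraint yields the saddle inequality. -/
theorem mse_le_of_multiplier (ha : AdmissibleCoef a n μ) (hμ : 0 < μ) (hφ : IsCanonical φ)
    (hP₀ : 0 < P₀) (hn : l2sq φ = ENNReal.ofReal P₀) {M : ℝ} (hM : 0 ≤ M)
    (hf : f ∈ bandClass v u P₀)
    (hle : ∀ᵐ t ∂freqMeasure, errRatio a n μ φ t * (f t - factorDensity φ t) ≤
      M * (f t - factorDensity φ t)) :
    mse a n μ (hFun a n μ φ) f ≤ mse a n μ (hFun a n μ φ) (factorDensity φ) := by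
  have hF := isSpectralDensity_factorDensity hφ.summable
  rw [mse_hFun ha hμ hφ hf.1, mse_hFun ha hμ hφ hF]
  have hpi := Real.pi_pos
  refine ENNReal.ofReal_le_ofReal (mul_le_mul_of_nonneg_left ?_ (by positivity))
  have i1 := integrable_errRatio_mul ha hμ hφ hf.1
  have i2 := integrable_errRatio_mul ha hμ hφ hF
  have h1 := integral_mono_ae (μ := freqMeasure)
    ((i1.sub i2).congr (Eventually.of_forall fun t => (mul_sub _ _ _).symm))
    ((hf.1.2.sub hF.2).const_mul M) hle
  have hpow : ∫ t, f t ∂freqMeasure ≤ 2 * π * P₀ := by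
    have := hf.2.2
    rwa [one_div, inv_mul_le_iff₀ (by positivity)] at this
  simp only [mul_sub] at h1
  rw [integral_sub i1 i2, integral_const_mul, integral_sub' hf.1.2 hF.2, integral_factorDensity_of_l2sq hφ hP₀ hn] at h1
  -- Since f_φ uses the full power 2πP₀, the integral of M(f - f_φ) is at most 0; this is where the
  -- sign of M matters.
  linarith [mul_nonneg hM (sub_nonneg.2 hpow)]

/-- The eigen equation says r_φ(e^{it}) is α times the conjugate of Φ(e^{-it}), so the ratio is
constant and serves as its own multiplier. -/
theorem errRatio_of_eigen (hφ : IsCanonical φ) {α : ℂ}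
    (h : ∀ k, DAW a n μ φ k = α * conj (φ k)) (t : ℝ) : errRatio a n μ φ t = ‖α‖ ^ 2 := by
  have hr : rFun a n μ φ t = α * conj (factorFun φ t) := by
    rw [rFun, factorFun, conj_tsum, ← tsum_mul_left]
    refine tsum_congr fun k => ?_
    rw [h, map_mul, ← exp_conj, mul_assoc]
    simp
  rw [errRatio, hr, norm_mul, RCLike.norm_conj, mul_pow, ← factorDensity,
    mul_div_cancel_right₀ _ (factorDensity_pos hφ t).ne']

theorem exists_errRatio_le (ha : AdmissibleCoef a n μ) (hμ : 0 < μ) (hφ : IsCanonical φ) :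
    ∃ M, 0 ≤ M ∧ ∀ᵐ t ∂freqMeasure, errRatio a n μ φ t ≤ M := by
  have hc : Continuous (errRatio a n μ φ) :=
    ((continuous_rFun ha hμ hφ.summable).norm.pow 2).div
      (continuous_factorDensity hφ.summable) fun t => (factorDensity_pos hφ t).ne'
  obtain ⟨M, hM⟩ := (isCompact_Icc (a := -π) (b := π)).exists_bound_of_continuousOn hc.continuousOn
  refine ⟨M, (norm_nonneg _).trans (hM π (Set.right_mem_Icc.2 (by linarith [Real.pi_pos]))), ?_⟩
  filter_upwards [ae_freq_mem] with t ht
  exact (le_abs_self _).trans (hM t (Set.Ioc_subset_Icc_self ht))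

/-- Complementary slackness with M = |c|^{-2} when c ≠ 0. Where the ratio is below M the truncation
from below is active, so f_φ = v ≤ f. Where it exceeds M the upper bound is reached, so f ≤ u ≤ f_φ.
Elsewhere the two sides coincide. -/
theorem exists_multiplier_of_trunc (ha : AdmissibleCoef a n μ) (hμ : 0 < μ) (hφ : IsCanonical φ)
    (hv : IsSpectralDensity v) (hvu : ∀ᵐ t ∂freqMeasure, v t ≤ u t) {c : ℂ}
    (hc : ∀ᵐ t ∂freqMeasure, truncDensity a n μ v u c φ t = factorDensity φ t) :
    ∃ M, 0 ≤ M ∧ ∀ f ∈ bandClass v u P₀, ∀ᵐ t ∂freqMeasure,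
      errRatio a n μ φ t * (f t - factorDensity φ t) ≤ M * (f t - factorDensity φ t) := by
  rcases eq_or_ne c 0 with rfl | hc0
  -- If c = 0 the truncated density is v, so f - f_φ ≥ 0 throughout the class and any upper bound of
  -- the ratio is a multiplier.
  · obtain ⟨M, hM0, hM⟩ := exists_errRatio_le ha hμ hφ
    refine ⟨M, hM0, fun f hf => ?_⟩
    filter_upwards [hc, hf.2.1, hM, hv.1, hvu] with t h1 h2 h3 h4 h5
    refine mul_le_mul_of_nonneg_right h3 ?_
    rw [← h1, truncDensity, zero_mul, norm_zero, zero_pow two_ne_zero, min_eq_right (h4.trans h5),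
      max_eq_left h4]
    exact sub_nonneg.2 h2.1
  · have hC : 0 < ‖c‖ ^ 2 := by positivity
    refine ⟨(‖c‖ ^ 2)⁻¹, by positivity, fun f hf => ?_⟩
    filter_upwards [hc, hf.2.1, hvu] with t h1 h2 h5
    have hF := factorDensity_pos hφ t
    rw [truncDensity, norm_mul, mul_pow] at h1
    rw [errRatio]
    rcases lt_trichotomy (‖c‖ ^ 2 * ‖rFun a n μ φ t‖ ^ 2) (factorDensity φ t) with hlt | heq | hgt
    · have hFv : factorDensity φ t = v t := by
        rcases max_choice (v t) (min (u t) (‖c‖ ^ 2 * ‖rFun a n μ φ t‖ ^ 2)) with h | h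
        · exact h1.symm.trans h
        · exact absurd (h1.symm.trans h) ((min_le_right _ _).trans_lt hlt).ne'
      refine mul_le_mul_of_nonneg_right ?_ (by rw [hFv]; exact sub_nonneg.2 h2.1)
      rw [div_le_iff₀ hF, inv_mul_eq_div, le_div_iff₀ hC, mul_comm]
      exact hlt.le
    · refine le_of_eq (congrArg (· * _) ?_)
      rw [← heq]
      rw [← heq] at hF
      rw [mul_comm (‖c‖ ^ 2), div_mul_cancel_left₀ (pos_of_mul_pos_right hF hC.le).ne']
    · have hFu : u t ≤ factorDensity φ t := by
        have h := (le_max_right (v t) _).trans h1.le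
        rcases min_le_iff.1 h with h | h
        · exact h
        · exact absurd h hgt.not_ge
      refine mul_le_mul_of_nonpos_right ?_ (sub_nonpos.2 (h2.2.trans hFu))
      rw [le_div_iff₀ hF, inv_mul_eq_div, div_le_iff₀ hC, mul_comm]
      exact hgt.le

theorem truncDensity_mem_Icc (hvu : ∀ᵐ t ∂freqMeasure, v t ≤ u t) {c : ℂ}
    (hc : ∀ᵐ t ∂freqMeasure, truncDensity a n μ v u c φ t = factorDensity φ t) :
    ∀ᵐ t ∂freqMeasure, v t ≤ factorDensity φ t ∧ factorDensity φ t ≤ u t := by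
  filter_upwards [hc, hvu] with t h1 h2
  rw [← h1]
  exact ⟨le_max_left _ _, max_le h2 (min_le_left _ _)⟩

theorem hFun_mem_characteristicsOn (ha : AdmissibleCoef a n μ) (hμ : 0 < μ) (hφ : IsCanonical φ) :
    hFun a n μ φ ∈ characteristicsOn n μ (bandClass v u P₀) :=
  fun _ hf => hFun_mem_characteristics ha hμ hφ hf.1

theorem minimax_of_eigenSolution (ha : AdmissibleCoef a n μ) (hμ : 0 < μ) (hP₀ : 0 < P₀)
    (hφ : φ ∈ eigenSolutions a n μ v u P₀) :
    IsLeastFavorable a n μ (bandClass v u P₀) (factorDensity φ) ∧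
      IsMinimaxRobust a n μ (bandClass v u P₀) (hFun a n μ φ) := by
  obtain ⟨hcan, ⟨α, hα⟩, hn, hb⟩ := hφ
  refine minimax_of_saddle (hFun_mem_characteristicsOn ha hμ hcan)
    (factorDensity_mem_bandClass hcan hP₀ hn hb) (isOptimalCharacteristic_hFun ha hμ hcan)
    fun f hf => ?_
  refine mse_le_of_multiplier ha hμ hcan hP₀ hn (sq_nonneg ‖α‖) hf (Eventually.of_forall fun t => ?_)
  rw [errRatio_of_eigen hcan hα]

theorem minimax_of_isTruncSolution (ha : AdmissibleCoef a n μ) (hμ : 0 < μ) (hP₀ : 0 < P₀)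
    (hv : IsSpectralDensity v) (hvu : ∀ᵐ t ∂freqMeasure, v t ≤ u t) {c : ℂ}
    (h : IsTruncSolution a n μ v u P₀ c φ) :
    IsLeastFavorable a n μ (bandClass v u P₀) (factorDensity φ) ∧
      IsMinimaxRobust a n μ (bandClass v u P₀) (hFun a n μ φ) := by
  obtain ⟨hcan, hn, hc⟩ := h
  obtain ⟨M, hM, hle⟩ := exists_multiplier_of_trunc (P₀ := P₀) ha hμ hcan hv hvu hc
  exact minimax_of_saddle (hFun_mem_characteristicsOn ha hμ hcan)
    (factorDensity_mem_bandClass hcan hP₀ hn (truncDensity_mem_Icc hvu hc))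
    (isOptimalCharacteristic_hFun ha hμ hcan) fun f hf =>
      mse_le_of_multiplier ha hμ hcan hP₀ hn hM hf (hle f hf)

theorem IsLeastFavorable.congr (h : IsLeastFavorable a n μ (bandClass v u P₀) f)
    (hfg : f =ᵐ[freqMeasure] g) : IsLeastFavorable a n μ (bandClass v u P₀) g := by
  have e : optMse a n μ f = optMse a n μ g := by
    simp only [optMse, characteristics, pastSpace, mse, specMeasure_congr hfg]
  exact ⟨bandClass_congr hfg h.1, fun f' hf' => (h.2 f' hf').trans_eq e⟩

theorem exists_isTruncSolution (h : nuU a n μ v u P₀ < nuUplus a n μ v u P₀) :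
    ∃ c φ, IsTruncSolution a n μ v u P₀ c φ := by
  by_contra! hno
  have : nuUplus a n μ v u P₀ = 0 := by
    rw [nuUplus, ENNReal.div_eq_zero_iff]
    left
    simp only [ENNReal.iSup_eq_zero]
    rintro φ ⟨c, hc⟩
    exact absurd hc (hno c φ)
  rw [this] at h
  exact not_lt_zero h

end Saddle

end

theorem theorem7p1 (n μ : ℕ) (hn : 1 ≤ n) (hμ : 0 < μ) (a : ℕ → ℂ) (ha : AdmissibleCoef a n μ)
    (v u : ℝ → ℝ) (hv : IsSpectralDensity v) (hu : IsSpectralDensity u)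
    (hvu : ∀ᵐ t ∂freqMeasure, v t ≤ u t) (P₀ : ℝ) (hP₀ : 0 < P₀) :
    -- the spectral errors are the mean square errors of the estimates of `Aξ`
    (∀ f : ℝ → ℝ, IsSpectralDensity f →
      ∀ (Ω : Type w) [MeasurableSpace Ω] (P : Measure Ω) [IsProbabilityMeasure P]
        (ξ : ℤ → Ω → ℂ), HasIncrementDensity P n f ξ →
        optimalEstimateError P a n μ ξ = optMse a n μ f ∧
        ∀ h ∈ characteristics n μ f,
          (∃ X, HasSpectralCharacteristic P n μ f ξ h X) ∧
          ∀ X, HasSpectralCharacteristic P n μ f ξ h X →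
            estimateError P a n μ ξ X = mse a n μ h f) ∧
    -- the case where the maxima agree
    (∀ φ₀ ∈ eigenSolutions a n μ v u P₀,
      nuU a n μ v u P₀ * ENNReal.ofReal P₀ = nuUplus a n μ v u P₀ * ENNReal.ofReal P₀ →
      nuUplus a n μ v u P₀ * ENNReal.ofReal P₀ = l2sq (DAW a n μ φ₀) →
      IsLeastFavorable a n μ (bandClass v u P₀) (factorDensity φ₀) ∧
      (∀ (Ω : Type w) [MeasurableSpace Ω] (P : Measure Ω) [IsProbabilityMeasure P]
        (ξ : ℤ → Ω → ℂ), HasIncrementDensity P n (factorDensity φ₀) ξ →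
        HasMovingAverage P n μ (Wapply n μ φ₀) ξ) ∧
      IsOptimalCharacteristic a n μ (factorDensity φ₀) (hFun a n μ φ₀) ∧
      IsMinimaxRobust a n μ (bandClass v u P₀) (hFun a n μ φ₀)) ∧
    -- the case of the truncated density
    (nuU a n μ v u P₀ < nuUplus a n μ v u P₀ →
      (∃ c φ, IsTruncSolution a n μ v u P₀ c φ) ∧
      ∀ c φ, IsTruncSolution a n μ v u P₀ c φ →
        IsLeastFavorable a n μ (bandClass v u P₀) (truncDensity a n μ v u c φ) ∧
        (∀ (Ω : Type w) [MeasurableSpace Ω] (P : Measure Ω) [IsProbabilityMeasure P]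
          (ξ : ℤ → Ω → ℂ), HasIncrementDensity P n (truncDensity a n μ v u c φ) ξ →
          HasMovingAverage P n μ (Wapply n μ φ) ξ) ∧
        SolvesExtremal a n μ (bandClass v u P₀) φ ∧
        ∫ t, truncDensity a n μ v u c φ t ∂freqMeasure = 2 * π * P₀ ∧
        IsOptimalCharacteristic a n μ (truncDensity a n μ v u c φ) (hFun a n μ φ) ∧
        IsMinimaxRobust a n μ (bandClass v u P₀) (hFun a n μ φ)) := by
  refine ⟨fun f hf Ω _ P _ ξ hξ => ⟨optimalEstimateError_eq ha hμ hf hξ, fun h hh => ⟨?_, ?_⟩⟩,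
    fun φ hφ _ _ => ?_, fun hlt => ⟨exists_isTruncSolution hlt, fun c φ hφ => ?_⟩⟩
  · obtain ⟨x, y, hxy, hy⟩ := exists_corr_of_mem_characteristics hf hξ hh
    exact ⟨x, hasSpectralCharacteristic_of_mem_corr hf hξ hy hxy⟩
  · intro X hX
    obtain ⟨x, y, hxy, hx, hy⟩ := exists_corr_of_hasSpectralCharacteristic hf hξ hh hX
    exact error_eq_of_mem_corr ha hf hξ hx hy hxy
  · obtain ⟨h1, h2⟩ := minimax_of_eigenSolution ha hμ hP₀ hφ
    exact ⟨h1, fun Ω _ P _ ξ hξ => hξ.hasMovingAverage hμ hφ.1,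
      isOptimalCharacteristic_hFun ha hμ hφ.1, h2⟩
  · obtain ⟨h1, h2⟩ := minimax_of_isTruncSolution ha hμ hP₀ hv hvu hφ
    obtain ⟨hcan, hn', hc⟩ := hφ
    have hc' : factorDensity φ =ᵐ[freqMeasure] truncDensity a n μ v u c φ := by
      filter_upwards [hc] with t ht using ht.symm
    exact ⟨h1.congr hc', fun Ω _ P _ ξ hξ => (hξ.congr hc).hasMovingAverage hμ hcan,
      solvesExtremal_of_isLeastFavorable ha hμ hcan h1,
      (integral_congr_ae hc).trans (integral_factorDensity_of_l2sq hcan hP₀ hn'),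
      (isOptimalCharacteristic_hFun ha hμ hcan).congr hc', h2⟩
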